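/- **Conventions.** $\lambda_2$ is surface area (two-dimensional Hausdorff measure normalised to Lebesgue measure on planes), $\lambda_3$ is Lebesgue measure in $\mathbb R^3$, $\mathbb R_0^+=[0,\infty)$, $]x,y[$ is the open segment. An open set $S\subseteq\mathbb R^3$ is called *polyhedral* if $\overline S$ is a finite union of convex polytopes and $S=\operatorname{int}\overline S$ (so $S$ is bounded and lies locally on one side of its boundary). $\partial_{\rm reg}S$ is the set of $x\in\partial S$ at which $S$ has an outer unit normal $\vec n_S(x)$ (i.e. near $x$, $S$ is the open half space $\{y:(y-x)\cdot\vec n_S(x)<0\}$). **Model.** $\Omega,\Omega_{\rm s},\Omega_{\rm g}\subseteq\mathbb R^3$ are nonempty, open, polyhedral, $\overline\Omega=\overline\Omega_{\rm s}\cup\overline\Omega_{\rm g}$, $\Omega_{\rm s}\cap\Omega_{\rm g}=\emptyset$, and $\partial\Omega_{\rm s}$ is the disjoint union of $\partial\Omega$ and $\Sigma:=\partial\Omega_{\rm g}$. Put $C:=$ closed convex hull of $\Omega$, $O:=\operatorname{int}(C)\setminus\overline\Omega$, $\Gamma_\Omega:=\overline\Omega\cap\overline O$, $\Gamma_{\rm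 ph}:=\partial C\cap\partial O$. Let $T,\sigma,\theta_{\rm ext},C_\varepsilon>0$ and, for $m\in\{{\rm s,g}\}$, $\kappa_m\ge0$; $\varepsilon_m:\mathbb R_0^+\to\mathbb R_0^+$ continuous with $\varepsilon_m(\theta_2)\ge(\theta_2-\theta_1)C_\varepsilon+\varepsilon_m(\theta_1)$ for $\theta_2\ge\theta_1\ge0$; $0\le f_m\in L^\infty(]0,T[\times\Omega_m)$; let $\theta_{\rm init}\in L^\infty(\Omega)$ with $\theta_{\rm init}>0$ a.e.; and let $\epsilon:\mathbb R_0^+\to\,]0,1]$ satisfy, for every $r\ge0$, $$L_{\epsilon,r}:=\sup\Big\{\tfrac{|\epsilon(a)-\epsilon(b)|}{|a-b|}:a,b\in[0,r],\ a\ne b\Big\}<\infty .$$ **Discretization.** $0=t_0<\dots<t_N=T$, $k_\nu:=t_\nu-t_{\nu-1}$. $(\omega_i)_{i\in I}$ is a finite family of nonempty, connected, open, polyhedral, pairwise disjoint subsets of $\Omega$ with $\overline\Omega=\bigcup_i\overline\omega_i$; $\omega_{m,i}:=\omega_i\cap\Omega_m$, $I_m:=\{i:\omega_{m,i}\ne\emptyset\}$,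 $\mathrm{nb}_m(i):=\{j\in I_m\setminus\{i\}:\lambda_2(\partial\omega_{m,i}\cap\partial\omega_{m,j})\ne0\}$. It is assumed that $\partial_{\rm reg}\omega_{{\rm s},i}\cap\Sigma=\partial_{\rm reg}\omega_{{\rm g},i}\cap\Sigma$ for each $i$, and there are points $x_i\in\overline\omega_i$ such that: $x_i\in\overline\omega_{m,i}$ if $i\in I_m$; $x_i\in\overline\omega_i\cap\Gamma_\Omega$ if $\lambda_2(\overline\omega_i\cap\Gamma_\Omega)\ne0$; $x_i\in\overline\omega_i\cap\overline{\partial\Omega\setminus\Gamma_\Omega}$ if $\lambda_2(\overline\omega_i\cap(\partial\Omega\setminus\Gamma_\Omega))\ne0$; and, if $i\ne j$ and $\lambda_2(\partial\omega_i\cap\partial\omega_j)\ne0$, then $x_i\ne x_j$ and $\vec n_{\omega_i}=(x_j-x_i)/\|x_j-x_i\|_2$ a.e. on $\partial\omega_i\cap\partial\omega_j$. $(\zeta_\alpha)_{\alpha\in I_\Omega}$ and $(\zeta_\alpha)_{\alpha\in I_\Sigma}$ are finite families (with disjoint index sets) of nonempty, connected, polyhedral (i.e. $\overline\zeta_\alpha$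 and $\overline\zeta_\alpha\setminus\zeta_\alpha$ are finite unions of convex polytopes), relatively open subsets of $\Gamma_\Omega$ and $\Sigma$, respectively, each contained in a plane; each family is pairwise disjoint, and the closures cover $\Gamma_\Omega$ and $\Sigma$, respectively. For each $\alpha\in I_\Omega$ (resp. $\alpha\in I_\Sigma$) there is a unique $i(\alpha)\in I$ with $\zeta_\alpha\subseteq\partial\omega_{i(\alpha)}\cap\Gamma_\Omega$ (resp. $\zeta_\alpha\subseteq\partial\omega_{{\rm s},i(\alpha)}\cap\Sigma$), and $x_{i(\alpha)}\in\overline\zeta_\alpha$. Put $J_{\Omega,i}:=\{\alpha\in I_\Omega:\lambda_2(\zeta_\alpha\cap\partial\omega_i)\ne0\}$, $J_{\Sigma,i}:=\{\alpha\in I_\Sigma:\lambda_2(\zeta_\alpha\cap\partial\omega_{{\rm s},i})\ne0\}$. The numbers $f_{m,\nu,i}$ ($1\le\nu\le N$, $i\in I$) and $\theta_{{\rm init},i}$ satisfy $0\le\operatorname{ess\,inf}f_m\le f_{m,\nu,i}\le\|f_m\|_\infty$ on $]t_{\nu-1},t_\nu[\times\omega_{m,i}$ (if $i\in I_m$) and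 $0\le\operatorname{ess\,inf}\theta_{\rm init}\le\theta_{{\rm init},i}\le\|\theta_{\rm init}\|_\infty$ on $\omega_i$. **Radiation terms.** For a cavity $A\in\{\Omega_{\rm g},O\}$, let $\vec n$ be the unit normal on $\partial A$ pointing into $A$ (on walls of the solid, this is the outer normal of the solid), and for $x,y\in\partial A$ let $$\omega(x,y):=\frac{(\vec n(y)\cdot(x-y))\,(\vec n(x)\cdot(y-x))}{\pi\,((y-x)\cdot(y-x))^2},\qquad \Lambda(x,y):=\begin{cases}1&\text{if }]x,y[\,\subseteq A,\\0&\text{otherwise.}\end{cases}$$ With $\zeta_{\rm ph}:=\Gamma_{\rm ph}$, let $\Lambda_{\alpha,\beta}:=\int_{\zeta_\alpha\times\zeta_\beta}\Lambda\,\omega$, using $A=\Omega_{\rm g}$ for $\alpha,\beta\in I_\Sigma$ and $A=O$ for $\alpha,\beta\in I_\Omega\cup\{{\rm ph}\}$. For $\vec u\in(\mathbb R_0^+)^{I_\Omega}$, resp. $(\mathbb R_0^+)^{I_\Sigma}$, let $\vec G(\vec u)$ be the matrix with entries $\delta_{\alpha\beta}\lambda_2(\zeta_\alpha)-(1-\epsilon(u_\alpha))\Lambda_{\alpha,\beta}$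 (which is invertible), $E_\alpha(\vec u):=\sigma\epsilon(u_\alpha)u_\alpha^4\lambda_2(\zeta_\alpha)$, $E_{{\rm ph},\alpha}(\vec u):=\sigma(1-\epsilon(u_\alpha))\theta_{\rm ext}^4\Lambda_{\alpha,{\rm ph}}$, and $$\vec R_\Gamma:=\vec G^{-1}(\vec E+\vec E_{\rm ph}),\quad V_{\Gamma,\alpha}(\vec u):=\epsilon(u_\alpha)\sum_{\beta\in I_\Omega}R_{\Gamma,\beta}(\vec u)\Lambda_{\alpha,\beta}+\sigma\epsilon(u_\alpha)\theta_{\rm ext}^4\Lambda_{\alpha,{\rm ph}},$$ $$\vec R_\Sigma:=\vec G^{-1}\vec E,\quad V_{\Sigma,\alpha}(\vec u):=\epsilon(u_\alpha)\sum_{\beta\in I_\Sigma}R_{\Sigma,\beta}(\vec u)\Lambda_{\alpha,\beta}.$$ **Scheme.** For $\tilde{\vec u},\vec u\in(\mathbb R_0^+)^I$, $i\in I$, $1\le\nu\le N$, with $\vec u|_{I_\Omega}:=(u_{i(\alpha)})_{\alpha\in I_\Omega}$, $\vec u|_{I_\Sigma}:=(u_{i(\alpha)})_{\alpha\in I_\Sigma}$,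 let $$\begin{aligned}\mathcal H_{\nu,i}(\tilde{\vec u},\vec u):={}&k_\nu^{-1}\sum_{m}(\varepsilon_m(u_i)-\varepsilon_m(\tilde u_i))\lambda_3(\omega_{m,i})-\sum_m\kappa_m\sum_{j\in\mathrm{nb}_m(i)}\frac{u_j-u_i}{\|x_i-x_j\|_2}\lambda_2(\partial\omega_{m,i}\cap\partial\omega_{m,j})\\&+\sigma\epsilon(u_i)u_i^4\lambda_2(\partial\omega_{{\rm s},i}\cap\Gamma_\Omega)-\sum_{\alpha\in J_{\Omega,i}}V_{\Gamma,\alpha}(\vec u|_{I_\Omega})\\&+\sigma\epsilon(u_i)(u_i^4-\theta_{\rm ext}^4)\lambda_2(\partial\omega_{{\rm s},i}\cap(\partial\Omega\setminus\Gamma_\Omega))\\&+\sigma\epsilon(u_i)u_i^4\lambda_2(\omega_i\cap\Sigma)-\sum_{\alpha\in J_{\Sigma,i}}V_{\Sigma,\alpha}(\vec u|_{I_\Sigma})-\sum_mf_{m,\nu,i}\lambda_3(\omega_{m,i}).\end{aligned}$$ Let $$B_{f,\nu}:=\max_i\sum_mf_{m,\nu,i}\tfrac{\lambda_3(\omega_{m,i})}{\lambda_3(\omega_i)},\quad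 m(\tilde{\vec u}):=\min\{\theta_{\rm ext},\min_i\tilde u_i\},\quad M_\nu(\tilde{\vec u}):=\max\{\theta_{\rm ext},\max_i\tilde u_i+\tfrac{k_\nu}{C_\varepsilon}B_{f,\nu}\},$$ $$L_1:=\sigma\max_i\tfrac{\lambda_2(\partial\omega_{{\rm s},i}\cap\Gamma_\Omega)}{\lambda_3(\omega_i)},\quad L_2:=\sigma\max_i\tfrac{\lambda_2(\partial\omega_{{\rm s},i}\cap(\partial\Omega\setminus\Gamma_\Omega))}{\lambda_3(\omega_i)},\quad L_3:=\sigma\max_i\tfrac{\lambda_2(\omega_i\cap\Sigma)}{\lambda_3(\omega_i)},$$ and, with $\epsilon_{\min,r}:=\min_{[0,r]}\epsilon$ and $\mathrm{var}^-\epsilon(r)$ the negative variation of $\epsilon$ on $[0,r]$ (the supremum of $\sum_j\max\{0,\epsilon(s_{j-1})-\epsilon(s_j)\}$ over all $0=s_0<\dots<s_K=r$), $$l^1_g(r):=4\,\mathrm{var}^-\epsilon(r)\,r^3+L_{\epsilon,r}r^4,\quad l_g^2(r):=4\epsilon_{\min,r}^{-1}r^3+\max\{r^4,\theta_{\rm ext}^4\}L_{\epsilon,r}(2\epsilon_{\min,r}^{-1}+1),\quad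 l_g^3(r):=L_{\epsilon,r}\theta_{\rm ext}^4.$$ **Claim.** Let $1\le n\le N$ and let $\vec u_0,\dots,\vec u_{n-1}\in(\mathbb R_0^+)^I$ satisfy $u_{0,i}=\theta_{{\rm init},i}$ and $\mathcal H_{\nu,i}(\vec u_{\nu-1},\vec u_\nu)=0$ for all $i\in I$, $1\le\nu\le n-1$. Then every $\vec u_n\in(\mathbb R_0^+)^I$ with $\mathcal H_{n,i}(\vec u_{n-1},\vec u_n)=0$ for all $i\in I$ lies in $[m(\vec u_{n-1}),M_n(\vec u_{n-1})]^I$. If, moreover, with $M:=M_n(\vec u_{n-1})$, $$k_n\big((L_1+L_2+L_3)\,l_g^1(M)+(L_1+L_3)\,l_g^2(M)+L_2\,l_g^3(M)\big)<C_\varepsilon,$$ then there is a unique $\vec u_n\in(\mathbb R_0^+)^I$ with $\mathcal H_{n,i}(\vec u_{n-1},\vec u_n)=0$ for all $i\in I$. -/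

import Mathlib

open MeasureTheory Set
open scoped ENNReal

noncomputable section

namespace RadHeat

/-- Three-dimensional Euclidean space. -/
abbrev E3 : Type := EuclideanSpace ℝ (Fin 3)

/-- Two-dimensional area, i.e. the two-dimensional Hausdorff measure normalised so that it agrees
with Lebesgue measure on planes. -/
def area : Measure E3 := Measure.euclideanHausdorffMeasure 2

/-! ### Polyhedral sets, normals, view factors -/

/-- A finite union of convex polytopes (convex hulls of finite sets) of any dimension. -/
def IsPolytopeUnion (S : Set E3) : Prop :=
  ∃ F : Finset (Finset E3), S = ⋃ V ∈ F, convexHull ℝ (V : Set E3)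

/-- A bounded open polyhedral set: an open set that lies locally on one side of its boundary
(i.e. it is the interior of its closure) and whose closure is a finite union of convex polytopes. -/
def IsPolyhedral (S : Set E3) : Prop :=
  IsOpen S ∧ interior (closure S) = S ∧ IsPolytopeUnion (closure S)

/-- A polyhedral boundary element of the surface `Γ`: nonvoid, connected, relatively open in `Γ`,
contained in a two-dimensional affine plane, with closure and relative boundary consisting of
finitely many convex polytopes (polygons, segments, points). -/
structure IsBoundaryElement (Γ ζ : Set E3) : Prop where
  subset : ζ ⊆ Γ
  connected : IsConnected ζ
  relOpen : ∃ U : Set E3, IsOpen U ∧ ζ = U ∩ Γ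
  planar : ∃ Q : AffineSubspace ℝ E3, Module.finrank ℝ Q.direction = 2 ∧ ζ ⊆ Q
  polyClosure : IsPolytopeUnion (closure ζ)
  polyBoundary : IsPolytopeUnion (closure ζ \ ζ)

/-- `v` is the outer unit normal vector of `S` at the boundary point `x`: near `x`, the set `S` is
the open half space `{y | ⟪y - x, v⟫ < 0}`. -/
def IsOuterNormal (S : Set E3) (x v : E3) : Prop :=
  ‖v‖ = 1 ∧ ∃ r : ℝ, 0 < r ∧ ∀ y ∈ Metric.ball x r, y ∈ S ↔ inner ℝ (y - x) v < 0

/-- The regular boundary: the boundary points at which an outer unit normal exists. (It is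
then unique.) -/
def regBoundary (S : Set E3) : Set E3 := {x | x ∈ frontier S ∧ ∃ v, IsOuterNormal S x v}

open Classical in
/-- The unit normal vector of `∂A` at `x` pointing into the cavity `A` (zero at the points of the
boundary where no normal exists). On opaque walls surrounding `A`, this is the outer unit normal
of the solid. -/
def innerNormal (A : Set E3) (x : E3) : E3 :=
  if h : ∃ v, IsOuterNormal A x v then -h.choose else 0

open Classical in
/-- The visibility factor for points of `∂A`: it is `1` if `x` and `y` see each other through the
cavity `A`, and `0` otherwise. -/
def visibility (A : Set E3) (x y : E3) : ℝ :=
  if openSegment ℝ x y ⊆ A then 1 else 0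

/-- The view factor
`(n(y) · (x - y)) (n(x) · (y - x)) / (π ((y - x) · (y - x))²)`. -/
def viewFactor (A : Set E3) (x y : E3) : ℝ :=
  (inner ℝ (innerNormal A y) (x - y) * inner ℝ (innerNormal A x) (y - x)) /
    (Real.pi * (inner ℝ (y - x) (y - x)) ^ 2)

/-- The integral of (visibility factor times view factor) over `ζ × ζ'`, with respect to area. -/
def radCoeff (A ζ ζ' : Set E3) : ℝ :=
  ∫ p, visibility A p.1 p.2 * viewFactor A p.1 p.2 ∂((area.restrict ζ).prod (area.restrict ζ'))

/-! ### Notions for functions of one variable on `[0, ∞)` -/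

/-- The difference quotients of `g` on `[0, r]`. -/
def lipQuotients (g : ℝ → ℝ) (r : ℝ) : Set ℝ :=
  {q | ∃ a ∈ Icc 0 r, ∃ b ∈ Icc 0 r, a ≠ b ∧ q = |g a - g b| / |a - b|}

/-- The optimal Lipschitz constant of `g` on `[0, r]`. -/
def lipConst (g : ℝ → ℝ) (r : ℝ) : ℝ := sSup (lipQuotients g r)

/-- The minimum of `g` on `[0, r]`. -/
def minOn (g : ℝ → ℝ) (r : ℝ) : ℝ := sInf (g '' Icc 0 r)

/-- The negative variation of `g` on `[0, r]`: the supremum of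
`∑ (-min {0, g (t_j) - g (t_{j-1})})` over the discretizations `0 = t_0 < ⋯ < t_N = r`. (It is
only used for functions that are Lipschitz on `[0, r]`, for which the supremum is finite.) -/
def negVar (g : ℝ → ℝ) (r : ℝ) : ℝ :=
  sSup {s | ∃ (N : ℕ) (t : ℕ → ℝ), t 0 = 0 ∧ t N = r ∧ (∀ j < N, t j < t (j + 1)) ∧
    s = ∑ j ∈ Finset.range N, -min 0 (g (t (j + 1)) - g (t j))}

/-! ### The continuous model -/

/-- The two phases: opaque solid and transparent gas. -/
inductive Phase where
  | solid : Phase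
  | gas : Phase

/-- The data of the heat transport model. -/
structure Model where
  /-- final time -/
  T : ℝ
  /-- the whole domain -/
  dom : Set E3
  /-- the solid and the gas domain -/
  sub : Phase → Set E3
  /-- internal energies -/
  energy : Phase → ℝ → ℝ
  /-- linear growth constant of the internal energies -/
  Ce : ℝ
  /-- thermal conductivities -/
  κ : Phase → ℝ
  /-- heat sources -/
  f : Phase → ℝ → E3 → ℝ
  /-- Boltzmann radiation constant -/
  σ : ℝ
  /-- emissivity -/
  emis : ℝ → ℝ
  /-- external temperature -/
  θext : ℝ
  /-- initial temperature -/
  θinit : E3 → ℝ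

namespace Model

variable (P : Model)

/-- The interface between solid and gas. -/
def interface : Set E3 := frontier (P.sub Phase.gas)

/-- The closed convex hull of the domain. -/
def hull : Set E3 := closure (convexHull ℝ P.dom)

/-- The open radiation region. -/
def openRegion : Set E3 := interior P.hull \ closure P.dom

/-- The part of the surface of the open radiation region that belongs to the solid. -/
def ΓΩ : Set E3 := closure P.dom ∩ closure P.openRegion

/-- The phantom closure of the open radiation region. -/
def Γph : Set E3 := frontier P.hull ∩ frontier P.openRegion

/-- The standing assumptions on the model. -/
structure Admissible : Prop where
  T_pos : 0 < P.T
  dom_nonempty : P.dom.Nonempty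
  dom_poly : IsPolyhedral P.dom
  sub_nonempty : ∀ m, (P.sub m).Nonempty
  sub_poly : ∀ m, IsPolyhedral (P.sub m)
  closure_eq : closure P.dom = closure (P.sub Phase.solid) ∪ closure (P.sub Phase.gas)
  sub_disjoint : Disjoint (P.sub Phase.solid) (P.sub Phase.gas)
  /-- the gas is enclosed by the solid -/
  frontier_eq : frontier (P.sub Phase.solid) = frontier P.dom ∪ frontier (P.sub Phase.gas)
  frontier_disjoint : Disjoint (frontier P.dom) (frontier (P.sub Phase.gas))
  energy_cont : ∀ m, ContinuousOn (P.energy m) (Ici 0)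
  energy_nonneg : ∀ m θ, 0 ≤ θ → 0 ≤ P.energy m θ
  Ce_pos : 0 < P.Ce
  energy_growth : ∀ m θ₁ θ₂, 0 ≤ θ₁ → θ₁ ≤ θ₂ →
    (θ₂ - θ₁) * P.Ce + P.energy m θ₁ ≤ P.energy m θ₂
  κ_nonneg : ∀ m, 0 ≤ P.κ m
  f_memLp : ∀ m, MemLp (fun p : ℝ × E3 => P.f m p.1 p.2) ∞
    (volume.restrict (Ioo 0 P.T ×ˢ P.sub m))
  f_nonneg : ∀ m, ∀ᵐ p ∂((volume : Measure (ℝ × E3)).restrict (Ioo 0 P.T ×ˢ P.sub m)),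
    0 ≤ P.f m p.1 p.2
  σ_pos : 0 < P.σ
  emis_pos : ∀ θ, 0 ≤ θ → 0 < P.emis θ
  emis_le_one : ∀ θ, 0 ≤ θ → P.emis θ ≤ 1
  /-- local Lipschitz continuity of the emissivity -/
  emis_lip : ∀ r, 0 ≤ r → BddAbove (lipQuotients P.emis r)
  θext_pos : 0 < P.θext
  θinit_memLp : MemLp P.θinit ∞ (volume.restrict P.dom)
  θinit_pos : ∀ᵐ x ∂(volume.restrict P.dom), 0 < P.θinit x

end Model

/-! ### Discretization -/

/-- The data of a discretization: control volumes are indexed by `I`, boundary elements of `ΓΩ` by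
`IΩ`, and boundary elements of the interface by `IS`. -/
structure Discretization (I IΩ IS : Type*) where
  /-- number of time steps -/
  N : ℕ
  /-- discrete times `t 0, …, t N` -/
  t : ℕ → ℝ
  /-- control volumes -/
  vol : I → Set E3
  /-- discretization points -/
  pt : I → E3
  /-- boundary elements on `ΓΩ` -/
  ζΩ : IΩ → Set E3
  /-- boundary elements on the interface -/
  ζS : IS → Set E3
  /-- control volume adjacent to a boundary element on `ΓΩ` -/
  iΩ : IΩ → I
  /-- control volume adjacent to a boundary element on the interface -/
  iS : IS → I
  /-- approximate heat sources in the time steps `1, …, N` -/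
  fApp : Phase → ℕ → I → ℝ
  /-- approximate initial temperature -/
  θApp : I → ℝ

namespace Discretization

variable {I IΩ IS : Type*} (D : Discretization I IΩ IS) (P : Model)

/-- The `n`-th time step size (`n ≥ 1`). -/
def k (n : ℕ) : ℝ := D.t n - D.t (n - 1)

/-- The part of the `i`-th control volume that lies in phase `m`. -/
def subVol (m : Phase) (i : I) : Set E3 := D.vol i ∩ P.sub m

/-- The space-time cylinder of the `n`-th time step over the `i`-th control volume in phase `m`. -/
def cyl (m : Phase) (n : ℕ) (i : I) : Set (ℝ × E3) :=
  Ioo (D.t (n - 1)) (D.t n) ×ˢ D.subVol P m i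

/-- The assumptions on the discretization and on the approximations of the data. -/
structure Admissible : Prop where
  t_zero : D.t 0 = 0
  t_last : D.t D.N = P.T
  t_lt : ∀ n < D.N, D.t n < D.t (n + 1)
  /-- the control volumes form a partition of the domain, up to their boundaries -/
  vol_subset : ∀ i, D.vol i ⊆ P.dom
  vol_disjoint : Pairwise (fun i j => Disjoint (D.vol i) (D.vol j))
  vol_cover : closure P.dom = ⋃ i, closure (D.vol i)
  vol_poly : ∀ i, IsPolyhedral (D.vol i)
  vol_connected : ∀ i, IsConnected (D.vol i)
  reg_eq : ∀ i, regBoundary (D.subVol P Phase.solid i) ∩ P.interface =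
    regBoundary (D.subVol P Phase.gas i) ∩ P.interface
  pt_mem : ∀ i, D.pt i ∈ closure (D.vol i)
  pt_mem_sub : ∀ m i, (D.subVol P m i).Nonempty → D.pt i ∈ closure (D.subVol P m i)
  pt_mem_ΓΩ : ∀ i, area (closure (D.vol i) ∩ P.ΓΩ) ≠ 0 → D.pt i ∈ closure (D.vol i) ∩ P.ΓΩ
  pt_mem_outer : ∀ i, area (closure (D.vol i) ∩ (frontier P.dom \ P.ΓΩ)) ≠ 0 →
    D.pt i ∈ closure (D.vol i) ∩ closure (frontier P.dom \ P.ΓΩ)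
  /-- for neighbouring control volumes, the line through the discretization points is
  perpendicular to the common interface -/
  pt_ne : ∀ i j, i ≠ j → area (frontier (D.vol i) ∩ frontier (D.vol j)) ≠ 0 → D.pt i ≠ D.pt j
  pt_normal : ∀ i j, i ≠ j → area (frontier (D.vol i) ∩ frontier (D.vol j)) ≠ 0 →
    ∀ᵐ y ∂(area.restrict (frontier (D.vol i) ∩ frontier (D.vol j))),
      IsOuterNormal (D.vol i) y (‖D.pt i - D.pt j‖⁻¹ • (D.pt j - D.pt i))
  /-- the boundary elements form partitions of `ΓΩ` and of the interface, up to their boundaries -/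
  ζΩ_elem : ∀ α, IsBoundaryElement P.ΓΩ (D.ζΩ α)
  ζΩ_disjoint : Pairwise (fun α β => Disjoint (D.ζΩ α) (D.ζΩ β))
  ζΩ_cover : P.ΓΩ = ⋃ α, closure (D.ζΩ α)
  ζS_elem : ∀ α, IsBoundaryElement P.interface (D.ζS α)
  ζS_disjoint : Pairwise (fun α β => Disjoint (D.ζS α) (D.ζS β))
  ζS_cover : P.interface = ⋃ α, closure (D.ζS α)
  /-- compatibility of boundary elements and control volumes -/
  iΩ_mem : ∀ α, D.ζΩ α ⊆ frontier (D.vol (D.iΩ α)) ∩ P.ΓΩ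
  iΩ_unique : ∀ α i, D.ζΩ α ⊆ frontier (D.vol i) ∩ P.ΓΩ → i = D.iΩ α
  iS_mem : ∀ α, D.ζS α ⊆ frontier (D.subVol P Phase.solid (D.iS α)) ∩ P.interface
  iS_unique : ∀ α i, D.ζS α ⊆ frontier (D.subVol P Phase.solid i) ∩ P.interface → i = D.iS α
  pt_iΩ : ∀ α, D.pt (D.iΩ α) ∈ closure (D.ζΩ α)
  pt_iS : ∀ α, D.pt (D.iS α) ∈ closure (D.ζS α)
  /-- the approximate sources lie between essential infimum and essential supremum -/
  fApp_lower : ∀ m n i, 1 ≤ n → n ≤ D.N → (D.subVol P m i).Nonempty →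
    0 ≤ essInf (fun p : ℝ × E3 => P.f m p.1 p.2) (volume.restrict (D.cyl P m n i)) ∧
    essInf (fun p : ℝ × E3 => P.f m p.1 p.2) (volume.restrict (D.cyl P m n i)) ≤ D.fApp m n i
  fApp_upper : ∀ m n i, 1 ≤ n → n ≤ D.N → (D.subVol P m i).Nonempty →
    D.fApp m n i ≤
      (eLpNorm (fun p : ℝ × E3 => P.f m p.1 p.2) ∞ (volume.restrict (D.cyl P m n i))).toReal
  /-- the approximate initial values lie between essential infimum and essential supremum -/
  θApp_lower : ∀ i, 0 ≤ essInf P.θinit (volume.restrict (D.vol i)) ∧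
    essInf P.θinit (volume.restrict (D.vol i)) ≤ D.θApp i
  θApp_upper : ∀ i, D.θApp i ≤ (eLpNorm P.θinit ∞ (volume.restrict (D.vol i))).toReal

/-! ### Discrete nonlocal radiation operators -/

/-- `Λ_{α,β}` for boundary elements on `ΓΩ`. -/
def ΛΩ (α β : IΩ) : ℝ := radCoeff P.openRegion (D.ζΩ α) (D.ζΩ β)

/-- `Λ_{α,ph}` for a boundary element on `ΓΩ` and the phantom closure. -/
def Λph (α : IΩ) : ℝ := radCoeff P.openRegion (D.ζΩ α) P.Γph

/-- `Λ_{α,β}` for boundary elements on the interface. -/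
def ΛS (α β : IS) : ℝ := radCoeff (P.sub Phase.gas) (D.ζS α) (D.ζS β)

/-- The vector of emitted radiation on `ΓΩ`. -/
def EΓ (u : IΩ → ℝ) (α : IΩ) : ℝ := P.σ * P.emis (u α) * u α ^ 4 * area.real (D.ζΩ α)

/-- The vector of emitted radiation on the interface. -/
def ES (u : IS → ℝ) (α : IS) : ℝ := P.σ * P.emis (u α) * u α ^ 4 * area.real (D.ζS α)

/-- The vector of reflected radiation coming from the phantom closure. -/
def Eph (u : IΩ → ℝ) (α : IΩ) : ℝ :=
  P.σ * (1 - P.emis (u α)) * P.θext ^ 4 * D.Λph P α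

open Classical in
/-- The radiosity matrix on `ΓΩ`. -/
def GΓ (u : IΩ → ℝ) : Matrix IΩ IΩ ℝ := fun α β =>
  (if α = β then area.real (D.ζΩ α) else 0) - (1 - P.emis (u α)) * D.ΛΩ P α β

open Classical in
/-- The radiosity matrix on the interface. -/
def GS (u : IS → ℝ) : Matrix IS IS ℝ := fun α β =>
  (if α = β then area.real (D.ζS α) else 0) - (1 - P.emis (u α)) * D.ΛS P α β

section Radiation

variable [Fintype IΩ] [Fintype IS]

open Classical in
/-- The radiosity on `ΓΩ`. -/
def RΓ (u : IΩ → ℝ) : IΩ → ℝ := (D.GΓ P u)⁻¹.mulVec (fun α => D.EΓ P u α + D.Eph P u α)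

open Classical in
/-- The radiosity on the interface. -/
def RS (u : IS → ℝ) : IS → ℝ := (D.GS P u)⁻¹.mulVec (D.ES P u)

/-- The absorbed radiation on `ΓΩ`. -/
def VΓ (u : IΩ → ℝ) (α : IΩ) : ℝ :=
  P.emis (u α) * ∑ β, D.RΓ P u β * D.ΛΩ P α β
    + P.σ * P.emis (u α) * P.θext ^ 4 * D.Λph P α

/-- The absorbed radiation on the interface. -/
def VS (u : IS → ℝ) (α : IS) : ℝ :=
  P.emis (u α) * ∑ β, D.RS P u β * D.ΛS P α β

end Radiation

/-! ### The finite volume scheme -/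

/-- Area of the common boundary of the parts of two control volumes in phase `m`. -/
def faceArea (m : Phase) (i j : I) : ℝ :=
  area.real (frontier (D.subVol P m i) ∩ frontier (D.subVol P m j))

/-- Area of the part of a control volume's solid boundary on `ΓΩ`. -/
def areaΓΩ (i : I) : ℝ := area.real (frontier (D.subVol P Phase.solid i) ∩ P.ΓΩ)

/-- Area of the part of a control volume's solid boundary on the remaining outer boundary. -/
def areaOuter (i : I) : ℝ :=
  area.real (frontier (D.subVol P Phase.solid i) ∩ (frontier P.dom \ P.ΓΩ))

/-- Area of the part of the interface inside a control volume. -/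
def areaS (i : I) : ℝ := area.real (D.vol i ∩ P.interface)

section Scheme

variable [Fintype I] [Fintype IΩ] [Fintype IS]

open Classical in
/-- The set `nb_m(i)` of neighbours of the `i`-th control volume in phase `m`. -/
def nb (m : Phase) (i : I) : Finset I :=
  Finset.univ.filter fun j => (D.subVol P m j).Nonempty ∧ j ≠ i ∧
    area (frontier (D.subVol P m i) ∩ frontier (D.subVol P m j)) ≠ 0

open Classical in
/-- The boundary elements on `ΓΩ` adjacent to the `i`-th control volume. -/
def JΩ (i : I) : Finset IΩ :=
  Finset.univ.filter fun α => area (D.ζΩ α ∩ frontier (D.vol i)) ≠ 0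

open Classical in
/-- The boundary elements on the interface adjacent to the `i`-th control volume. -/
def JS (i : I) : Finset IS :=
  Finset.univ.filter fun α => area (D.ζS α ∩ frontier (D.subVol P Phase.solid i)) ≠ 0

/-- Change of internal energy in phase `m` during the `n`-th time step, per unit time. -/
def energyTerm (m : Phase) (n : ℕ) (w u : I → ℝ) (i : I) : ℝ :=
  (D.k n)⁻¹ * ((P.energy m (u i) - P.energy m (w i)) * volume.real (D.subVol P m i))

/-- Discrete conduction in phase `m`. -/
def conductionTerm (m : Phase) (u : I → ℝ) (i : I) : ℝ :=
  P.κ m * ∑ j ∈ D.nb P m i, (u j - u i) / ‖D.pt i - D.pt j‖ * D.faceArea P m i j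

/-- Discrete heat source in phase `m`. -/
def sourceTerm (m : Phase) (n : ℕ) (i : I) : ℝ :=
  D.fApp m n i * volume.real (D.subVol P m i)

/-- The operator `ℋ_{n,i}(w, u)` of the fully implicit finite volume scheme, where `w` is the
vector of the previous time step. -/
def H (n : ℕ) (w u : I → ℝ) (i : I) : ℝ :=
  (D.energyTerm P Phase.solid n w u i + D.energyTerm P Phase.gas n w u i)
  - (D.conductionTerm P Phase.solid u i + D.conductionTerm P Phase.gas u i)
  + P.σ * P.emis (u i) * u i ^ 4 * D.areaΓΩ P i
  - ∑ α ∈ D.JΩ i, D.VΓ P (fun β => u (D.iΩ β)) α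
  + P.σ * P.emis (u i) * (u i ^ 4 - P.θext ^ 4) * D.areaOuter P i
  + P.σ * P.emis (u i) * u i ^ 4 * D.areaS P i
  - ∑ α ∈ D.JS P i, D.VS P (fun β => u (D.iS β)) α
  - (D.sourceTerm P Phase.solid n i + D.sourceTerm P Phase.gas n i)

/-- `(u 0, …, u n)` is a nonnegative solution to the scheme up to time step `n`. -/
def IsNonnegSolution (n : ℕ) (u : ℕ → I → ℝ) : Prop :=
  (∀ ν ≤ n, ∀ i, 0 ≤ u ν i) ∧ (∀ i, u 0 i = D.θApp i) ∧
    ∀ ν, 1 ≤ ν → ν ≤ n → ∀ i, D.H P ν (u (ν - 1)) (u ν) i = 0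

/-! ### Bounds and time step condition (the suprema over `I` are maxima, as `I` is finite) -/

/-- The constant `B_{f,n}`. -/
def Bf (n : ℕ) : ℝ :=
  ⨆ i, (D.fApp Phase.solid n i * (volume.real (D.subVol P Phase.solid i) / volume.real (D.vol i))
    + D.fApp Phase.gas n i * (volume.real (D.subVol P Phase.gas i) / volume.real (D.vol i)))

/-- The constant `L_{V,ΓΩ}`. -/
def LΓΩ : ℝ := P.σ * ⨆ i, D.areaΓΩ P i / volume.real (D.vol i)

/-- The constant `L_{V,∂Ω∖ΓΩ}`. -/
def LOuter : ℝ := P.σ * ⨆ i, D.areaOuter P i / volume.real (D.vol i)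

/-- The constant `L_{V,Σ}`. -/
def LS : ℝ := P.σ * ⨆ i, D.areaS P i / volume.real (D.vol i)

/-- The upper bound `M_n(w)`. -/
def upper (n : ℕ) (w : I → ℝ) : ℝ := max P.θext ((⨆ i, w i) + D.k n / P.Ce * D.Bf P n)

end Scheme

end Discretization

/-- The lower bound `m(w)`. -/
def Model.lower {I : Type*} (P : Model) (w : I → ℝ) : ℝ := min P.θext (⨅ i, w i)

/-- The function `l_g^1`. -/
def Model.lg1 (P : Model) (r : ℝ) : ℝ := 4 * negVar P.emis r * r ^ 3 + lipConst P.emis r * r ^ 4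

/-- The function `l_g^2`. -/
def Model.lg2 (P : Model) (r : ℝ) : ℝ :=
  4 * (minOn P.emis r)⁻¹ * r ^ 3
    + max (r ^ 4) (P.θext ^ 4) * lipConst P.emis r * (2 * (minOn P.emis r)⁻¹ + 1)

/-- The function `l_g^3`. -/
def Model.lg3 (P : Model) (r : ℝ) : ℝ := lipConst P.emis r * P.θext ^ 4

/-- The smallness condition on the `n`-th time step, where `w` is the vector of the previous time
step. -/
def Discretization.StepCondition {I IΩ IS : Type*} [Fintype I] [Fintype IΩ] [Fintype IS]
    (D : Discretization I IΩ IS) (P : Model) (n : ℕ) (w : I → ℝ) : Prop :=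
  D.k n * ((D.LΓΩ P + D.LOuter P + D.LS P) * P.lg1 (D.upper P n w)
    + (D.LΓΩ P + D.LS P) * P.lg2 (D.upper P n w)
    + D.LOuter P * P.lg3 (D.upper P n w)) < P.Ce

end RadHeat

end

/-! Each equation of a time step balances stored energy, exchange with neighbouring cells, emission
and absorption. The view factors seen from a boundary element add up to its area. Hence a constant
radiosity is in equilibrium with a constant temperature, and the radiosity matrix is strictly
diagonally dominant, row `α` having slack at least `e α * a α`. The resulting minimum principle
`radiosity_nonneg` confines the incoming radiation between `σ * c ^ 4` times the area for lower and
upper bounds `c` of all temperatures, `θext` included. Applied to the difference of two solutions,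
it makes the incoming radiation Lipschitz in the temperatures (`IsRadiosity.abs_sub_le`).

For the bounds, look at a cell where the temperature is extremal: beyond the claimed bound all terms
of its balance push in the same direction, the energy term strictly. The upper bound contains the
rise that the sources can cause during one step.

For unique solvability, freeze the neighbouring values and the absorbed radiation at `v` and solve
each scalar equation for the cell's own temperature. Under the step condition the local terms
increase with a slope larger than the Lipschitz constant of the absorbed radiation, while the
exchange adds the same sum of conductances to both. So the map `v ↦` solution is a contraction of
the box `[0, M]^I` in the maximum norm (`BalanceSystem.existsUnique_of_slope`), and the bounds force
every nonnegative solution into that box.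

What remains is geometric and is collected in `Discretization.Conservative`. All boundaries lie in
finitely many planes; points on two different planes form a null set, and at the other boundary
points the sets are half spaces locally. From such a point almost every inward ray first hits the
boundary at a regular point, so the cones over the visible parts of the faces tile the inward half
space. The weight `⟪z, ν⟫ exp (-‖z‖²)` has integral `π / 2` over this half space, and over a cone it
integrates to `π / 2` times the view factor integral of the face. Therefore the view factors sum up
to one (`lintegral_viewFactor`). The same local half space picture matches boundary elements with
control volumes, and a projection argument shows that boundary elements have positive area. -/

namespace RadHeat

/-! ### The radiosity system: comparison and stability -/

section Radiosity

variable {J : Type*} [Fintype J]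

/-- The incoming radiation for radiosities `R`, view factor coefficients `Λ`, and radiation `q`
from outside. -/
def incoming (Λ : J → J → ℝ) (q R : J → ℝ) (α : J) : ℝ := ∑ β, R β * Λ α β + q α

open Classical in
/-- The matrix of the radiosity system for areas `a`, view factor coefficients `Λ` and
emissivities `e`. -/
noncomputable def radMatrix (a : J → ℝ) (Λ : J → J → ℝ) (e : J → ℝ) : Matrix J J ℝ := fun α β =>
  (if α = β then a α else 0) - (1 - e α) * Λ α β

lemma incoming_mono {Λ : J → J → ℝ} (hΛ : ∀ α β, 0 ≤ Λ α β) {q q' R R' : J → ℝ}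
    (hR : ∀ α, R α ≤ R' α) (hq : ∀ α, q α ≤ q' α) (α : J) :
    incoming Λ q R α ≤ incoming Λ q' R' α :=
  add_le_add (Finset.sum_le_sum fun β _ => mul_le_mul_of_nonneg_right (hR β) (hΛ α β)) (hq α)

lemma incoming_const {a p : J → ℝ} {Λ : J → J → ℝ} (hrow : ∀ α, ∑ β, Λ α β + p α = a α)
    (c : ℝ) (α : J) : incoming Λ (fun α => c * p α) (fun _ => c) α = c * a α := by
  rw [incoming, ← Finset.mul_sum, ← mul_add, hrow]

open Classical in
lemma radMatrix_mulVec (a : J → ℝ) (Λ : J → J → ℝ) (e R : J → ℝ) (α : J) :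
    (radMatrix a Λ e).mulVec R α = a α * R α - (1 - e α) * ∑ β, R β * Λ α β := by
  have h : ∀ β, radMatrix a Λ e α β * R β
      = (if α = β then a α * R β else 0) - (1 - e α) * (R β * Λ α β) := fun β => by
    rw [radMatrix, sub_mul, ite_mul, zero_mul]; ring
  simp only [Matrix.mulVec, dotProduct, h, Finset.sum_sub_distrib, Finset.sum_ite_eq,
    Finset.mem_univ, if_true, Finset.mul_sum]

-- Strict diagonal dominance by rows: the row sums of `Λ` are at most `a`, and the factor `1 - e α <
-- 1` leaves a gap.
open Classical in
lemma radMatrix_isUnit_det {a p : J → ℝ} {Λ : J → J → ℝ} (ha : ∀ α, 0 < a α)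
    (hΛ : ∀ α β, 0 ≤ Λ α β) (hp : ∀ α, 0 ≤ p α) (hrow : ∀ α, ∑ β, Λ α β + p α = a α)
    {e : J → ℝ} (he : ∀ α, 0 < e α) (he1 : ∀ α, e α ≤ 1) : IsUnit (radMatrix a Λ e).det := by
  refine isUnit_iff_ne_zero.2 (det_ne_zero_of_sum_row_lt_diag fun α => ?_)
  have h1 : ∑ β ∈ Finset.univ.erase α, ‖radMatrix a Λ e α β‖
      = ∑ β ∈ Finset.univ.erase α, (1 - e α) * Λ α β := by
    refine Finset.sum_congr rfl fun β hβ => ?_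
    rw [radMatrix, if_neg (Finset.ne_of_mem_erase hβ).symm, zero_sub, norm_neg, Real.norm_eq_abs,
      abs_of_nonneg (mul_nonneg (sub_nonneg.2 (he1 α)) (hΛ α β))]
  rw [h1, ← Finset.mul_sum]
  have h2 := Finset.add_sum_erase Finset.univ (Λ α) (Finset.mem_univ α)
  have h3 := hrow α
  have h4 : ∑ β, Λ α β ≤ a α := by linarith [hp α]
  have h5 : (1 - e α) * ∑ β, Λ α β < a α := by
    have := mul_le_mul_of_nonneg_left h4 (sub_nonneg.2 (he1 α))
    nlinarith [mul_pos (he α) (ha α)]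
  have h6 : radMatrix a Λ e α α = a α - (1 - e α) * Λ α α := by simp [radMatrix]
  rw [h6]
  refine lt_of_lt_of_le ?_ (le_abs_self _)
  rw [← h2, mul_add] at h5
  linarith

/-- Minimum principle for the radiosity system. -/
lemma radiosity_nonneg {a p : J → ℝ} {Λ : J → J → ℝ} (ha : ∀ α, 0 < a α)
    (hΛ : ∀ α β, 0 ≤ Λ α β) (hp : ∀ α, 0 ≤ p α) (hrow : ∀ α, ∑ β, Λ α β + p α = a α)
    {e : J → ℝ} (he : ∀ α, 0 < e α) (he1 : ∀ α, e α ≤ 1) {R : J → ℝ} {s : ℝ} (hs : 0 ≤ s)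
    (hR : ∀ α, -(e α * s * a α) ≤ a α * R α - (1 - e α) * ∑ β, R β * Λ α β) (α : J) :
    -s ≤ R α := by
  have : Nonempty J := ⟨α⟩
  -- At a minimum of `R` below `-s ≤ 0`, the bound `∑ Λ ≤ a` gives `∑ R Λ ≥ R γ * a γ`. Then the
  -- right side of `hR γ` is at most `e γ * a γ * R γ`, which is less than `-(e γ * s * a γ)`.
  obtain ⟨γ, hγ⟩ := Finite.exists_min R
  refine le_trans ?_ (hγ α)
  by_contra! hlt
  have h1 : R γ * ∑ β, Λ γ β ≤ ∑ β, R β * Λ γ β := by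
    rw [Finset.mul_sum]
    exact Finset.sum_le_sum fun β _ => mul_le_mul_of_nonneg_right (hγ β) (hΛ γ β)
  have h2 : R γ * a γ ≤ R γ * ∑ β, Λ γ β := by
    have := hrow γ
    nlinarith [hp γ, mul_nonneg (hp γ) (by linarith : 0 ≤ -R γ)]
  have h3 := mul_le_mul_of_nonneg_left (h2.trans h1) (sub_nonneg.2 (he1 γ))
  have h4 := hR γ
  nlinarith [mul_pos (mul_pos (he γ) (ha γ)) (sub_pos.2 hlt)]

/-- The radiosity system. -/
structure IsRadiosity (a p : J → ℝ) (Λ : J → J → ℝ) (σ Θ : ℝ) (e U R : J → ℝ) : Prop where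
  eq : ∀ α, a α * R α =
    (1 - e α) * incoming Λ (fun α => σ * Θ * p α) R α + σ * e α * U α * a α

/-- The constant radiosity `σ * c` solves the system for `U = Θ = c` because of `hrow`. So `R - σ *
c` has nonnegative data, and the minimum principle applies with `s = 0`. -/
lemma IsRadiosity.lower {a p : J → ℝ} {Λ : J → J → ℝ} (ha : ∀ α, 0 < a α)
    (hΛ : ∀ α β, 0 ≤ Λ α β) (hp : ∀ α, 0 ≤ p α) (hrow : ∀ α, ∑ β, Λ α β + p α = a α)
    {e U R : J → ℝ} (he : ∀ α, 0 < e α) (he1 : ∀ α, e α ≤ 1) {σ Θ c : ℝ} (hσ : 0 ≤ σ)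
    (h : IsRadiosity a p Λ σ Θ e U R) (hU : ∀ α, c ≤ U α) (hΘ : c ≤ Θ) (α : J) :
    σ * c * a α ≤ incoming Λ (fun α => σ * Θ * p α) R α := by
  have key : ∀ α, σ * c ≤ R α := by
    intro α
    have := radiosity_nonneg ha hΛ hp hrow he he1 (R := fun α => R α - σ * c) le_rfl ?_ α
    · linarith
    · intro β
      have h1 := h.eq β
      have h2 := incoming_const hrow (σ * c) β
      simp only [incoming] at h1 h2
      simp only [sub_mul, Finset.sum_sub_distrib]
      have h3 : 0 ≤ (1 - e β) * (σ * (Θ - c) * p β) :=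
        mul_nonneg (sub_nonneg.2 (he1 β)) (mul_nonneg (mul_nonneg hσ (sub_nonneg.2 hΘ)) (hp β))
      have h4 : 0 ≤ σ * e β * (U β - c) * a β := by
        have := he β; have := ha β; have := sub_nonneg.2 (hU β); positivity
      have h5 : ∑ x, σ * c * Λ β x = σ * c * a β - σ * c * p β := by linarith
      rw [h5]
      nlinarith
  rw [← incoming_const hrow]
  exact incoming_mono hΛ key
    (fun β => mul_le_mul_of_nonneg_right (mul_le_mul_of_nonneg_left hΘ hσ) (hp β)) α

/-- The system is linear and imposes no sign on `U` and `Θ`, so negation turns lower bounds into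
upper ones. -/
lemma IsRadiosity.neg {a p : J → ℝ} {Λ : J → J → ℝ} {e U R : J → ℝ} {σ Θ : ℝ}
    (h : IsRadiosity a p Λ σ Θ e U R) :
    IsRadiosity a p Λ σ (-Θ) e (fun α => -U α) (fun α => -R α) := by
  refine ⟨fun α => ?_⟩
  have := h.eq α
  simp only [incoming, neg_mul, Finset.sum_neg_distrib] at this ⊢
  linarith

lemma IsRadiosity.upper {a p : J → ℝ} {Λ : J → J → ℝ} (ha : ∀ α, 0 < a α)
    (hΛ : ∀ α β, 0 ≤ Λ α β) (hp : ∀ α, 0 ≤ p α) (hrow : ∀ α, ∑ β, Λ α β + p α = a α)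
    {e U R : J → ℝ} (he : ∀ α, 0 < e α) (he1 : ∀ α, e α ≤ 1) {σ Θ c : ℝ} (hσ : 0 ≤ σ)
    (h : IsRadiosity a p Λ σ Θ e U R) (hU : ∀ α, U α ≤ c) (hΘ : Θ ≤ c) (α : J) :
    incoming Λ (fun α => σ * Θ * p α) R α ≤ σ * c * a α := by
  have := h.neg.lower ha hΛ hp hrow he he1 hσ (c := -c) (fun α => neg_le_neg (hU α))
    (neg_le_neg hΘ) α
  simp only [incoming, neg_mul, mul_neg, Finset.sum_neg_distrib] at this ⊢
  linarith

/-- `R - R'` solves the system with emissivities `e` and data `(e' - e) (K' - σ U' a) + σ e (U - U')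
a`, where `K'` is the incoming radiation of `R'`. The comparison principle puts both `K'` and `σ U'
a` into `[0, σ c a]`, which bounds the first term; `radiosity_nonneg` then bounds `R - R'` from
below. -/
lemma IsRadiosity.sub_le {a p : J → ℝ} {Λ : J → J → ℝ} (ha : ∀ α, 0 < a α)
    (hΛ : ∀ α β, 0 ≤ Λ α β) (hp : ∀ α, 0 ≤ p α) (hrow : ∀ α, ∑ β, Λ α β + p α = a α)
    {e e' U U' R R' : J → ℝ} {σ Θ c l s emin : ℝ} (hσ : 0 ≤ σ) (hc : 0 ≤ Θ) (hΘ : Θ ≤ c)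
    (hemin : 0 < emin) (he : ∀ α, emin ≤ e α) (he1 : ∀ α, e α ≤ 1)
    (he' : ∀ α, emin ≤ e' α) (he1' : ∀ α, e' α ≤ 1)
    (h : IsRadiosity a p Λ σ Θ e U R) (h' : IsRadiosity a p Λ σ Θ e' U' R')
    (hU0' : ∀ α, 0 ≤ U' α) (hU' : ∀ α, U' α ≤ c)
    (hl : 0 ≤ l) (hs : 0 ≤ s)
    (hee : ∀ α, |e α - e' α| ≤ l) (hUU : ∀ α, |U α - U' α| ≤ s) (α : J) :
    incoming Λ (fun α => σ * Θ * p α) R' α - incoming Λ (fun α => σ * Θ * p α) R α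
      ≤ σ * (c * l / emin + s) * a α := by
  have he0 : ∀ α, 0 < e α := fun α => hemin.trans_le (he α)
  have he0' : ∀ α, 0 < e' α := fun α => hemin.trans_le (he' α)
  set δ := σ * (c * l / emin + s) with hδ
  have hδ0 : 0 ≤ δ := by have : 0 ≤ c := hc.trans hΘ; positivity
  have key : ∀ α, -δ ≤ R α - R' α := by
    refine radiosity_nonneg ha hΛ hp hrow he0 he1 hδ0 fun β => ?_
    have h1 := h.eq β
    have h2 := h'.eq β
    have lo := h'.lower ha hΛ hp hrow he0' he1' hσ hU0' hc β
    have up := h'.upper ha hΛ hp hrow he0' he1' hσ hU' hΘ β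
    have e1 : ∑ x, (R x - R' x) * Λ β x
        = incoming Λ (fun α => σ * Θ * p α) R β - incoming Λ (fun α => σ * Θ * p α) R' β := by
      simp [incoming, sub_mul]
    set K := incoming Λ (fun α => σ * Θ * p α) R β
    set K' := incoming Λ (fun α => σ * Θ * p α) R' β
    rw [e1]
    have hid : a β * (R β - R' β) - (1 - e β) * (K - K')
        = (e' β - e β) * (K' - σ * U' β * a β) + σ * e β * (U β - U' β) * a β := by
      linear_combination h1 - h2
    rw [hid]
    have haβ := ha β
    have b1 : |K' - σ * U' β * a β| ≤ σ * c * a β := by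
      have u0 : 0 ≤ σ * U' β * a β := by have := hU0' β; positivity
      have u1 : σ * U' β * a β ≤ σ * c * a β := by have := hU' β; gcongr
      rw [abs_le]; constructor <;> linarith
    have b2 : |(e' β - e β) * (K' - σ * U' β * a β)| ≤ l * (σ * c * a β) := by
      rw [abs_mul, abs_sub_comm]
      exact mul_le_mul (hee β) b1 (abs_nonneg _) hl
    have b3 : -s ≤ U β - U' β := (abs_le.1 (hUU β)).1
    have b4 : -(σ * e β * s * a β) ≤ σ * e β * (U β - U' β) * a β := by
      have := he0 β
      have : 0 ≤ σ * e β * a β := by positivity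
      nlinarith
    -- The minimum principle tolerates errors proportional to `e β`; replacing the error `l` by such
    -- a multiple costs the factor `1 / emin`.
    have b5 : l * (σ * c * a β) ≤ e β * (σ * (c * l / emin)) * a β := by
      have hc0 : 0 ≤ c := hc.trans hΘ
      have : emin * (c * l / emin) = c * l := by field_simp
      have h3 : c * l ≤ e β * (c * l / emin) := by
        rw [← this]; exact (mul_le_mul_of_nonneg_right (he β) (by positivity)).trans_eq (by rw [this])
      have := mul_le_mul_of_nonneg_left h3 (by positivity : 0 ≤ σ * a β)
      nlinarith
    have b6 := (abs_le.1 b2).1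
    rw [hδ]
    nlinarith
  have e1 : incoming Λ (fun α => σ * Θ * p α) R' α - incoming Λ (fun α => σ * Θ * p α) R α
      = ∑ β, (R' β - R β) * Λ α β := by
    simp [incoming, sub_mul]
  rw [e1]
  calc ∑ β, (R' β - R β) * Λ α β ≤ ∑ β, δ * Λ α β :=
        Finset.sum_le_sum fun β _ =>
          mul_le_mul_of_nonneg_right (by linarith [key β]) (hΛ α β)
    _ = δ * ∑ β, Λ α β := (Finset.mul_sum ..).symm
    _ ≤ δ * a α := mul_le_mul_of_nonneg_left (by linarith [hp α, hrow α]) hδ0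

lemma IsRadiosity.abs_sub_le {a p : J → ℝ} {Λ : J → J → ℝ} (ha : ∀ α, 0 < a α)
    (hΛ : ∀ α β, 0 ≤ Λ α β) (hp : ∀ α, 0 ≤ p α) (hrow : ∀ α, ∑ β, Λ α β + p α = a α)
    {e e' U U' R R' : J → ℝ} {σ Θ c l s emin : ℝ} (hσ : 0 ≤ σ) (hc : 0 ≤ Θ) (hΘ : Θ ≤ c)
    (hemin : 0 < emin) (he : ∀ α, emin ≤ e α) (he1 : ∀ α, e α ≤ 1)
    (he' : ∀ α, emin ≤ e' α) (he1' : ∀ α, e' α ≤ 1)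
    (h : IsRadiosity a p Λ σ Θ e U R) (h' : IsRadiosity a p Λ σ Θ e' U' R')
    (hU0 : ∀ α, 0 ≤ U α) (hU : ∀ α, U α ≤ c)
    (hU0' : ∀ α, 0 ≤ U' α) (hU' : ∀ α, U' α ≤ c)
    (hl : 0 ≤ l) (hs : 0 ≤ s)
    (hee : ∀ α, |e α - e' α| ≤ l) (hUU : ∀ α, |U α - U' α| ≤ s) (α : J) :
    |incoming Λ (fun α => σ * Θ * p α) R α - incoming Λ (fun α => σ * Θ * p α) R' α|
      ≤ σ * (c * l / emin + s) * a α := by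
  rw [abs_le]
  have h1 := h.sub_le ha hΛ hp hrow hσ hc hΘ hemin he he1 he' he1' h' hU0' hU' hl hs hee hUU α
  have h2 := h'.sub_le ha hΛ hp hrow hσ hc hΘ hemin he' he1' he he1 h hU0 hU hl hs
    (fun α => by rw [abs_sub_comm]; exact hee α) (fun α => by rw [abs_sub_comm]; exact hUU α) α
  constructor <;> linarith

open Classical in
lemma isRadiosity_inv {a p : J → ℝ} {Λ : J → J → ℝ} (ha : ∀ α, 0 < a α)
    (hΛ : ∀ α β, 0 ≤ Λ α β) (hp : ∀ α, 0 ≤ p α) (hrow : ∀ α, ∑ β, Λ α β + p α = a α)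
    {e : J → ℝ} (he : ∀ α, 0 < e α) (he1 : ∀ α, e α ≤ 1) (σ Θ : ℝ) (U : J → ℝ) :
    IsRadiosity a p Λ σ Θ e U ((radMatrix a Λ e)⁻¹.mulVec
      fun α => σ * e α * U α * a α + σ * (1 - e α) * Θ * p α) := by
  refine ⟨fun α => ?_⟩
  set b : J → ℝ := fun α => σ * e α * U α * a α + σ * (1 - e α) * Θ * p α with hb
  have h1 := radMatrix_mulVec a Λ e ((radMatrix a Λ e)⁻¹.mulVec b) α
  rw [Matrix.mulVec_mulVec, Matrix.mul_nonsing_inv _ (radMatrix_isUnit_det ha hΛ hp hrow he he1),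
    Matrix.one_mulVec] at h1
  simp only [incoming]
  simp only [hb] at h1 ⊢
  linear_combination -h1

end Radiosity

/-! ### Balance systems: bounds and contraction -/

/-- A finite system of implicit balance equations with diffusive exchange between the cells, local
emission, and nonlocal absorption `K`. -/
structure BalanceSystem (I : Type*) [Fintype I] where
  (k Ce σ θ : ℝ)
  (emis : ℝ → ℝ)
  (b : I → ℝ → ℝ)
  (vol aI aO src w : I → ℝ)
  (A : I → I → ℝ)
  (K : I → (I → ℝ) → ℝ)
  k_pos : 0 < k
  Ce_pos : 0 < Ce
  σ_pos : 0 < σ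
  θ_pos : 0 < θ
  emis_pos : ∀ x, 0 ≤ x → 0 < emis x
  emis_le_one : ∀ x, 0 ≤ x → emis x ≤ 1
  emis_cont : ContinuousOn emis (Ici 0)
  b_cont : ∀ i, ContinuousOn (b i) (Ici 0)
  b_growth : ∀ i x y, 0 ≤ x → x ≤ y → (y - x) * Ce * vol i ≤ b i y - b i x
  vol_pos : ∀ i, 0 < vol i
  aI_nonneg : ∀ i, 0 ≤ aI i
  aO_nonneg : ∀ i, 0 ≤ aO i
  src_nonneg : ∀ i, 0 ≤ src i
  w_nonneg : ∀ i, 0 ≤ w i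
  A_nonneg : ∀ i j, 0 ≤ A i j
  K_lower : ∀ i u c, 0 ≤ c → c ≤ θ → (∀ j, c ≤ u j) → σ * c ^ 4 * aI i ≤ K i u
  K_upper : ∀ i u c, θ ≤ c → (∀ j, 0 ≤ u j) → (∀ j, u j ≤ c) → K i u ≤ σ * c ^ 4 * aI i

namespace BalanceSystem

variable {I : Type*} [Fintype I] (S : BalanceSystem I)

/-- The residual of the `i`-th balance equation, where the neighbouring values and the absorbed
radiation are evaluated at `v`. -/
noncomputable def res (v : I → ℝ) (i : I) (x : ℝ) : ℝ :=
  S.k⁻¹ * (S.b i x - S.b i (S.w i)) - ∑ j, S.A i j * (v j - x)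
    + S.emis x * (S.σ * x ^ 4 * S.aI i - S.K i v)
    + S.σ * S.emis x * (x ^ 4 - S.θ ^ 4) * S.aO i - S.src i

/-- At a cell where `u` is minimal and below `m`, no term of the residual is positive and the energy
term is negative. `K_lower` applies with `c` the minimum of `u`, which lies below `θ`. -/
lemma le_of_res_eq_zero {u : I → ℝ} (hu : ∀ i, 0 ≤ u i) (h : ∀ i, S.res u i (u i) = 0) {m : ℝ}
    (hmθ : m ≤ S.θ) (hmw : ∀ i, m ≤ S.w i) (i : I) : m ≤ u i := by
  have : Nonempty I := ⟨i⟩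
  obtain ⟨γ, hγ⟩ := Finite.exists_min u
  refine le_trans ?_ (hγ i)
  by_contra! hlt
  have h0 := h γ
  have hx := hu γ
  set x := u γ
  have h1 : S.k⁻¹ * (S.b γ x - S.b γ (S.w γ)) < 0 := by
    have h2 := S.b_growth γ x (S.w γ) hx (hlt.le.trans (hmw γ))
    have h3 : 0 < (S.w γ - x) * S.Ce * S.vol γ :=
      mul_pos (mul_pos (by linarith [hmw γ]) S.Ce_pos) (S.vol_pos γ)
    exact mul_neg_of_pos_of_neg (inv_pos.2 S.k_pos) (by linarith)
  have h2 : 0 ≤ ∑ j, S.A γ j * (u j - x) :=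
    Finset.sum_nonneg fun j _ => mul_nonneg (S.A_nonneg γ j) (sub_nonneg.2 (hγ j))
  have h3 : S.emis x * (S.σ * x ^ 4 * S.aI γ - S.K γ u) ≤ 0 :=
    mul_nonpos_of_nonneg_of_nonpos (S.emis_pos x hx).le
      (sub_nonpos.2 (S.K_lower γ u x hx (by linarith) hγ))
  have h4 : S.σ * S.emis x * (x ^ 4 - S.θ ^ 4) * S.aO γ ≤ 0 := by
    have : x ^ 4 ≤ S.θ ^ 4 := by gcongr; linarith
    exact mul_nonpos_of_nonpos_of_nonneg (mul_nonpos_of_nonneg_of_nonpos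
      (mul_pos S.σ_pos (S.emis_pos x hx)).le (by linarith)) (S.aO_nonneg γ)
  have h5 := S.src_nonneg γ
  rw [res] at h0
  linarith

/-- `M` exceeds `w i` by at least the rise `k / Ce * B` that a source density `B` can cause in one
step. Hence the energy stored on the way from `w i` to `M` pays for the source. -/
lemma src_le {M B : ℝ} {i : I} (hB : S.src i ≤ S.vol i * B)
    (hM : S.w i + S.k / S.Ce * B ≤ M) {x : ℝ} (hM0 : S.w i ≤ x) :
    S.src i + S.k⁻¹ * ((x - M) * S.Ce * S.vol i) ≤ S.k⁻¹ * (S.b i x - S.b i (S.w i)) := by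
  have h2 := S.b_growth i (S.w i) x (S.w_nonneg i) hM0
  have h3 : S.k⁻¹ * ((x - S.w i) * S.Ce * S.vol i) ≤ S.k⁻¹ * (S.b i x - S.b i (S.w i)) :=
    mul_le_mul_of_nonneg_left h2 (inv_pos.2 S.k_pos).le
  refine le_trans ?_ h3
  have h4 : S.k⁻¹ * ((S.k / S.Ce * B) * S.Ce * S.vol i) = S.vol i * B := by
    have := S.k_pos.ne'; have := S.Ce_pos.ne'; field_simp
  have h5 : S.k⁻¹ * ((S.k / S.Ce * B) * S.Ce * S.vol i) ≤
      S.k⁻¹ * ((M - S.w i) * S.Ce * S.vol i) := by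
    have := S.k_pos; have := S.Ce_pos; have := S.vol_pos i
    gcongr
    linarith
  have h6 : S.k⁻¹ * ((x - S.w i) * S.Ce * S.vol i) = S.k⁻¹ * ((x - M) * S.Ce * S.vol i)
    + S.k⁻¹ * ((M - S.w i) * S.Ce * S.vol i) := by ring
  linarith

/-- The mirror image of `le_of_res_eq_zero` at a maximal cell; strictness comes from the surplus
proportional to `x - M` in `src_le`. -/
lemma le_max_of_res_eq_zero {u : I → ℝ} (hu : ∀ i, 0 ≤ u i) (h : ∀ i, S.res u i (u i) = 0)
    {M B : ℝ} (hB0 : 0 ≤ B) (hB : ∀ i, S.src i ≤ S.vol i * B)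
    (hMθ : S.θ ≤ M) (hMw : ∀ i, S.w i + S.k / S.Ce * B ≤ M) (i : I) : u i ≤ M := by
  have : Nonempty I := ⟨i⟩
  obtain ⟨γ, hγ⟩ := Finite.exists_max u
  refine (hγ i).trans ?_
  by_contra! hlt
  have h0 := h γ
  have hx := hu γ
  set x := u γ
  have hkB : 0 ≤ S.k / S.Ce * B := mul_nonneg (div_pos S.k_pos S.Ce_pos).le hB0
  have h1 := S.src_le (x := x) (hB γ) (hMw γ) (by linarith [hMw γ])
  have h1' : 0 < S.k⁻¹ * ((x - M) * S.Ce * S.vol γ) :=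
    mul_pos (inv_pos.2 S.k_pos) (mul_pos (mul_pos (by linarith) S.Ce_pos) (S.vol_pos γ))
  have h2 : ∑ j, S.A γ j * (u j - x) ≤ 0 :=
    Finset.sum_nonpos fun j _ =>
      mul_nonpos_of_nonneg_of_nonpos (S.A_nonneg γ j) (sub_nonpos.2 (hγ j))
  have h3 : 0 ≤ S.emis x * (S.σ * x ^ 4 * S.aI γ - S.K γ u) :=
    mul_nonneg (S.emis_pos x hx).le (sub_nonneg.2 (S.K_upper γ u x (by linarith) hu hγ))
  have h4 : 0 ≤ S.σ * S.emis x * (x ^ 4 - S.θ ^ 4) * S.aO γ := by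
    have : S.θ ^ 4 ≤ x ^ 4 := by have := S.θ_pos; gcongr; linarith
    exact mul_nonneg (mul_nonneg
      (mul_pos S.σ_pos (S.emis_pos x hx)).le (by linarith)) (S.aO_nonneg γ)
  rw [res] at h0
  linarith

/-- Split the difference into `e y (y ^ 4 - x ^ 4) C ≥ 0` and `(e y - e x) (x ^ 4 C - κ)`. Only the
variation of the emissivity can make emission decrease, and its factor is at most `M ^ 4 C` because
both `x ^ 4 C` and `κ` lie in `[0, M ^ 4 C]`. -/
lemma emission_sub_ge {e : ℝ → ℝ} {L M C κ x y : ℝ} (hC : 0 ≤ C) (hκ0 : 0 ≤ κ)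
    (hκ : κ ≤ M ^ 4 * C) (hx : 0 ≤ x) (hxy : x ≤ y) (hy : y ≤ M) (he : 0 ≤ e y)
    (hL : |e y - e x| ≤ L * (y - x)) :
    -(L * M ^ 4 * C * (y - x)) ≤ e y * (y ^ 4 * C - κ) - e x * (x ^ 4 * C - κ) := by
  have h1 : 0 ≤ e y * ((y ^ 4 - x ^ 4) * C) := by
    have : x ^ 4 ≤ y ^ 4 := by gcongr
    exact mul_nonneg he (mul_nonneg (by linarith) hC)
  have h2 : |x ^ 4 * C - κ| ≤ M ^ 4 * C := by
    have u0 : 0 ≤ x ^ 4 * C := by positivity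
    have u1 : x ^ 4 * C ≤ M ^ 4 * C := by gcongr; linarith
    rw [abs_le]; constructor <;> linarith
  have h3 : |(e y - e x) * (x ^ 4 * C - κ)| ≤ L * (y - x) * (M ^ 4 * C) := by
    rw [abs_mul]
    exact mul_le_mul hL h2 (abs_nonneg _) ((abs_nonneg _).trans hL)
  have h4 := (abs_le.1 h3).1
  linarith

/-- The lower slope bound for the residual, without the exchange term. -/
noncomputable def slope (L M : ℝ) (i : I) : ℝ :=
  S.k⁻¹ * (S.Ce * S.vol i) - L * M ^ 4 * (S.σ * S.aI i) - L * M ^ 4 * (S.σ * S.aO i)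

/-- `emission_sub_ge` is used twice: with the frozen absorption `κ = K i v`, and with the radiation
of the environment at temperature `θ`. As `v` is frozen, the exchange contributes its full
conductance to the slope. -/
lemma res_sub_ge {L M : ℝ} (hMθ : S.θ ≤ M)
    (hL : ∀ x y, 0 ≤ x → x ≤ y → y ≤ M → |S.emis y - S.emis x| ≤ L * (y - x))
    {v : I → ℝ} (hv : ∀ i, 0 ≤ v i) (hvM : ∀ i, v i ≤ M) (i : I) {x y : ℝ} (hx : 0 ≤ x)
    (hxy : x ≤ y) (hy : y ≤ M) :
    (S.slope L M i + ∑ j, S.A i j) * (y - x) ≤ S.res v i y - S.res v i x := by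
  have hy0 := hx.trans hxy
  have h1 : S.k⁻¹ * ((y - x) * S.Ce * S.vol i) ≤ S.k⁻¹ * (S.b i y - S.b i x) :=
    mul_le_mul_of_nonneg_left (S.b_growth i x y hx hxy) (inv_pos.2 S.k_pos).le
  have h2 : ∑ j, S.A i j * (v j - x) - ∑ j, S.A i j * (v j - y) = (∑ j, S.A i j) * (y - x) := by
    rw [← Finset.sum_sub_distrib, Finset.sum_mul]
    exact Finset.sum_congr rfl fun j _ => by ring
  have h3 := emission_sub_ge (κ := S.K i v) (M := M) (mul_nonneg S.σ_pos.le (S.aI_nonneg i))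
    (by have := S.K_lower i v 0 le_rfl S.θ_pos.le hv; linarith)
    (by have := S.K_upper i v M hMθ hv hvM; linarith) hx hxy hy (S.emis_pos y hy0).le
    (hL x y hx hxy hy)
  have h4 := emission_sub_ge (κ := S.θ ^ 4 * (S.σ * S.aO i)) (M := M)
    (mul_nonneg S.σ_pos.le (S.aO_nonneg i))
    (mul_nonneg (pow_nonneg S.θ_pos.le 4) (mul_nonneg S.σ_pos.le (S.aO_nonneg i)))
    (mul_le_mul_of_nonneg_right (pow_le_pow_left₀ S.θ_pos.le hMθ 4)
      (mul_nonneg S.σ_pos.le (S.aO_nonneg i))) hx hxy hy (S.emis_pos y hy0).le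
    (hL x y hx hxy hy)
  simp only [res, slope]
  linear_combination h1 + h3 + h4 - h2

lemma continuousOn_res (v : I → ℝ) (i : I) : ContinuousOn (S.res v i) (Ici 0) := by
  have h1 := S.emis_cont
  have h2 := S.b_cont i
  unfold res
  fun_prop

/-- Intermediate value theorem: by the sign arguments of the two bounds, the residual is nonpositive
at `0` and nonnegative at `M`. -/
lemma exists_root {M B : ℝ} (hB0 : 0 ≤ B) (hB : ∀ i, S.src i ≤ S.vol i * B)
    (hMθ : S.θ ≤ M) (hMw : ∀ i, S.w i + S.k / S.Ce * B ≤ M)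
    {v : I → ℝ} (hv : ∀ i, 0 ≤ v i) (hvM : ∀ i, v i ≤ M) (i : I) :
    ∃ x ∈ Icc 0 M, S.res v i x = 0 := by
  have hM0 : 0 ≤ M := S.θ_pos.le.trans hMθ
  have hcont : ContinuousOn (S.res v i) (Icc 0 M) :=
    (S.continuousOn_res v i).mono Icc_subset_Ici_self
  have hkB : 0 ≤ S.k / S.Ce * B := mul_nonneg (div_pos S.k_pos S.Ce_pos).le hB0
  have hlo : S.res v i 0 ≤ 0 := by
    have h1 : S.k⁻¹ * (S.b i 0 - S.b i (S.w i)) ≤ 0 := by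
      have h2 := S.b_growth i 0 (S.w i) le_rfl (S.w_nonneg i)
      have h3 : 0 ≤ (S.w i - 0) * S.Ce * S.vol i :=
        mul_nonneg (mul_nonneg (by linarith [S.w_nonneg i]) S.Ce_pos.le) (S.vol_pos i).le
      exact mul_nonpos_of_nonneg_of_nonpos (inv_pos.2 S.k_pos).le (by linarith)
    have h2 : 0 ≤ ∑ j, S.A i j * (v j - 0) :=
      Finset.sum_nonneg fun j _ => mul_nonneg (S.A_nonneg i j) (by linarith [hv j])
    have h3 : S.emis 0 * (S.σ * 0 ^ 4 * S.aI i - S.K i v) ≤ 0 :=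
      mul_nonpos_of_nonneg_of_nonpos (S.emis_pos 0 le_rfl).le
        (sub_nonpos.2 (S.K_lower i v 0 le_rfl S.θ_pos.le hv))
    have h4 : S.σ * S.emis 0 * (0 ^ 4 - S.θ ^ 4) * S.aO i ≤ 0 := by
      have : 0 ≤ S.θ ^ 4 := pow_nonneg S.θ_pos.le 4
      exact mul_nonpos_of_nonpos_of_nonneg (mul_nonpos_of_nonneg_of_nonpos
        (mul_pos S.σ_pos (S.emis_pos 0 le_rfl)).le (by linarith)) (S.aO_nonneg i)
    have h5 := S.src_nonneg i
    rw [res]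
    linarith
  have hhi : 0 ≤ S.res v i M := by
    have h1 := S.src_le (x := M) (hB i) (hMw i) (by linarith [hMw i])
    have h2 : ∑ j, S.A i j * (v j - M) ≤ 0 :=
      Finset.sum_nonpos fun j _ =>
        mul_nonpos_of_nonneg_of_nonpos (S.A_nonneg i j) (sub_nonpos.2 (hvM j))
    have h3 : 0 ≤ S.emis M * (S.σ * M ^ 4 * S.aI i - S.K i v) :=
      mul_nonneg (S.emis_pos M hM0).le (sub_nonneg.2 (S.K_upper i v M hMθ hv hvM))
    have h4 : 0 ≤ S.σ * S.emis M * (M ^ 4 - S.θ ^ 4) * S.aO i := by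
      have : S.θ ^ 4 ≤ M ^ 4 := pow_le_pow_left₀ S.θ_pos.le hMθ 4
      exact mul_nonneg (mul_nonneg
        (mul_pos S.σ_pos (S.emis_pos M hM0)).le (by linarith)) (S.aO_nonneg i)
    rw [res]
    linarith
  exact intermediate_value_Icc hM0 hcont ⟨hlo, hhi⟩

/-- If the slope of the local terms exceeds the Lipschitz constant of the nonlocal terms, then the
system is uniquely solvable in the box `[0, M]`. -/
theorem existsUnique_of_slope {M B L : ℝ} {q : I → ℝ} (hB0 : 0 ≤ B)
    (hB : ∀ i, S.src i ≤ S.vol i * B) (hMθ : S.θ ≤ M)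
    (hMw : ∀ i, S.w i + S.k / S.Ce * B ≤ M)
    (hL : ∀ x y, 0 ≤ x → x ≤ y → y ≤ M → |S.emis y - S.emis x| ≤ L * (y - x))
    (hq0 : ∀ i, 0 ≤ q i)
    (hK : ∀ i u v d, (∀ j, u j ∈ Icc 0 M) → (∀ j, v j ∈ Icc 0 M) → (∀ j, |u j - v j| ≤ d) →
      |S.K i u - S.K i v| ≤ q i * d)
    (hqs : ∀ i, q i < S.slope L M i) :
    ∃! u : I → ℝ, (∀ i, 0 ≤ u i) ∧ ∀ i, S.res u i (u i) = 0 := by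
  have hM0 : 0 ≤ M := S.θ_pos.le.trans hMθ
  let X : Set (I → ℝ) := Icc 0 fun _ => M
  have hX : ∀ {v : I → ℝ}, v ∈ X ↔ ∀ i, v i ∈ Icc 0 M := fun {v} =>
    ⟨fun h i => ⟨h.1 i, h.2 i⟩, fun h => ⟨fun i => (h i).1, fun i => (h i).2⟩⟩
  have hA : ∀ i, 0 ≤ ∑ j, S.A i j := fun i => Finset.sum_nonneg fun j _ => S.A_nonneg i j
  have hpos : ∀ i, 0 < S.slope L M i + ∑ j, S.A i j := fun i => by
    linarith [hq0 i, hqs i, hA i]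
  -- The contraction constant is the largest ratio of Lipschitz constant to slope; adding the same
  -- conductance to `q i < slope` keeps each ratio below `1`.
  obtain ⟨c, hc0, hc1, hc⟩ : ∃ c : ℝ, 0 ≤ c ∧ c < 1 ∧
      ∀ i, q i + ∑ j, S.A i j ≤ c * (S.slope L M i + ∑ j, S.A i j) := by
    rcases isEmpty_or_nonempty I with hI | hI
    · exact ⟨0, le_rfl, one_pos, fun i => isEmptyElim i⟩
    obtain ⟨γ, hγ⟩ := Finite.exists_max
      fun i => (q i + ∑ j, S.A i j) / (S.slope L M i + ∑ j, S.A i j)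
    refine ⟨_, div_nonneg (add_nonneg (hq0 γ) (hA γ)) (hpos γ).le,
      (div_lt_one (hpos γ)).2 (by linarith [hqs γ]), fun i => ?_⟩
    exact (div_le_iff₀ (hpos i)).1 (hγ i)
  -- A nonlinear Jacobi step: each cell solves its own equation with all other data taken from `v`.
  choose Φ hΦ hΦ0 using fun (v : X) (i : I) => S.exists_root hB0 hB hMθ hMw
    (fun i => (hX.1 v.2 i).1) (fun i => (hX.1 v.2 i).2) i
  let F : X → X := fun v => ⟨Φ v, hX.2 (hΦ v)⟩
  have hstep : ∀ (v v' : X) (i : I), Φ v' i ≤ Φ v i →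
      Φ v i - Φ v' i ≤ c * dist v v' := by
    intro v v' i hle
    have hd : ∀ j, |v.1 j - v'.1 j| ≤ dist v v' := fun j => dist_le_pi_dist v.1 v'.1 j
    have h1 := S.res_sub_ge hMθ hL (fun i => (hX.1 v.2 i).1) (fun i => (hX.1 v.2 i).2) i
      (hΦ v' i).1 hle (hΦ v i).2
    -- At the same argument the two residuals differ in the frozen terms only.
    have h2 : S.res v i (Φ v' i) - S.res v' i (Φ v' i)
        = S.emis (Φ v' i) * (S.K i v' - S.K i v) + ∑ j, S.A i j * (v'.1 j - v.1 j) := by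
      have : ∑ j, S.A i j * (v'.1 j - v.1 j)
          = ∑ j, S.A i j * (v'.1 j - Φ v' i) - ∑ j, S.A i j * (v.1 j - Φ v' i) := by
        rw [← Finset.sum_sub_distrib]
        exact Finset.sum_congr rfl fun j _ => by ring
      simp only [res]
      rw [this]
      ring
    have h3 : -((∑ j, S.A i j) * dist v v') ≤ ∑ j, S.A i j * (v'.1 j - v.1 j) := by
      rw [Finset.sum_mul, ← Finset.sum_neg_distrib]
      refine Finset.sum_le_sum fun j _ => ?_
      nlinarith [(abs_le.1 (hd j)).2, S.A_nonneg i j]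
    have h4 : -(q i * dist v v') ≤ S.emis (Φ v' i) * (S.K i v' - S.K i v) := by
      have h5 := hK i v v' _ (hX.1 v.2) (hX.1 v'.2) hd
      have h6 : |S.emis (Φ v' i) * (S.K i v' - S.K i v)| ≤ 1 * (q i * dist v v') := by
        rw [abs_mul, abs_sub_comm, abs_of_nonneg (S.emis_pos _ (hΦ v' i).1).le]
        exact mul_le_mul (S.emis_le_one _ (hΦ v' i).1) h5 (abs_nonneg _) zero_le_one
      linarith [(abs_le.1 h6).1]
    rw [hΦ0 v i] at h1
    rw [hΦ0 v' i] at h2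
    have h7 : (S.slope L M i + ∑ j, S.A i j) * (Φ v i - Φ v' i)
        ≤ (S.slope L M i + ∑ j, S.A i j) * (c * dist v v') := by
      have h8 := mul_le_mul_of_nonneg_right (hc i) (dist_nonneg (x := v) (y := v'))
      linarith
    exact le_of_mul_le_mul_left h7 (hpos i)
  have hcontr : ContractingWith ⟨c, hc0⟩ F := by
    refine ⟨by exact_mod_cast hc1, LipschitzWith.of_dist_le_mul fun v v' => ?_⟩
    refine (dist_pi_le_iff (mul_nonneg hc0 dist_nonneg)).2 fun i => ?_
    rw [Real.dist_eq]
    rcases le_total (Φ v' i) (Φ v i) with h | h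
    · rw [abs_of_nonneg (sub_nonneg.2 h)]
      exact hstep v v' i h
    · rw [abs_sub_comm, abs_of_nonneg (sub_nonneg.2 h), dist_comm]
      exact hstep v' v i h
  have : CompleteSpace X := isClosed_Icc.completeSpace_coe
  have : Nonempty X := ⟨⟨0, hX.2 fun _ => ⟨le_rfl, hM0⟩⟩⟩
  -- Scalar residuals are strictly increasing, so each has only one root; a solution in the box is
  -- therefore a fixed point.
  have hfix : ∀ v : X, (∀ i, S.res v i (v.1 i) = 0) → F v = v := by
    intro v hv
    refine Subtype.ext (funext fun i => ?_)
    have h1 := hX.1 v.2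
    rcases le_total (Φ v i) (v.1 i) with h | h
    · have h2 := S.res_sub_ge hMθ hL (fun i => (h1 i).1) (fun i => (h1 i).2) i
        (hΦ v i).1 h (h1 i).2
      rw [hv i, hΦ0 v i, sub_zero] at h2
      have := nonpos_of_mul_nonpos_right h2 (hpos i)
      exact le_antisymm h (by linarith)
    · have h2 := S.res_sub_ge hMθ hL (fun i => (h1 i).1) (fun i => (h1 i).2) i
        (h1 i).1 h (hΦ v i).2
      rw [hv i, hΦ0 v i, sub_zero] at h2
      have := nonpos_of_mul_nonpos_right h2 (hpos i)
      exact le_antisymm (by linarith) h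
  let z := ContractingWith.fixedPoint F hcontr
  have hz : F z = z := hcontr.fixedPoint_isFixedPt
  refine ⟨z.1, ⟨fun i => (hX.1 z.2 i).1, fun i => ?_⟩, fun u hu => ?_⟩
  · have h1 := hΦ0 z i
    have h2 : Φ z = z.1 := congrArg Subtype.val hz
    rwa [h2] at h1
  -- Uniqueness is not restricted to the box: the upper bound places every nonnegative solution
  -- there.
  · have huX : u ∈ X := hX.2 fun i =>
      ⟨hu.1 i, S.le_max_of_res_eq_zero hu.1 hu.2 hB0 hB hMθ hMw i⟩
    exact congrArg Subtype.val (hcontr.fixedPoint_unique (hfix ⟨u, huX⟩ hu.2))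

end BalanceSystem

/-! ### Emissivity -/

lemma lipConst_nonneg (g : ℝ → ℝ) (r : ℝ) : 0 ≤ lipConst g r := by
  refine Real.sSup_nonneg ?_
  rintro q ⟨a, -, b, -, -, rfl⟩
  positivity

lemma abs_sub_le_lipConst {g : ℝ → ℝ} {r : ℝ} (h : BddAbove (lipQuotients g r)) {x y : ℝ}
    (hx : x ∈ Icc 0 r) (hy : y ∈ Icc 0 r) : |g x - g y| ≤ lipConst g r * |x - y| := by
  by_cases hxy : x = y
  · simp [hxy]
  · exact (div_le_iff₀ (abs_pos.2 (sub_ne_zero.2 hxy))).1 (le_csSup h ⟨x, hx, y, hy, hxy, rfl⟩)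

lemma continuousOn_Ici_of_lip {g : ℝ → ℝ} (h : ∀ r, 0 ≤ r → BddAbove (lipQuotients g r)) :
    ContinuousOn g (Ici 0) := by
  intro x hx
  have hx : (0 : ℝ) ≤ x := hx
  -- The right end `x + 1` makes the interval a neighbourhood of `x` within `[0, ∞)`.
  have h1 : LipschitzOnWith ⟨lipConst g (x + 1), lipConst_nonneg _ _⟩ g (Icc 0 (x + 1)) :=
    LipschitzOnWith.of_dist_le_mul fun a ha b hb =>
      abs_sub_le_lipConst (h _ (by linarith)) ha hb
  have h2 := h1.continuousOn x ⟨hx, by linarith⟩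
  refine h2.mono_of_mem_nhdsWithin ?_
  rw [← Ici_inter_Iic]
  exact Filter.inter_mem self_mem_nhdsWithin (mem_nhdsWithin_of_mem_nhds (Iic_mem_nhds (by linarith)))

lemma negVar_nonneg (g : ℝ → ℝ) (r : ℝ) : 0 ≤ negVar g r := by
  refine Real.sSup_nonneg ?_
  rintro s ⟨N, t, -, -, -, rfl⟩
  exact Finset.sum_nonneg fun j _ => neg_nonneg.2 (min_le_left _ _)

lemma minOn_le {g : ℝ → ℝ} {r : ℝ} (hg : ContinuousOn g (Ici 0)) {x : ℝ} (hx : x ∈ Icc 0 r) :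
    minOn g r ≤ g x :=
  csInf_le (isCompact_Icc.image_of_continuousOn (hg.mono Icc_subset_Ici_self)).bddBelow
    (mem_image_of_mem _ hx)

lemma minOn_pos {g : ℝ → ℝ} {r : ℝ} (hr : 0 ≤ r) (hg : ContinuousOn g (Ici 0))
    (hpos : ∀ x, 0 ≤ x → 0 < g x) : 0 < minOn g r := by
  have h := (isCompact_Icc.image_of_continuousOn (hg.mono Icc_subset_Ici_self)).sInf_mem
    ((nonempty_Icc.2 hr).image g)
  obtain ⟨x, hx, hgx⟩ := h
  rw [minOn, ← hgx]
  exact hpos x hx.1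

lemma abs_pow_four_sub_le {M x y d : ℝ} (hx : x ∈ Icc 0 M) (hy : y ∈ Icc 0 M) (h : |x - y| ≤ d) :
    |x ^ 4 - y ^ 4| ≤ 4 * M ^ 3 * d := by
  obtain ⟨hx0, hxM⟩ := hx
  obtain ⟨hy0, hyM⟩ := hy
  have hM := hx0.trans hxM
  have h1 : x ^ 4 - y ^ 4 = (x ^ 3 + x ^ 2 * y + x * y ^ 2 + y ^ 3) * (x - y) := by ring
  have h2 : x ^ 3 + x ^ 2 * y + x * y ^ 2 + y ^ 3
      ≤ M ^ 3 + M ^ 2 * M + M * M ^ 2 + M ^ 3 := by gcongr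
  rw [h1, abs_mul, abs_of_nonneg (by positivity)]
  exact mul_le_mul (h2.trans_eq (by ring)) h (abs_nonneg _) (by positivity)

/-! ### The scheme as a balance system -/

namespace Discretization

set_option linter.unusedSectionVars false

variable {I IΩ IS : Type*} [Fintype I] [Fintype IΩ] [Fintype IS]
  (D : Discretization I IΩ IS) (P : Model)

/-- The geometric properties of the discretization on which the discrete maximum principle
rests. -/
structure Conservative : Prop where
  vol_pos : ∀ i, 0 < volume.real (D.vol i)
  vol_le : ∀ i, volume.real (D.vol i) ≤
    volume.real (D.subVol P Phase.solid i) + volume.real (D.subVol P Phase.gas i)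
  areaζΩ_pos : ∀ α, 0 < area.real (D.ζΩ α)
  areaζS_pos : ∀ α, 0 < area.real (D.ζS α)
  ΛΩ_nonneg : ∀ α β, 0 ≤ D.ΛΩ P α β
  Λph_nonneg : ∀ α, 0 ≤ D.Λph P α
  ΛS_nonneg : ∀ α β, 0 ≤ D.ΛS P α β
  rowΩ : ∀ α, ∑ β, D.ΛΩ P α β + D.Λph P α = area.real (D.ζΩ α)
  rowS : ∀ α, ∑ β, D.ΛS P α β = area.real (D.ζS α)
  mem_JΩ : ∀ i, ∀ α ∈ D.JΩ i, D.iΩ α = i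
  mem_JS : ∀ i, ∀ α ∈ D.JS P i, D.iS α = i
  sumΩ : ∀ i, ∑ α ∈ D.JΩ i, area.real (D.ζΩ α) = D.areaΓΩ P i
  sumS : ∀ i, ∑ α ∈ D.JS P i, area.real (D.ζS α) = D.areaS P i

/-- The radiation that arrives at the boundary elements of the `i`-th control volume. -/
noncomputable def absorbed (i : I) (u : I → ℝ) : ℝ :=
  ∑ α ∈ D.JΩ i, incoming (D.ΛΩ P) (fun α => P.σ * P.θext ^ 4 * D.Λph P α)
      (D.RΓ P fun β => u (D.iΩ β)) α
    + ∑ α ∈ D.JS P i, incoming (D.ΛS P) (fun α => P.σ * P.θext ^ 4 * (0 : IS → ℝ) α)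
      (D.RS P fun β => u (D.iS β)) α

open Classical in
/-- The conductances between the control volumes. -/
noncomputable def conductance (i j : I) : ℝ :=
  (if j ∈ D.nb P Phase.solid i then
    P.κ Phase.solid * (D.faceArea P Phase.solid i j / ‖D.pt i - D.pt j‖) else 0)
  + (if j ∈ D.nb P Phase.gas i then
    P.κ Phase.gas * (D.faceArea P Phase.gas i j / ‖D.pt i - D.pt j‖) else 0)

variable {D P}

lemma isRadiosityΓ (hP : P.Admissible) (h : D.Conservative P) {u : IΩ → ℝ} (hu : ∀ α, 0 ≤ u α) :
    IsRadiosity (fun α => area.real (D.ζΩ α)) (D.Λph P) (D.ΛΩ P) P.σ (P.θext ^ 4)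
      (fun α => P.emis (u α)) (fun α => u α ^ 4) (D.RΓ P u) :=
  isRadiosity_inv h.areaζΩ_pos h.ΛΩ_nonneg h.Λph_nonneg h.rowΩ (fun α => hP.emis_pos _ (hu α))
    (fun α => hP.emis_le_one _ (hu α)) P.σ (P.θext ^ 4) fun α => u α ^ 4

/-- The gas cavity is closed, so this is the case `p = 0`. The external temperature is then
multiplied by zero and is kept only to treat both cavities alike. -/
lemma isRadiosityS (hP : P.Admissible) (h : D.Conservative P) {u : IS → ℝ} (hu : ∀ α, 0 ≤ u α) :
    IsRadiosity (fun α => area.real (D.ζS α)) 0 (D.ΛS P) P.σ (P.θext ^ 4)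
      (fun α => P.emis (u α)) (fun α => u α ^ 4) (D.RS P u) := by
  have := isRadiosity_inv (p := 0) h.areaζS_pos h.ΛS_nonneg (fun _ => le_rfl)
    (by simpa using h.rowS) (fun α => hP.emis_pos _ (hu α))
    (fun α => hP.emis_le_one _ (hu α)) P.σ (P.θext ^ 4) fun α => u α ^ 4
  simp only [Pi.zero_apply, mul_zero, add_zero] at this
  exact this

lemma absorbed_lower (hP : P.Admissible) (h : D.Conservative P) (i : I) {u : I → ℝ} {c : ℝ}
    (hc : 0 ≤ c) (hcθ : c ≤ P.θext) (hu : ∀ j, c ≤ u j) :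
    P.σ * c ^ 4 * (D.areaΓΩ P i + D.areaS P i) ≤ D.absorbed P i u := by
  rw [mul_add, ← h.sumΩ, ← h.sumS, Finset.mul_sum, Finset.mul_sum]
  have h4 : c ^ 4 ≤ P.θext ^ 4 := pow_le_pow_left₀ hc hcθ 4
  refine add_le_add (Finset.sum_le_sum fun α _ => ?_) (Finset.sum_le_sum fun α _ => ?_)
  · exact (isRadiosityΓ hP h fun α => hc.trans (hu _)).lower h.areaζΩ_pos h.ΛΩ_nonneg h.Λph_nonneg
      h.rowΩ (fun α => hP.emis_pos _ (hc.trans (hu _)))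
      (fun α => hP.emis_le_one _ (hc.trans (hu _))) hP.σ_pos.le
      (fun α => pow_le_pow_left₀ hc (hu _) 4) h4 α
  · exact (isRadiosityS hP h fun α => hc.trans (hu _)).lower h.areaζS_pos h.ΛS_nonneg
      (fun _ => le_rfl)
      (by simpa using h.rowS) (fun α => hP.emis_pos _ (hc.trans (hu _)))
      (fun α => hP.emis_le_one _ (hc.trans (hu _))) hP.σ_pos.le
      (fun α => pow_le_pow_left₀ hc (hu _) 4) h4 α

lemma absorbed_upper (hP : P.Admissible) (h : D.Conservative P) (i : I) {u : I → ℝ} {c : ℝ}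
    (hcθ : P.θext ≤ c) (hu : ∀ j, 0 ≤ u j) (huc : ∀ j, u j ≤ c) :
    D.absorbed P i u ≤ P.σ * c ^ 4 * (D.areaΓΩ P i + D.areaS P i) := by
  rw [mul_add, ← h.sumΩ, ← h.sumS, Finset.mul_sum, Finset.mul_sum]
  have h4 : P.θext ^ 4 ≤ c ^ 4 := pow_le_pow_left₀ hP.θext_pos.le hcθ 4
  refine add_le_add (Finset.sum_le_sum fun α _ => ?_) (Finset.sum_le_sum fun α _ => ?_)
  · exact (isRadiosityΓ hP h fun α => (hu _)).upper h.areaζΩ_pos h.ΛΩ_nonneg h.Λph_nonneg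
      h.rowΩ (fun α => hP.emis_pos _ (hu _))
      (fun α => hP.emis_le_one _ (hu _)) hP.σ_pos.le
      (fun α => pow_le_pow_left₀ (hu _) (huc _) 4) h4 α
  · exact (isRadiosityS hP h fun α => (hu _)).upper h.areaζS_pos h.ΛS_nonneg
      (fun _ => le_rfl)
      (by simpa using h.rowS) (fun α => hP.emis_pos _ (hu _))
      (fun α => hP.emis_le_one _ (hu _)) hP.σ_pos.le
      (fun α => pow_le_pow_left₀ (hu _) (huc _) 4) h4 α

/-- `IsRadiosity.abs_sub_le` with `c = M ^ 4`, emissivity error `lipConst P.emis M * d` and error `4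
* M ^ 3 * d` in the fourth powers, summed over the elements of the cell. -/
lemma absorbed_lipschitz (hP : P.Admissible) (h : D.Conservative P) (i : I) {u v : I → ℝ} {M d : ℝ}
    (hMθ : P.θext ≤ M) (hu : ∀ j, u j ∈ Icc 0 M) (hv : ∀ j, v j ∈ Icc 0 M)
    (hd : ∀ j, |u j - v j| ≤ d) :
    |D.absorbed P i u - D.absorbed P i v| ≤
      P.σ * (M ^ 4 * lipConst P.emis M / minOn P.emis M + 4 * M ^ 3)
        * (D.areaΓΩ P i + D.areaS P i) * d := by
  have hM0 : 0 ≤ M := hP.θext_pos.le.trans hMθ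
  have hd0 : 0 ≤ d := (abs_nonneg _).trans (hd i)
  have hcont := continuousOn_Ici_of_lip hP.emis_lip
  have hL := lipConst_nonneg P.emis M
  have hmin := minOn_pos hM0 hcont hP.emis_pos
  have h4 : P.θext ^ 4 ≤ M ^ 4 := pow_le_pow_left₀ hP.θext_pos.le hMθ 4
  have h4' : 0 ≤ P.θext ^ 4 := pow_nonneg hP.θext_pos.le 4
  have he : ∀ j, |P.emis (u j) - P.emis (v j)| ≤ lipConst P.emis M * d := fun j =>
    (abs_sub_le_lipConst (hP.emis_lip M hM0) (hu j) (hv j)).trans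
      (mul_le_mul_of_nonneg_left (hd j) hL)
  set δ := P.σ * (M ^ 4 * (lipConst P.emis M * d) / minOn P.emis M + 4 * M ^ 3 * d) with hδ
  have e1 : P.σ * (M ^ 4 * lipConst P.emis M / minOn P.emis M + 4 * M ^ 3)
        * (D.areaΓΩ P i + D.areaS P i) * d = δ * (D.areaΓΩ P i + D.areaS P i) := by
    rw [hδ]; ring
  have h1 : ∀ α, |incoming (D.ΛΩ P) (fun α => P.σ * P.θext ^ 4 * D.Λph P α)
      (D.RΓ P fun β => u (D.iΩ β)) α - incoming (D.ΛΩ P) (fun α => P.σ * P.θext ^ 4 * D.Λph P α)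
      (D.RΓ P fun β => v (D.iΩ β)) α| ≤ δ * area.real (D.ζΩ α) :=
    (isRadiosityΓ hP h fun α => (hu _).1).abs_sub_le h.areaζΩ_pos h.ΛΩ_nonneg h.Λph_nonneg
      h.rowΩ hP.σ_pos.le h4' h4 hmin (fun α => minOn_le hcont (hu _))
      (fun α => hP.emis_le_one _ (hu _).1) (fun α => minOn_le hcont (hv _))
      (fun α => hP.emis_le_one _ (hv _).1) (isRadiosityΓ hP h fun α => (hv _).1)
      (fun α => pow_nonneg (hu _).1 4) (fun α => pow_le_pow_left₀ (hu _).1 (hu _).2 4)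
      (fun α => pow_nonneg (hv _).1 4) (fun α => pow_le_pow_left₀ (hv _).1 (hv _).2 4)
      (by positivity) (by positivity) (fun α => he _)
      (fun α => abs_pow_four_sub_le (hu _) (hv _) (hd _))
  have h2 : ∀ α, |incoming (D.ΛS P) (fun α => P.σ * P.θext ^ 4 * (0 : IS → ℝ) α)
      (D.RS P fun β => u (D.iS β)) α - incoming (D.ΛS P)
      (fun α => P.σ * P.θext ^ 4 * (0 : IS → ℝ) α)
      (D.RS P fun β => v (D.iS β)) α| ≤ δ * area.real (D.ζS α) :=
    (isRadiosityS hP h fun α => (hu _).1).abs_sub_le h.areaζS_pos h.ΛS_nonneg (fun _ => le_rfl)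
      (by simpa using h.rowS) hP.σ_pos.le h4' h4 hmin (fun α => minOn_le hcont (hu _))
      (fun α => hP.emis_le_one _ (hu _).1) (fun α => minOn_le hcont (hv _))
      (fun α => hP.emis_le_one _ (hv _).1) (isRadiosityS hP h fun α => (hv _).1)
      (fun α => pow_nonneg (hu _).1 4) (fun α => pow_le_pow_left₀ (hu _).1 (hu _).2 4)
      (fun α => pow_nonneg (hv _).1 4) (fun α => pow_le_pow_left₀ (hv _).1 (hv _).2 4)
      (by positivity) (by positivity) (fun α => he _)
      (fun α => abs_pow_four_sub_le (hu _) (hv _) (hd _))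
  rw [e1, mul_add, ← h.sumΩ, ← h.sumS, Finset.mul_sum, Finset.mul_sum, absorbed, absorbed,
    add_sub_add_comm, ← Finset.sum_sub_distrib, ← Finset.sum_sub_distrib]
  refine (abs_add_le _ _).trans (add_le_add ?_ ?_)
  · exact (Finset.abs_sum_le_sum_abs _ _).trans (Finset.sum_le_sum fun α _ => h1 α)
  · exact (Finset.abs_sum_le_sum_abs _ _).trans (Finset.sum_le_sum fun α _ => h2 α)

variable (D P) in
/-- The scheme for one time step as a balance system. -/
noncomputable def balance (hP : P.Admissible) (hD : D.Admissible P) (h : D.Conservative P)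
    {n : ℕ} (hn : 1 ≤ n) (hnN : n ≤ D.N) {w : I → ℝ} (hw : ∀ i, 0 ≤ w i) : BalanceSystem I where
  k := D.k n
  Ce := P.Ce
  σ := P.σ
  θ := P.θext
  emis := P.emis
  b i x := P.energy Phase.solid x * volume.real (D.subVol P Phase.solid i)
    + P.energy Phase.gas x * volume.real (D.subVol P Phase.gas i)
  vol i := volume.real (D.vol i)
  aI i := D.areaΓΩ P i + D.areaS P i
  aO i := D.areaOuter P i
  src i := D.sourceTerm P Phase.solid n i + D.sourceTerm P Phase.gas n i
  w := w
  A := D.conductance P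
  K := D.absorbed P
  k_pos := by
    have := hD.t_lt (n - 1) (by omega)
    rw [Nat.sub_add_cancel hn] at this
    exact sub_pos.2 this
  Ce_pos := hP.Ce_pos
  σ_pos := hP.σ_pos
  θ_pos := hP.θext_pos
  emis_pos := hP.emis_pos
  emis_le_one := hP.emis_le_one
  emis_cont := continuousOn_Ici_of_lip hP.emis_lip
  b_cont i := by
    have h1 := hP.energy_cont Phase.solid
    have h2 := hP.energy_cont Phase.gas
    fun_prop
  b_growth i x y hx hxy := by
    have h1 := mul_le_mul_of_nonneg_right (hP.energy_growth Phase.solid x y hx hxy)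
      (measureReal_nonneg (μ := volume) (s := D.subVol P Phase.solid i))
    have h2 := mul_le_mul_of_nonneg_right (hP.energy_growth Phase.gas x y hx hxy)
      (measureReal_nonneg (μ := volume) (s := D.subVol P Phase.gas i))
    have h3 := mul_le_mul_of_nonneg_left (h.vol_le i)
      (mul_nonneg (sub_nonneg.2 hxy) hP.Ce_pos.le)
    linarith
  vol_pos := h.vol_pos
  aI_nonneg i := add_nonneg measureReal_nonneg measureReal_nonneg
  aO_nonneg i := measureReal_nonneg
  src_nonneg i := by
    have : ∀ m, 0 ≤ D.sourceTerm P m n i := fun m => by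
      rw [sourceTerm]
      rcases (D.subVol P m i).eq_empty_or_nonempty with he | hne
      · simp [he]
      · have := hD.fApp_lower m n i hn hnN hne
        exact mul_nonneg (this.1.trans this.2) measureReal_nonneg
    exact add_nonneg (this _) (this _)
  w_nonneg := hw
  A_nonneg i j := by
    have : ∀ m, 0 ≤ P.κ m * (D.faceArea P m i j / ‖D.pt i - D.pt j‖) := fun m =>
      mul_nonneg (hP.κ_nonneg m) (div_nonneg measureReal_nonneg (norm_nonneg _))
    unfold conductance
    split_ifs <;> simp [this, add_nonneg]
  K_lower i u c hc hcθ hu := absorbed_lower hP h i hc hcθ hu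
  K_upper i u c hcθ hu huc := absorbed_upper hP h i hcθ hu huc

/-- Every element in `JΩ i` or `JS i` carries the temperature of cell `i`. So emission and
absorption share the factor `emis (u i)`, which can be pulled out of the sums. -/
lemma H_eq_res (hP : P.Admissible) (hD : D.Admissible P) (h : D.Conservative P)
    {n : ℕ} (hn : 1 ≤ n) (hnN : n ≤ D.N) {w : I → ℝ} (hw : ∀ i, 0 ≤ w i) (u : I → ℝ) (i : I) :
    D.H P n w u i = (D.balance P hP hD h hn hnN hw).res u i (u i) := by
  have h1 : ∑ j, D.conductance P i j * (u j - u i)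
      = D.conductionTerm P Phase.solid u i + D.conductionTerm P Phase.gas u i := by
    simp only [conductance, add_mul, Finset.sum_add_distrib, ite_mul, zero_mul,
      Finset.sum_ite_mem, Finset.univ_inter, conductionTerm, Finset.mul_sum]
    congr 1 <;> exact Finset.sum_congr rfl fun j _ => by ring
  have h2 : ∑ α ∈ D.JΩ i, D.VΓ P (fun β => u (D.iΩ β)) α = P.emis (u i) *
      ∑ α ∈ D.JΩ i, incoming (D.ΛΩ P) (fun α => P.σ * P.θext ^ 4 * D.Λph P α)
      (D.RΓ P fun β => u (D.iΩ β)) α := by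
    rw [Finset.mul_sum]
    refine Finset.sum_congr rfl fun α hα => ?_
    simp only [VΓ, incoming, h.mem_JΩ i α hα]
    ring
  have h3 : ∑ α ∈ D.JS P i, D.VS P (fun β => u (D.iS β)) α = P.emis (u i) *
      ∑ α ∈ D.JS P i, incoming (D.ΛS P) (fun α => P.σ * P.θext ^ 4 * (0 : IS → ℝ) α)
      (D.RS P fun β => u (D.iS β)) α := by
    rw [Finset.mul_sum]
    refine Finset.sum_congr rfl fun α hα => ?_
    simp only [VS, incoming, h.mem_JS i α hα, Pi.zero_apply]
    ring
  simp only [H, BalanceSystem.res, balance, h1, h2, h3, absorbed, energyTerm]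
  ring

lemma sourceTerm_le (h : D.Conservative P) (n : ℕ) (i : I) :
    D.sourceTerm P Phase.solid n i + D.sourceTerm P Phase.gas n i
      ≤ volume.real (D.vol i) * D.Bf P n := by
  have h1 := le_ciSup (Set.finite_range fun i =>
    (D.fApp Phase.solid n i * (volume.real (D.subVol P Phase.solid i) / volume.real (D.vol i))
    + D.fApp Phase.gas n i * (volume.real (D.subVol P Phase.gas i) / volume.real (D.vol i)))).bddAbove
    i
  have h2 := mul_le_mul_of_nonneg_left h1 (h.vol_pos i).le
  refine le_trans (le_of_eq ?_) h2
  have := (h.vol_pos i).ne'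
  simp only [sourceTerm]
  field_simp

lemma Bf_nonneg (hD : D.Admissible P) {n : ℕ} (hn : 1 ≤ n) (hnN : n ≤ D.N) : 0 ≤ D.Bf P n := by
  have : ∀ m i, 0 ≤ D.fApp m n i * (volume.real (D.subVol P m i) / volume.real (D.vol i)) :=
    fun m i => by
      rcases (D.subVol P m i).eq_empty_or_nonempty with he | hne
      · simp [he]
      · have := hD.fApp_lower m n i hn hnN hne
        exact mul_nonneg (this.1.trans this.2) (div_nonneg measureReal_nonneg measureReal_nonneg)
  exact Real.iSup_nonneg fun i => add_nonneg (this _ i) (this _ i)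

lemma le_mul_iSup_div (h : D.Conservative P) (s : ℝ) (hs : 0 ≤ s) (a : I → ℝ) (i : I) :
    s * a i ≤ volume.real (D.vol i) * (s * ⨆ i, a i / volume.real (D.vol i)) := by
  have h1 := le_ciSup (Set.finite_range fun i => a i / volume.real (D.vol i)).bddAbove i
  have h2 := mul_le_mul_of_nonneg_left h1 (mul_nonneg (h.vol_pos i).le hs)
  refine le_trans (le_of_eq ?_) (h2.trans_eq (by ring))
  have := (h.vol_pos i).ne'
  field_simp

/-- The step condition is stronger than what the contraction needs: from `lg1` only `L * M ^ 4` is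
kept, from `lg2` only `M ^ 4 * L / e + 4 * M ^ 3` (using `1 / e ≥ 1` for the minimal emissivity
`e`), and `lg3` is dropped. The maximum in `lg2` is `M ^ 4`, since `θext ≤ M`. -/
lemma lt_slope (hP : P.Admissible) (hD : D.Admissible P) (h : D.Conservative P)
    {n : ℕ} (hn : 1 ≤ n) (hnN : n ≤ D.N) {w : I → ℝ} (hw : ∀ i, 0 ≤ w i)
    (hstep : D.StepCondition P n w) (i : I) :
    P.σ * (D.upper P n w ^ 4 * lipConst P.emis (D.upper P n w) / minOn P.emis (D.upper P n w)
        + 4 * D.upper P n w ^ 3) * (D.areaΓΩ P i + D.areaS P i) <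
      (D.balance P hP hD h hn hnN hw).slope (lipConst P.emis (D.upper P n w)) (D.upper P n w) i := by
  have hk : 0 < D.k n := (D.balance P hP hD h hn hnN hw).k_pos
  have hMθ : P.θext ≤ D.upper P n w := le_max_left _ _
  rw [StepCondition, Model.lg1, Model.lg2, Model.lg3] at hstep
  simp only [BalanceSystem.slope, balance]
  set M := D.upper P n w
  have hM0 : 0 ≤ M := hP.θext_pos.le.trans hMθ
  have hcont := continuousOn_Ici_of_lip hP.emis_lip
  have hL := lipConst_nonneg P.emis M
  have hmin := minOn_pos hM0 hcont hP.emis_pos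
  have hmin1 : minOn P.emis M ≤ 1 :=
    (minOn_le hcont ⟨le_rfl, hM0⟩).trans (hP.emis_le_one 0 le_rfl)
  have hneg := negVar_nonneg P.emis M
  have hθ := hP.θext_pos
  rw [max_eq_left (pow_le_pow_left₀ hθ.le hMθ 4)] at hstep
  have hinv : 1 ≤ (minOn P.emis M)⁻¹ := (one_le_inv₀ hmin).2 hmin1
  set L := lipConst P.emis M
  set e := (minOn P.emis M)⁻¹ with he
  set N := negVar P.emis M
  have hv := h.vol_pos i
  have q1 := le_mul_iSup_div h P.σ hP.σ_pos.le (D.areaΓΩ P) i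
  have q2 := le_mul_iSup_div h P.σ hP.σ_pos.le (D.areaOuter P) i
  have q3 := le_mul_iSup_div h P.σ hP.σ_pos.le (D.areaS P) i
  change _ ≤ _ * D.LΓΩ P at q1
  change _ ≤ _ * D.LOuter P at q2
  change _ ≤ _ * D.LS P at q3
  have a1 : 0 ≤ P.σ * D.areaΓΩ P i := mul_nonneg hP.σ_pos.le measureReal_nonneg
  have a2 : 0 ≤ P.σ * D.areaOuter P i := mul_nonneg hP.σ_pos.le measureReal_nonneg
  have a3 : 0 ≤ P.σ * D.areaS P i := mul_nonneg hP.σ_pos.le measureReal_nonneg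
  set V := volume.real (D.vol i)
  set g1 := 4 * N * M ^ 3 + L * M ^ 4
  set g2 := 4 * e * M ^ 3 + M ^ 4 * L * (2 * e + 1)
  set g3 := L * P.θext ^ 4
  have hg1 : L * M ^ 4 ≤ g1 := le_add_of_nonneg_left (by positivity)
  have hg2 : M ^ 4 * L * e + 4 * M ^ 3 ≤ g2 := by
    have : 4 * M ^ 3 * 1 ≤ 4 * M ^ 3 * e := by gcongr
    have : 0 ≤ M ^ 4 * L * (e + 1) := by positivity
    linarith
  have hg3 : 0 ≤ g3 := by positivity
  have hg1' : 0 ≤ g1 := le_trans (by positivity) hg1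
  have hg2' : 0 ≤ g2 := le_trans (by positivity) hg2
  have c1 : (P.σ * D.areaΓΩ P i + P.σ * D.areaOuter P i + P.σ * D.areaS P i) * (L * M ^ 4)
      ≤ (V * D.LΓΩ P + V * D.LOuter P + V * D.LS P) * g1 := by gcongr; linarith
  have c2 : (P.σ * D.areaΓΩ P i + P.σ * D.areaS P i) * (M ^ 4 * L * e + 4 * M ^ 3)
      ≤ (V * D.LΓΩ P + V * D.LS P) * g2 := by gcongr; linarith
  have c3 : 0 ≤ V * D.LOuter P * g3 := mul_nonneg (a2.trans q2) hg3
  have c4 : V * ((D.LΓΩ P + D.LOuter P + D.LS P) * g1 + (D.LΓΩ P + D.LS P) * g2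
      + D.LOuter P * g3) < (D.k n)⁻¹ * (P.Ce * V) := by
    rw [inv_mul_eq_div, lt_div_iff₀ hk]
    nlinarith
  rw [div_eq_mul_inv, ← he]
  nlinarith

/-- Discrete maximum principle, and unique solvability under the time step condition. -/
theorem Conservative.bounds_and_existsUnique (hP : P.Admissible) (hD : D.Admissible P)
    (h : D.Conservative P) {n : ℕ} (hn : 1 ≤ n) (hnN : n ≤ D.N) {w : I → ℝ}
    (hw : ∀ i, 0 ≤ w i) :
    (∀ v : I → ℝ, (∀ i, 0 ≤ v i) → (∀ i, D.H P n w v i = 0) →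
      ∀ i, v i ∈ Set.Icc (P.lower w) (D.upper P n w)) ∧
    (D.StepCondition P n w → ∃! v : I → ℝ, (∀ i, 0 ≤ v i) ∧ ∀ i, D.H P n w v i = 0) := by
  set S := D.balance P hP hD h hn hnN hw with hS
  have hB : ∀ i, S.src i ≤ S.vol i * D.Bf P n := sourceTerm_le h n
  have hB0 := Bf_nonneg hD hn hnN
  have hMθ : S.θ ≤ D.upper P n w := le_max_left _ _
  have hMw : ∀ i, S.w i + S.k / S.Ce * D.Bf P n ≤ D.upper P n w := fun i =>
    (add_le_add_left (le_ciSup (Set.finite_range w).bddAbove i) _).trans (le_max_right _ _)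
  constructor
  · intro v hv hH i
    have hres : ∀ i, S.res v i (v i) = 0 := fun i => by rw [hS, ← H_eq_res, hH]
    refine ⟨S.le_of_res_eq_zero hv hres (min_le_left _ _)
      (fun i => (min_le_right _ _).trans (ciInf_le (Set.finite_range w).bddBelow i)) i,
      S.le_max_of_res_eq_zero hv hres hB0 hB hMθ hMw i⟩
  · intro hstep
    have hM0 : 0 ≤ D.upper P n w := S.θ_pos.le.trans hMθ
    have hmin := minOn_pos hM0 (continuousOn_Ici_of_lip hP.emis_lip) hP.emis_pos
    have := S.existsUnique_of_slope (L := lipConst P.emis (D.upper P n w)) hB0 hB hMθ hMw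
      (fun x y hx hxy hy => by
        have := abs_sub_le_lipConst (hP.emis_lip _ hM0) ⟨hx.trans hxy, hy⟩ ⟨hx, hxy.trans hy⟩
        rwa [abs_of_nonneg (sub_nonneg.2 hxy)] at this)
      (fun i => mul_nonneg (mul_nonneg hP.σ_pos.le (add_nonneg (div_nonneg
        (mul_nonneg (pow_nonneg hM0 4) (lipConst_nonneg _ _)) hmin.le) (by positivity)))
        (S.aI_nonneg i))
      (fun i u v d hu hv hd => absorbed_lipschitz hP h i hMθ hu hv hd)
      (lt_slope hP hD h hn hnN hw hstep)
    simpa only [hS, ← H_eq_res] using this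

end Discretization

/-! ### Oriented planes -/

/-- The plane with unit normal `p.1` and offset `p.2`. -/
def plane (p : E3 × ℝ) : Set E3 := {y | inner ℝ y p.1 = p.2}

lemma isClosed_plane (p : E3 × ℝ) : IsClosed (plane p) :=
  isClosed_eq (by fun_prop) continuous_const

lemma plane_neg (p : E3 × ℝ) : plane (-p) = plane p := by
  ext y
  simp [plane, inner_neg_right]

/-- A finite set of planes, each of them with both orientations. -/
structure IsPlaneFamily (F : Set (E3 × ℝ)) : Prop where
  finite : F.Finite
  norm : ∀ p ∈ F, ‖p.1‖ = 1
  neg : ∀ p ∈ F, -p ∈ F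

lemma isPlaneFamily_iUnion {ι : Type*} [Finite ι] {F : ι → Set (E3 × ℝ)}
    (h : ∀ i, IsPlaneFamily (F i)) : IsPlaneFamily (⋃ i, F i) where
  finite := finite_iUnion fun i => (h i).finite
  norm p hp := by
    obtain ⟨i, hi⟩ := mem_iUnion.1 hp
    exact (h i).norm p hi
  neg p hp := by
    obtain ⟨i, hi⟩ := mem_iUnion.1 hp
    exact mem_iUnion.2 ⟨i, (h i).neg p hi⟩

lemma isPlaneFamily_pair {p : E3 × ℝ} (hp : ‖p.1‖ = 1) : IsPlaneFamily {p, -p} where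
  finite := toFinite _
  norm q hq := by
    rcases hq with rfl | rfl
    · exact hp
    · simpa using hp
  neg q hq := by
    rcases hq with rfl | rfl <;> simp

/-- The union of the planes of a family. -/
def planeUnion (F : Set (E3 × ℝ)) : Set E3 := ⋃ p ∈ F, plane p

lemma planeUnion_mono {F G : Set (E3 × ℝ)} (h : F ⊆ G) : planeUnion F ⊆ planeUnion G :=
  biUnion_subset_biUnion_left h

/-- The points that lie in two different planes of the family. -/
def exceptional (F : Set (E3 × ℝ)) : Set E3 :=
  ⋃ p ∈ F, ⋃ q ∈ F, {y | q ≠ p ∧ q ≠ -p ∧ y ∈ plane p ∧ y ∈ plane q}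

lemma mem_exceptional {F : Set (E3 × ℝ)} {p q : E3 × ℝ} (hp : p ∈ F) (hq : q ∈ F) (h1 : q ≠ p)
    (h2 : q ≠ -p) {y : E3} (hyp : y ∈ plane p) (hyq : y ∈ plane q) : y ∈ exceptional F := by
  simp only [exceptional, mem_iUnion]
  exact ⟨p, hp, q, hq, h1, h2, hyp, hyq⟩

lemma exists_plane_of_affineSubspace_ne_top {s : AffineSubspace ℝ E3} (hs : s ≠ ⊤) :
    ∃ p : E3 × ℝ, ‖p.1‖ = 1 ∧ (s : Set E3) ⊆ plane p := by
  rcases s.eq_bot_or_nonempty with rfl | ⟨x, hx⟩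
  · obtain ⟨v, hv⟩ := exists_norm_eq E3 (zero_le_one (α := ℝ))
    exact ⟨(v, 0), hv, by simp⟩
  have hdir : s.direction ≠ ⊤ := fun h =>
    hs ((AffineSubspace.direction_eq_top_iff_of_nonempty ⟨x, hx⟩).1 h)
  have horth : s.directionᗮ ≠ ⊥ := fun h => hdir (Submodule.orthogonal_eq_bot_iff.1 h)
  obtain ⟨v, hv, hv0⟩ := Submodule.exists_mem_ne_zero_of_ne_bot horth
  refine ⟨(‖v‖⁻¹ • v, inner ℝ x (‖v‖⁻¹ • v)), by simpa using norm_smul_inv_norm (𝕜 := ℝ) hv0, fun y hy => ?_⟩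
  have h1 : inner ℝ (y - x) v = 0 :=
    (Submodule.mem_orthogonal _ v).1 hv _ (AffineSubspace.vsub_mem_direction hy hx)
  rw [inner_sub_left, sub_eq_zero] at h1
  simp only [plane, mem_ofPred_eq, inner_smul_right, h1]

/-! ### Boundaries of polyhedral sets -/

/-- A supporting functional at a boundary point `x` is maximal at `x`. Hence every vertex of
positive weight in a convex combination for `x` lies in the supporting plane, and `x` is in the span
of the vertices there. If `V` does not span the space, `V` itself will do. -/
lemma frontier_convexHull_subset (V : Finset E3) :
    frontier (convexHull ℝ (V : Set E3)) ⊆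
      ⋃ W ∈ {W : Finset E3 | W ⊆ V ∧ affineSpan ℝ (W : Set E3) ≠ ⊤},
        (affineSpan ℝ (W : Set E3) : Set E3) := by
  intro x hx
  have hclosed : IsClosed (convexHull ℝ (V : Set E3)) := V.finite_toSet.isClosed_convexHull ℝ
  rw [hclosed.frontier_eq] at hx
  simp only [mem_ofPred_eq, mem_iUnion, exists_prop]
  by_cases hV : affineSpan ℝ (V : Set E3) = ⊤
  swap
  · exact ⟨V, ⟨subset_rfl, hV⟩, convexHull_subset_affineSpan _ hx.1⟩
  obtain ⟨f, hf0, hf⟩ := geometric_hahn_banach_of_nonempty_interior_point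
    (convex_convexHull ℝ (V : Set E3)) hx.2 (interior_convexHull_nonempty_iff_affineSpan_eq_top.2 hV)
  obtain ⟨w, hw0, hw1, hwx⟩ := Finset.mem_convexHull'.1 hx.1
  classical
  have hle : ∀ y ∈ V, 0 ≤ w y * (f x - f y) := fun y hy =>
    mul_nonneg (hw0 y hy) (sub_nonneg.2 (hf y (subset_convexHull ℝ _ hy)))
  have hsum : ∑ y ∈ V, w y * (f x - f y) = 0 := by
    have h1 : f x = ∑ y ∈ V, w y * f y := by
      conv_lhs => rw [← hwx]
      simp [map_sum]
    simp only [mul_sub, Finset.sum_sub_distrib, ← Finset.sum_mul, hw1, one_mul, ← h1, sub_self]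
  have hz := (Finset.sum_eq_zero_iff_of_nonneg hle).1 hsum
  have hout : ∀ y ∈ V, y ∉ V.filter (fun y => f y = f x) → w y = 0 := by
    intro y hy hy'
    have h1 : f y ≠ f x := fun h => hy' (Finset.mem_filter.2 ⟨hy, h⟩)
    exact (mul_eq_zero.1 (hz y hy)).resolve_right (sub_ne_zero.2 h1.symm)
  refine ⟨V.filter (fun y => f y = f x), ⟨Finset.filter_subset _ _, fun htop => ?_⟩,
    convexHull_subset_affineSpan _ ?_⟩
  · have h2 : affineSpan ℝ ((V.filter (fun y => f y = f x) : Finset E3) : Set E3) ≤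
        (AffineSubspace.mk' x f.toLinearMap.ker) := by
      refine affineSpan_le.2 fun y hy => ?_
      have := (Finset.mem_filter.1 hy).2
      simp [AffineSubspace.mem_mk', this]
    rw [htop, top_le_iff] at h2
    have h3 := congrArg AffineSubspace.direction h2
    rw [AffineSubspace.direction_mk', AffineSubspace.direction_top] at h3
    refine hf0 (ContinuousLinearMap.ext fun y => ?_)
    have : y ∈ f.toLinearMap.ker := h3 ▸ Submodule.mem_top
    simpa using this
  · refine Finset.mem_convexHull'.2 ⟨w, fun y hy => hw0 y (Finset.filter_subset _ _ hy), ?_, ?_⟩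
    · rw [Finset.sum_subset (Finset.filter_subset _ _) hout, hw1]
    · rw [Finset.sum_subset (Finset.filter_subset _ _) (fun y hy hy' => by
        rw [hout y hy hy', zero_smul]), hwx]

lemma exists_planeFamily_convexHull (V : Finset E3) :
    ∃ F, IsPlaneFamily F ∧ frontier (convexHull ℝ (V : Set E3)) ⊆ planeUnion F := by
  have hfin : {W : Finset E3 | W ⊆ V ∧ affineSpan ℝ (W : Set E3) ≠ ⊤}.Finite :=
    V.powerset.finite_toSet.subset fun W hW => Finset.mem_coe.2 (Finset.mem_powerset.2 hW.1)
  have := hfin.to_subtype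
  choose p hp1 hp2 using fun W : {W : Finset E3 | W ⊆ V ∧ affineSpan ℝ (W : Set E3) ≠ ⊤} =>
    exists_plane_of_affineSubspace_ne_top W.2.2
  refine ⟨⋃ W, {p W, -p W}, isPlaneFamily_iUnion fun W => isPlaneFamily_pair (hp1 W), ?_⟩
  refine (frontier_convexHull_subset V).trans (iUnion₂_subset fun W hW => ?_)
  exact (hp2 ⟨W, hW⟩).trans (subset_biUnion_of_mem (u := plane) (mem_iUnion.2 ⟨⟨W, hW⟩, by simp⟩))

/-- A boundary point of the union is a boundary point of each polytope that contains it. -/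
lemma exists_planeFamily_polytopeUnion {S : Set E3} (h : IsPolytopeUnion S) :
    ∃ F, IsPlaneFamily F ∧ frontier S ⊆ planeUnion F := by
  obtain ⟨𝒱, rfl⟩ := h
  choose F hF hF' using fun V : 𝒱 => exists_planeFamily_convexHull V.1
  refine ⟨⋃ V, F V, isPlaneFamily_iUnion hF, fun x hx => ?_⟩
  have hclosed : IsClosed (⋃ V ∈ 𝒱, convexHull ℝ (V : Set E3)) :=
    𝒱.finite_toSet.isClosed_biUnion fun V _ => V.finite_toSet.isClosed_convexHull ℝ
  rw [hclosed.frontier_eq] at hx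
  obtain ⟨V, hV, hxV⟩ := mem_iUnion₂.1 hx.1
  have h1 : x ∈ frontier (convexHull ℝ (V : Set E3)) := by
    rw [(V.finite_toSet.isClosed_convexHull ℝ).frontier_eq]
    exact ⟨hxV, fun h => hx.2 (interior_mono (subset_biUnion_of_mem
      (u := fun V : Finset E3 => convexHull ℝ (V : Set E3)) hV) h)⟩
  exact planeUnion_mono (subset_iUnion F ⟨V, hV⟩) (hF' ⟨V, hV⟩ h1)

/-- A regular open set with boundary in the planes of the family `F`. -/
structure IsAdapted (F : Set (E3 × ℝ)) (A : Set E3) : Prop where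
  isOpen : IsOpen A
  regular : interior (closure A) = A
  frontier_subset : frontier A ⊆ planeUnion F

lemma IsAdapted.mono {F G : Set (E3 × ℝ)} {A : Set E3} (h : IsAdapted F A) (hFG : F ⊆ G) :
    IsAdapted G A := ⟨h.isOpen, h.regular, h.frontier_subset.trans (planeUnion_mono hFG)⟩

lemma IsAdapted.inter {F : Set (E3 × ℝ)} {A B : Set E3} (hA : IsAdapted F A)
    (hB : IsAdapted F B) : IsAdapted F (A ∩ B) where
  isOpen := hA.isOpen.inter hB.isOpen
  regular := by
    refine subset_antisymm ?_ (interior_maximal subset_closure (hA.isOpen.inter hB.isOpen))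
    have h := interior_mono (closure_inter_subset_inter_closure A B)
    rwa [interior_inter, hA.regular, hB.regular] at h
  frontier_subset := (frontier_inter_subset A B).trans (union_subset
    (inter_subset_left.trans hA.frontier_subset) (inter_subset_right.trans hB.frontier_subset))

lemma IsPolyhedral.exists_adapted {A : Set E3} (h : IsPolyhedral A) :
    ∃ F, IsPlaneFamily F ∧ IsAdapted F A := by
  obtain ⟨h1, h2, h3⟩ := h
  obtain ⟨F, hF, hF'⟩ := exists_planeFamily_polytopeUnion h3
  refine ⟨F, hF, h1, h2, subset_trans ?_ hF'⟩
  rw [isClosed_closure.frontier_eq, h2, h1.frontier_eq]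

lemma IsPolytopeUnion.isCompact {S : Set E3} (h : IsPolytopeUnion S) : IsCompact S := by
  obtain ⟨𝒱, rfl⟩ := h
  exact 𝒱.finite_toSet.isCompact_biUnion fun V _ => V.finite_toSet.isCompact_convexHull ℝ

lemma IsPolyhedral.isBounded {A : Set E3} (h : IsPolyhedral A) : Bornology.IsBounded A :=
  h.2.2.isCompact.isBounded.subset subset_closure

lemma closure_convexHull_eq {A : Set E3} (h : IsPolytopeUnion (closure A)) :
    ∃ V : Finset E3, closure (convexHull ℝ A) = convexHull ℝ (V : Set E3) := by
  classical
  obtain ⟨𝒱, h𝒱⟩ := h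
  refine ⟨𝒱.biUnion id, subset_antisymm ?_ ?_⟩
  · refine closure_minimal (convexHull_min ?_ (convex_convexHull ℝ _))
      ((Finset.finite_toSet _).isClosed_convexHull ℝ)
    refine subset_closure.trans (h𝒱.trans_subset (iUnion₂_subset fun V hV => convexHull_mono ?_))
    exact Finset.coe_subset.2 (Finset.subset_biUnion_of_mem id hV)
  · refine convexHull_min (fun x hx => ?_) (convex_convexHull ℝ A).closure
    obtain ⟨V, hV, hxV⟩ := Finset.mem_biUnion.1 (Finset.mem_coe.1 hx)
    have h1 : x ∈ closure A := by
      rw [h𝒱]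
      exact mem_iUnion₂.2 ⟨V, hV, subset_convexHull ℝ _ hxV⟩
    exact closure_mono (subset_convexHull ℝ A) h1

lemma exists_adapted_interior_hull {A : Set E3} (h : IsPolyhedral A) :
    ∃ F, IsPlaneFamily F ∧ IsAdapted F (interior (closure (convexHull ℝ A))) := by
  obtain ⟨V, hV⟩ := closure_convexHull_eq h.2.2
  obtain ⟨F, hF, hF'⟩ := exists_planeFamily_convexHull V
  rw [← hV] at hF'
  set C := closure (convexHull ℝ A)
  have hC : IsClosed C := isClosed_closure
  refine ⟨F, hF, ⟨isOpen_interior, subset_antisymm ?_ ?_, ?_⟩⟩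
  · exact interior_mono (closure_minimal interior_subset hC)
  · exact interior_maximal subset_closure isOpen_interior
  · refine subset_trans ?_ hF'
    rw [isOpen_interior.frontier_eq, hC.frontier_eq]
    exact sdiff_subset_sdiff_left (closure_minimal interior_subset hC)

/-- The part of a regular open set outside of the closure of another one. -/
lemma IsAdapted.diff_closure {F : Set (E3 × ℝ)} {A B : Set E3} (hA : IsAdapted F A)
    (hB : IsAdapted F B) : IsAdapted F (A \ closure B) where
  isOpen := hA.isOpen.sdiff isClosed_closure
  regular := by
    have hopen := hA.isOpen.sdiff (isClosed_closure (s := B))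
    refine subset_antisymm ?_ (interior_maximal subset_closure hopen)
    intro x hx
    refine ⟨hA.regular ▸ interior_mono (closure_mono sdiff_subset) hx, fun hxB => ?_⟩
    obtain ⟨y, hy, hyB⟩ := mem_closure_iff.1 hxB _ isOpen_interior hx
    obtain ⟨z, hz, hz'⟩ := mem_closure_iff.1 (interior_subset hy) _ hB.isOpen hyB
    exact hz'.2 (subset_closure hz)
  frontier_subset := by
    have h1 : A \ closure B = A ∩ (closure B)ᶜ := rfl
    rw [h1]
    refine (frontier_inter_subset _ _).trans (union_subset
      (inter_subset_left.trans hA.frontier_subset) (inter_subset_right.trans ?_))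
    rw [frontier_compl]
    refine subset_trans ?_ hB.frontier_subset
    exact frontier_closure_subset

/-! ### Regular boundary points -/

/-- For different unit vectors, a small step in direction `w - v` has negative product with `v` and
positive product with `w`: it would lie both inside and outside of `A`. -/
lemma IsOuterNormal.unique {A : Set E3} {x v w : E3} (hv : IsOuterNormal A x v)
    (hw : IsOuterNormal A x w) : v = w := by
  by_contra hne
  obtain ⟨hv1, r, hr, hv⟩ := hv
  obtain ⟨hw1, s, hs, hw⟩ := hw
  have h1 : inner ℝ w v < (1 : ℝ) := (inner_lt_one_iff_real_of_norm_eq_one hw1 hv1).2 (Ne.symm hne)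
  have h0 : 0 < ‖w - v‖ := norm_pos_iff.2 (sub_ne_zero.2 (Ne.symm hne))
  set t := min r s / 2 / ‖w - v‖
  have ht : 0 < t := by positivity
  have hdist : ‖t • (w - v)‖ = min r s / 2 := by
    rw [norm_smul, Real.norm_of_nonneg ht.le, div_mul_cancel₀ _ h0.ne']
  have hmin : 0 < min r s := lt_min hr hs
  have e1 := hv (x + t • (w - v)) (by
    rw [mem_ball_iff_norm, add_sub_cancel_left, hdist]
    linarith [min_le_left r s])
  have e2 := hw (x + t • (w - v)) (by
    rw [mem_ball_iff_norm, add_sub_cancel_left, hdist]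
    linarith [min_le_right r s])
  rw [add_sub_cancel_left, inner_smul_left, inner_sub_left, real_inner_self_eq_norm_sq] at e1 e2
  rw [hv1] at e1
  rw [hw1, real_inner_comm] at e2
  have hin : x + t • (w - v) ∈ A := e1.2 (mul_neg_of_pos_of_neg (by simpa using ht) (by linarith))
  have hout := e2.1 hin
  have : (0 : ℝ) < t * (1 ^ 2 - inner ℝ w v) := mul_pos ht (by linarith)
  simp only [conj_trivial] at hout
  linarith

lemma IsOuterNormal.eventually {A : Set E3} {x v : E3} (h : IsOuterNormal A x v) (d : E3) :
    ∃ ε > 0, ∀ t : ℝ, 0 < t → t < ε → (x + t • d ∈ A ↔ inner ℝ d v < 0) := by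
  obtain ⟨-, r, hr, h⟩ := h
  refine ⟨r / (‖d‖ + 1), by positivity, fun t ht htr => ?_⟩
  rw [h, add_sub_cancel_left, inner_smul_left]
  · simp [mul_neg_iff, ht, not_lt.2 ht.le]
  · rw [mem_ball_iff_norm, add_sub_cancel_left, norm_smul, Real.norm_of_nonneg ht.le]
    rw [lt_div_iff₀ (by positivity)] at htr
    nlinarith [norm_nonneg d]

lemma IsOuterNormal.not_neg_of_subset {A B : Set E3} {x v : E3} (hA : IsOuterNormal A x v)
    (hB : IsOuterNormal B x (-v)) (hAB : A ⊆ B) : False := by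
  obtain ⟨ε, hε, h1⟩ := hA.eventually (-v)
  obtain ⟨δ, hδ, h2⟩ := hB.eventually (-v)
  have hv := hA.1
  have ht : 0 < min ε δ / 2 := by positivity
  have hm : 0 < min ε δ := lt_min hε hδ
  have e1 := (h1 _ ht (by linarith [min_le_left ε δ])).2 (by simp [hv])
  have e2 := (h2 _ ht (by linarith [min_le_right ε δ])).1 (hAB e1)
  simp [hv] at e2
  linarith

lemma IsOuterNormal.not_disjoint {A B : Set E3} {x v : E3} (hA : IsOuterNormal A x v)
    (hB : IsOuterNormal B x v) (hAB : Disjoint A B) : False := by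
  obtain ⟨ε, hε, h1⟩ := hA.eventually (-v)
  obtain ⟨δ, hδ, h2⟩ := hB.eventually (-v)
  have hv := hA.1
  have ht : 0 < min ε δ / 2 := by positivity
  have hm : 0 < min ε δ := lt_min hε hδ
  exact disjoint_left.1 hAB ((h1 _ ht (by linarith [min_le_left ε δ])).2 (by simp [hv]))
    ((h2 _ ht (by linarith [min_le_right ε δ])).2 (by simp [hv]))

lemma exists_ball_inter_planeUnion {F : Set (E3 × ℝ)} (hF : IsPlaneFamily F) {y : E3}
    {p : E3 × ℝ} (hp : p ∈ F) (hy : y ∈ plane p) (hex : y ∉ exceptional F) :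
    ∃ r > 0, ∀ z ∈ Metric.ball y r, z ∈ planeUnion F → z ∈ plane p := by
  have hfin : {q ∈ F | q ≠ p ∧ q ≠ -p}.Finite := hF.finite.subset (sep_subset _ _)
  have hclosed : IsClosed (⋃ q ∈ {q ∈ F | q ≠ p ∧ q ≠ -p}, plane q) :=
    hfin.isClosed_biUnion fun q _ => isClosed_plane q
  have hyn : y ∈ (⋃ q ∈ {q ∈ F | q ≠ p ∧ q ≠ -p}, plane q)ᶜ := by
    simp only [mem_compl_iff, mem_iUnion, not_exists]
    exact fun q hq hyq => hex (mem_exceptional hp hq.1 hq.2.1 hq.2.2 hy hyq)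
  obtain ⟨r, hr, hball⟩ := Metric.isOpen_iff.1 hclosed.isOpen_compl y hyn
  refine ⟨r, hr, fun z hz hzF => ?_⟩
  obtain ⟨q, hq, hzq⟩ := mem_iUnion₂.1 hzF
  by_cases h1 : q = p
  · exact h1 ▸ hzq
  by_cases h2 : q = -p
  · rwa [h2, plane_neg] at hzq
  · exact absurd (mem_iUnion₂.2 ⟨q, ⟨hq, h1, h2⟩, hzq⟩) (hball hz)

lemma exists_add_smul_mem {U : Set E3} (hU : IsOpen U) {z : E3} (hz : z ∈ U) (v : E3) :
    ∃ t : ℝ, 0 < t ∧ z + t • v ∈ U ∧ z - t • v ∈ U := by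
  have h1 : Filter.Tendsto (fun t : ℝ => z + t • v) (nhds 0) (nhds z) := by
    have : Continuous fun t : ℝ => z + t • v := by fun_prop
    simpa using this.tendsto 0
  have h2 : Filter.Tendsto (fun t : ℝ => z - t • v) (nhds 0) (nhds z) := by
    have : Continuous fun t : ℝ => z - t • v := by fun_prop
    simpa using this.tendsto 0
  have h3 := (h1.eventually (hU.mem_nhds hz)).and (h2.eventually (hU.mem_nhds hz))
  obtain ⟨ε, hε, h⟩ := Metric.eventually_nhds_iff.1 h3
  exact ⟨ε / 2, by positivity, h (by rw [Real.dist_eq, sub_zero, abs_of_pos] <;> linarith)⟩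

/-- At a point of exactly one plane, an adapted set is locally a half space. -/
lemma IsAdapted.isOuterNormal {F : Set (E3 × ℝ)} (hF : IsPlaneFamily F) {A : Set E3}
    (hA : IsAdapted F A) {y : E3} (hyA : y ∈ frontier A) {p : E3 × ℝ} (hp : p ∈ F)
    (hy : y ∈ plane p) (hex : y ∉ exceptional F) :
    IsOuterNormal A y p.1 ∨ IsOuterNormal A y (-p.1) := by
  obtain ⟨r, hr, hball⟩ := exists_ball_inter_planeUnion hF hp hy hex
  have hn : ‖p.1‖ = 1 := hF.norm p hp
  have hyp : ∀ z, inner ℝ (z - y) p.1 = inner ℝ z p.1 - p.2 := fun z => by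
    rw [inner_sub_left, show inner ℝ y p.1 = p.2 from hy]
  -- A connected set off the plane `p` does not meet the frontier of `A` inside this ball, so it
  -- lies on one side of the frontier. This is applied to the two open half balls.
  have hsplit : ∀ (B : Set E3), IsPreconnected B → B ⊆ Metric.ball y r →
      (∀ z ∈ B, inner ℝ (z - y) p.1 ≠ 0) → B ⊆ A ∨ Disjoint B A := by
    intro B hB hBr hB0
    have h1 : B ⊆ A ∪ (closure A)ᶜ := by
      intro z hz
      by_contra hcon
      rw [mem_union, not_or, mem_compl_iff, not_not] at hcon
      have hzf : z ∈ frontier A := by rw [hA.isOpen.frontier_eq]; exact ⟨hcon.2, hcon.1⟩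
      have := hball z (hBr hz) (hA.frontier_subset hzf)
      exact hB0 z hz (by rw [hyp, show inner ℝ z p.1 = p.2 from this, sub_self])
    rcases hB.subset_or_subset hA.isOpen isClosed_closure.isOpen_compl
      (disjoint_compl_right.mono_left subset_closure) h1 with h | h
    · exact Or.inl h
    · exact Or.inr (disjoint_left.2 fun z hz hzA => h hz (subset_closure hzA))
  let pos : Set E3 := Metric.ball y r ∩ {z | 0 < inner ℝ (z - y) p.1}
  let neg : Set E3 := Metric.ball y r ∩ {z | inner ℝ (z - y) p.1 < 0}
  have hlin : IsLinearMap ℝ fun z : E3 => inner ℝ z p.1 :=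
    ⟨fun a b => inner_add_left a b _, fun c a => by simp [inner_smul_left]⟩
  have hposc : Convex ℝ pos := by
    refine (convex_ball y r).inter ?_
    simp only [hyp, sub_pos]
    exact convex_halfSpace_gt hlin p.2
  have hnegc : Convex ℝ neg := by
    refine (convex_ball y r).inter ?_
    simp only [hyp, sub_neg]
    exact convex_halfSpace_lt hlin p.2
  have hpos := hsplit pos hposc.isPreconnected inter_subset_left fun z hz => (mem_ofPred.1 hz.2).ne'
  have hneg := hsplit neg hnegc.isPreconnected inter_subset_left fun z hz => (mem_ofPred.1 hz.2).ne
  have hstep : ∀ U : Set E3, IsOpen U → ∀ z ∈ U, z ∈ Metric.ball y r →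
      inner ℝ (z - y) p.1 = 0 → (U ∩ pos).Nonempty ∧ (U ∩ neg).Nonempty := by
    intro U hU z hz hzr hz0
    obtain ⟨t, ht, h1, h2⟩ := exists_add_smul_mem (hU.inter Metric.isOpen_ball) ⟨hz, hzr⟩ p.1
    have h3 : inner ℝ (z + t • p.1 - y) p.1 = t := by
      rw [add_sub_right_comm, inner_add_left, hz0, inner_smul_left, real_inner_self_eq_norm_sq, hn]
      simp
    have h4 : inner ℝ (z - t • p.1 - y) p.1 = -t := by
      rw [sub_right_comm, inner_sub_left, hz0, inner_smul_left, real_inner_self_eq_norm_sq, hn]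
      simp
    exact ⟨⟨_, h1.1, h1.2, by rw [mem_ofPred_eq, h3]; exact ht⟩,
      ⟨_, h2.1, h2.2, by rw [mem_ofPred_eq, h4]; linarith⟩⟩
  have hyA' : y ∉ A := fun h => by
    have := hA.isOpen.inter_frontier_eq
    exact (this ▸ (⟨h, hyA⟩ : y ∈ A ∩ frontier A) : y ∈ (∅ : Set E3))
  -- If both half balls are in `A`, then `y` is interior to `closure A`, hence in `A` by regularity;
  -- if neither is, then `y` is not in `closure A`. Both contradict `y ∈ frontier A`, and the two
  -- mixed cases are the two possible normals.
  rcases hpos with hpos | hpos <;> rcases hneg with hneg | hneg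
  · exfalso
    refine hyA' ?_
    rw [← hA.regular]
    refine mem_interior.2 ⟨Metric.ball y r, fun z hz => ?_, Metric.isOpen_ball,
      Metric.mem_ball_self hr⟩
    rcases lt_trichotomy (inner ℝ (z - y) p.1) 0 with h | h | h
    · exact subset_closure (hneg ⟨hz, h⟩)
    · refine mem_closure_iff.2 fun U hU hzU => ?_
      obtain ⟨a, ha, ha'⟩ := (hstep U hU z hzU hz h).1
      exact ⟨a, ha, hpos ha'⟩
    · exact subset_closure (hpos ⟨hz, h⟩)
  · right
    refine ⟨by rwa [norm_neg], r, hr, fun z hz => ?_⟩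
    rw [inner_neg_right, neg_lt_zero]
    refine ⟨fun hzA => ?_, fun h => hpos ⟨hz, h⟩⟩
    rcases lt_trichotomy (inner ℝ (z - y) p.1) 0 with h | h | h
    · exact absurd hzA (disjoint_left.1 hneg ⟨hz, h⟩)
    · obtain ⟨a, ha, ha'⟩ := (hstep A hA.isOpen z hzA hz h).2
      exact absurd ha (disjoint_left.1 hneg ha')
    · exact h
  · left
    refine ⟨hn, r, hr, fun z hz => ⟨fun hzA => ?_, fun h => hneg ⟨hz, h⟩⟩⟩
    rcases lt_trichotomy (inner ℝ (z - y) p.1) 0 with h | h | h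
    · exact h
    · obtain ⟨a, ha, ha'⟩ := (hstep A hA.isOpen z hzA hz h).1
      exact absurd ha (disjoint_left.1 hpos ha')
    · exact absurd hzA (disjoint_left.1 hpos ⟨hz, h⟩)
  · exfalso
    obtain ⟨z, hz, hzA⟩ := mem_closure_iff.1 (frontier_subset_closure hyA) _ Metric.isOpen_ball
      (Metric.mem_ball_self hr)
    rcases lt_trichotomy (inner ℝ (z - y) p.1) 0 with h | h | h
    · exact disjoint_left.1 hneg ⟨hz, h⟩ hzA
    · obtain ⟨a, ha, ha'⟩ := (hstep A hA.isOpen z hzA hz h).1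
      exact disjoint_left.1 hpos ha' ha
    · exact disjoint_left.1 hpos ⟨hz, h⟩ hzA

/-- Closedness of the family under `p ↦ -p` allows choosing the orientation that agrees with the
outer normal. -/
lemma IsAdapted.exists_normal {F : Set (E3 × ℝ)} (hF : IsPlaneFamily F) {A : Set E3}
    (hA : IsAdapted F A) {y : E3} (hyA : y ∈ frontier A) (hex : y ∉ exceptional F) :
    ∃ p ∈ F, y ∈ plane p ∧ IsOuterNormal A y p.1 := by
  obtain ⟨p, hp, hy⟩ := mem_iUnion₂.1 (hA.frontier_subset hyA)
  rcases hA.isOuterNormal hF hyA hp hy hex with h | h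
  · exact ⟨p, hp, hy, h⟩
  · exact ⟨-p, hF.neg p hp, by rwa [plane_neg], h⟩

/-- Off the exceptional set, three pairwise disjoint adapted sets have no common boundary point. -/
lemma not_mem_three_frontiers {F : Set (E3 × ℝ)} (hF : IsPlaneFamily F) {A B C : Set E3}
    (hA : IsAdapted F A) (hB : IsAdapted F B) (hC : IsAdapted F C) (hAB : Disjoint A B)
    (hAC : Disjoint A C) (hBC : Disjoint B C) {y : E3} (hyA : y ∈ frontier A)
    (hyB : y ∈ frontier B) (hyC : y ∈ frontier C) : y ∈ exceptional F := by
  by_contra hex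
  obtain ⟨p, hp, hy, hnA⟩ := hA.exists_normal hF hyA hex
  -- `A` and `B` occupy the opposite sides of the plane, so no side is left for `C`.
  rcases hB.isOuterNormal hF hyB hp hy hex with hnB | hnB
  · exact hnA.not_disjoint hnB hAB
  rcases hC.isOuterNormal hF hyC hp hy hex with hnC | hnC
  · exact hnA.not_disjoint hnC hAC
  · exact hnB.not_disjoint hnC hBC

/-- Off the exceptional set, a common boundary point of two disjoint adapted subsets is not a
boundary point of the whole. -/
lemma not_mem_frontier_whole {F : Set (E3 × ℝ)} (hF : IsPlaneFamily F) {A B C : Set E3}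
    (hA : IsAdapted F A) (hB : IsAdapted F B) (hC : IsAdapted F C) (hAB : Disjoint A B)
    (hAC : A ⊆ C) (hBC : B ⊆ C) {y : E3} (hyA : y ∈ frontier A)
    (hyB : y ∈ frontier B) (hyC : y ∈ frontier C) : y ∈ exceptional F := by
  by_contra hex
  obtain ⟨p, hp, hy, hnA⟩ := hA.exists_normal hF hyA hex
  -- `A` and `B` fill both sides of the plane, whereas `C` would occupy only one of them.
  rcases hB.isOuterNormal hF hyB hp hy hex with hnB | hnB
  · exact hnA.not_disjoint hnB hAB
  rcases hC.isOuterNormal hF hyC hp hy hex with hnC | hnC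
  · exact hnB.not_neg_of_subset (by rwa [neg_neg]) hBC
  · exact hnA.not_neg_of_subset hnC hAC

/-! ### Charts of planes and area -/

/-- The Euclidean plane. -/
abbrev E2 : Type := EuclideanSpace ℝ (Fin 2)

lemma volume_linear_fiber {E : Type*} [NormedAddCommGroup E] [InnerProductSpace ℝ E]
    [FiniteDimensional ℝ E] [MeasurableSpace E] [BorelSpace E] {f : E →ₗ[ℝ] ℝ} (hf : f ≠ 0)
    (c : ℝ) : volume {w : E | f w = c} = 0 := by
  obtain ⟨w₀, hw₀⟩ := LinearMap.surjective hf c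
  have h1 : {w : E | f w = c} = (AffineSubspace.mk' w₀ f.ker : Set E) := by
    ext w
    simp [AffineSubspace.mem_mk', hw₀, sub_eq_zero]
  rw [h1]
  refine Measure.addHaar_affineSubspace _ _ fun htop => hf ?_
  have h2 := congrArg AffineSubspace.direction htop
  rw [AffineSubspace.direction_mk', AffineSubspace.direction_top] at h2
  exact LinearMap.ker_eq_top.1 h2

lemma volume_inner_eq_zero {v : E3} (hv : v ≠ 0) : volume {z : E3 | inner ℝ z v = 0} = 0 := by
  have h := volume_linear_fiber (f := (innerₗ E3 v)) (fun h => hv ?_) 0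
  · simpa [real_inner_comm] using h
  · have := LinearMap.congr_fun h v
    simpa using this

/-- Isometric coordinates on the planes with unit normal `m`. -/
structure IsPlaneChart (m : E3) (ψ : E2 →ₗᵢ[ℝ] E3) : Prop where
  orth : ∀ w, inner ℝ (ψ w) m = 0
  surj : ∀ z, inner ℝ z m = 0 → ∃ w, ψ w = z
  measurePreserving : MeasurePreserving (fun q : ℝ × E2 => q.1 • m + ψ q.2)
    ((volume : Measure ℝ).prod volume) volume

lemma exists_isPlaneChart {m : E3} (hm : ‖m‖ = 1) : ∃ ψ, IsPlaneChart m ψ := by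
  have hm0 : m ≠ 0 := by rintro rfl; simp at hm
  have hfact : Fact (Module.finrank ℝ E3 = 2 + 1) := ⟨by simp⟩
  let s : Submodule ℝ E3 := ℝ ∙ m
  let e : E2 ≃ₗᵢ[ℝ] sᗮ := (OrthonormalBasis.fromOrthogonalSpanSingleton 2 hm0).repr.symm
  let ψ : E2 →ₗᵢ[ℝ] E3 := sᗮ.subtypeₗᵢ.comp e.toLinearIsometry
  let e₁ : ℝ ≃ₗᵢ[ℝ] s := LinearIsometryEquiv.toSpanUnitSingleton m hm
  have hψ : ∀ w, ψ w = (e w : E3) := fun w => rfl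
  have he₁ : ∀ r, (e₁ r : E3) = r • m := fun r => rfl
  refine ⟨ψ, fun w => ?_, fun z hz => ?_, ?_⟩
  · rw [real_inner_comm]
    exact Submodule.mem_orthogonal_singleton_iff_inner_right.1 (e w).2
  · have hz' : z ∈ sᗮ := Submodule.mem_orthogonal_singleton_iff_inner_left.2 hz
    exact ⟨e.symm ⟨z, hz'⟩, by rw [hψ, e.apply_symm_apply]⟩
  · have h1 := (s.measurePreserving_measurableEquivProd (0 : E3)).symm
    rw [InnerProductSpace.euclideanHausdorffMeasure_eq_volume] at h1
    have h2 : MeasurePreserving (Prod.map e₁ e) ((volume : Measure ℝ).prod (volume : Measure E2))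
      (volume.prod volume) := e₁.measurePreserving.prod e.measurePreserving
    have h3 : (fun q : ℝ × E2 => q.1 • m + ψ q.2)
        = (s.measurableEquivProd (0 : E3)).symm ∘ Prod.map e₁ e := by
      funext q
      simp [hψ, he₁]
    rw [h3]
    exact h1.comp h2

/-- Isometries preserve Hausdorff measure. This turns integrals with respect to area on a plane into
Lebesgue integrals. -/
lemma IsPlaneChart.map_eq {m : E3} {ψ : E2 →ₗᵢ[ℝ] E3} (h : IsPlaneChart m ψ) {c : ℝ} {b : E3}
    (hb : b ∈ plane (m, c)) :
    (volume : Measure E2).map (fun w => b + ψ w) = area.restrict (plane (m, c)) := by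
  have hiso : Isometry fun w => b + ψ w := (IsometryEquiv.addLeft b).isometry.comp ψ.isometry
  have hr : range (fun w => b + ψ w) = plane (m, c) := by
    have hb : inner ℝ b m = c := hb
    ext y
    constructor
    · rintro ⟨w, rfl⟩
      simp [plane, inner_add_left, h.orth, hb]
    · intro hy
      have hy : inner ℝ y m = c := hy
      obtain ⟨w, hw⟩ := h.surj (y - b) (by rw [inner_sub_left, hy, hb, sub_self])
      exact ⟨w, by simp [hw]⟩
  have := hiso.map_euclideanHausdorffMeasure (d := 2)
  rwa [EuclideanSpace.euclideanHausdorffMeasure_eq_volume, hr] at this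

lemma smul_mem_plane {m : E3} (hm : ‖m‖ = 1) (c : ℝ) : c • m ∈ plane (m, c) := by
  simp [plane, inner_smul_left, hm]

/-- In a chart of the first plane, the second plane is a line, hence null, unless the normals are
parallel; in that case two planes that are not equal up to orientation do not meet. -/
lemma area_plane_inter_plane {p q : E3 × ℝ} (hp : ‖p.1‖ = 1) (hq : ‖q.1‖ = 1) (h1 : q ≠ p)
    (h2 : q ≠ -p) : area (plane p ∩ plane q) = 0 := by
  obtain ⟨m, c⟩ := p
  obtain ⟨m', c'⟩ := q
  dsimp only at hp hq
  obtain ⟨ψ, hψ⟩ := exists_isPlaneChart hp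
  have hmeas : MeasurableSet (plane (m', c')) := (isClosed_plane _).measurableSet
  rw [inter_comm, ← Measure.restrict_apply hmeas, ← hψ.map_eq (smul_mem_plane hp c),
    Measure.map_apply (by fun_prop) hmeas]
  by_cases hf : (innerₗ E3 m').comp ψ.toLinearMap = 0
  · have horth : ∀ w, inner ℝ (ψ w) m' = 0 := fun w => by
      simpa [real_inner_comm] using LinearMap.congr_fun hf w
    set a : ℝ := inner ℝ m' m with ha
    obtain ⟨w, hw⟩ := hψ.surj (m' - a • m) (by
      rw [inner_sub_left, inner_smul_left, real_inner_self_eq_norm_sq, hp]; simp [ha])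
    have hm' : m' = a • m := by
      have e1 : inner ℝ (m' - a • m) (m' - a • m) = (0 : ℝ) := by
        conv_lhs => rw [inner_sub_right]
        rw [← hw, horth, inner_smul_right, hψ.orth]
        simp
      exact sub_eq_zero.1 (inner_self_eq_zero.1 e1)
    have ha1 : |a| = 1 := by
      have := congrArg norm hm'
      rwa [norm_smul, hp, hq, mul_one, Real.norm_eq_abs, eq_comm] at this
    have hval : ∀ w, inner ℝ (c • m + ψ w) m' = a * c := fun w => by
      rw [inner_add_left, horth, hm', inner_smul_left, inner_smul_right,
        real_inner_self_eq_norm_sq, hp]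
      simp [mul_comm]
    have hc' : c' ≠ a * c := by
      rintro rfl
      rcases eq_or_eq_neg_of_abs_eq ha1 with h | h
      · exact h1 (by rw [hm', h]; simp)
      · exact h2 (by rw [hm', h]; simp)
    have : (fun w => c • m + ψ w) ⁻¹' plane (m', c') = ∅ := by
      ext w
      simp only [mem_preimage, plane, mem_ofPred_eq, hval, mem_empty_iff_false, iff_false]
      exact hc'.symm
    rw [this, measure_empty]
  · refine measure_mono_null ?_ (volume_linear_fiber hf (c' - inner ℝ (c • m) m'))
    intro w hw
    have hw : inner ℝ (c • m + ψ w) m' = c' := hw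
    rw [inner_add_left] at hw
    simp only [mem_ofPred_eq, LinearMap.comp_apply, innerₗ_apply_apply]
    rw [real_inner_comm]
    exact eq_sub_of_add_eq' hw

lemma area_exceptional {F : Set (E3 × ℝ)} (hF : IsPlaneFamily F) : area (exceptional F) = 0 := by
  refine (measure_biUnion_null_iff hF.finite.countable).2 fun p hp =>
    (measure_biUnion_null_iff hF.finite.countable).2 fun q hq => ?_
  by_cases h : q ≠ p ∧ q ≠ -p
  · exact measure_mono_null (t := plane p ∩ plane q) (fun y hy => ⟨hy.2.2.1, hy.2.2.2⟩)
      (area_plane_inter_plane (hF.norm p hp) (hF.norm q hq) h.1 h.2)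
  · refine measure_mono_null (fun y hy => ?_) measure_empty
    exact h ⟨hy.1, hy.2.1⟩

lemma area_plane_inter_lt_top {p : E3 × ℝ} (hp : ‖p.1‖ = 1) {S : Set E3}
    (hS : Bornology.IsBounded S) : area (S ∩ plane p) < ⊤ := by
  obtain ⟨m, c⟩ := p
  dsimp only at hp
  obtain ⟨ψ, hψ⟩ := exists_isPlaneChart hp
  obtain ⟨R, hR⟩ := hS.subset_closedBall 0
  refine (measure_mono (inter_subset_inter_left _ hR)).trans_lt ?_
  have hmeas : MeasurableSet (Metric.closedBall (0 : E3) R) := Metric.isClosed_closedBall.measurableSet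
  rw [← Measure.restrict_apply hmeas, ← hψ.map_eq (smul_mem_plane hp c),
    Measure.map_apply (by fun_prop) hmeas]
  refine (measure_mono (t := Metric.closedBall 0 (R + ‖c • m‖)) fun w hw => ?_).trans_lt
    measure_closedBall_lt_top
  rw [mem_closedBall_zero_iff]
  rw [mem_preimage, mem_closedBall_zero_iff] at hw
  have := norm_sub_le (c • m + ψ w) (c • m)
  rw [add_sub_cancel_left, ψ.norm_map] at this
  linarith

lemma area_lt_top {F : Set (E3 × ℝ)} (hF : IsPlaneFamily F) {S : Set E3}
    (hS : Bornology.IsBounded S) (hSF : S ⊆ planeUnion F) : area S < ⊤ := by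
  have h1 : S ⊆ ⋃ p ∈ F, S ∩ plane p := fun y hy => by
    obtain ⟨p, hp, hyp⟩ := mem_iUnion₂.1 (hSF hy)
    exact mem_iUnion₂.2 ⟨p, hp, hy, hyp⟩
  exact (measure_mono h1).trans_lt (measure_biUnion_lt_top hF.finite fun p hp =>
    area_plane_inter_lt_top (hF.norm p hp) hS)

/-! ### Integration over cones -/

/-- The cone of directions in which a subset `V` of the plane `p` is seen from `x`. -/
def seenCone (x : E3) (p : E3 × ℝ) (V : Set E3) : Set E3 :=
  {z | 0 < inner ℝ z p.1 ∧ x + ((p.2 - inner ℝ x p.1) / inner ℝ z p.1) • z ∈ V}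

lemma measurableSet_seenCone (x : E3) (p : E3 × ℝ) {V : Set E3} (hV : MeasurableSet V) :
    MeasurableSet (seenCone x p V) := by
  have h1 : Measurable fun z : E3 => inner ℝ z p.1 := by fun_prop
  refine (measurableSet_lt measurable_const h1).inter ?_
  have : Measurable fun z : E3 => x + ((p.2 - inner ℝ x p.1) / inner ℝ z p.1) • z := by fun_prop
  exact this hV

lemma lintegral_comp_smul_E2 {f : E2 → ℝ≥0∞} (hf : Measurable f) {r : ℝ} (hr : 0 < r) :
    ∫⁻ w, f (r⁻¹ • w) = ENNReal.ofReal (r ^ 2) * ∫⁻ w, f w := by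
  have h1 : Measurable fun w : E2 => r⁻¹ • w := by fun_prop
  rw [← lintegral_map hf h1, Measure.map_addHaar_smul _ (inv_pos.2 hr).ne', lintegral_smul_measure]
  congr 2
  simp

/-- Integration over a cone in terms of its intersection with a plane. -/
lemma setLIntegral_seenCone {x : E3} {p : E3 × ℝ} (hp : ‖p.1‖ = 1)
    (hd : 0 < p.2 - inner ℝ x p.1) {V : Set E3} (hV : MeasurableSet V) (hVp : V ⊆ plane p)
    {g : E3 → ℝ≥0∞} (hg : Measurable g) :
    ∫⁻ z in seenCone x p V, g z = ∫⁻ y in V, (∫⁻ h in Ioi (0 : ℝ),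
      ENNReal.ofReal ((h / (p.2 - inner ℝ x p.1)) ^ 2)
        * g ((h / (p.2 - inner ℝ x p.1)) • (y - x))) ∂area := by
  obtain ⟨m, c⟩ := p
  dsimp only at hp hd ⊢
  set d := c - inner ℝ x m with hd_def
  obtain ⟨ψ, hψ⟩ := exists_isPlaneChart hp
  have hmm : inner ℝ m m = (1 : ℝ) := by rw [real_inner_self_eq_norm_sq, hp, one_pow]
  have hb : x + d • m ∈ plane (m, c) := by
    simp [plane, inner_add_left, inner_smul_left, hp, hd_def]
  have hin : ∀ h w, inner ℝ (h • m + ψ w) m = h := fun h w => by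
    rw [inner_add_left, hψ.orth, inner_smul_left, hmm]; simp
  have hcone := measurableSet_seenCone x (m, c) hV
  have hchart : Measurable fun q : ℝ × E2 => q.1 • m + ψ q.2 := hψ.measurePreserving.measurable
  -- the integrand on the plane, in the chart, after scaling to unit height
  let G : ℝ → E2 → ℝ≥0∞ := fun h w =>
    ((fun w => x + d • m + ψ w) ⁻¹' V).indicator (fun w => g ((h / d) • (d • m + ψ w))) w
  have hVm : MeasurableSet ((fun w => x + d • m + ψ w) ⁻¹' V) :=
    (by fun_prop : Measurable fun w => x + d • m + ψ w) hV
  have hG : ∀ h, Measurable (G h) := fun h =>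
    (hg.comp (by fun_prop : Measurable fun w => (h / d) • (d • m + ψ w))).indicator hVm
  have hGu : Measurable fun q : ℝ × E2 => G q.1 q.2 := by
    have h1 : (fun q : ℝ × E2 => G q.1 q.2) =
        (Prod.snd ⁻¹' ((fun w => x + d • m + ψ w) ⁻¹' V)).indicator
          fun q : ℝ × E2 => g ((q.1 / d) • (d • m + ψ q.2)) := rfl
    rw [h1]
    exact (hg.comp (by fun_prop : Measurable fun q : ℝ × E2 =>
      (q.1 / d) • (d • m + ψ q.2))).indicator (measurable_snd hVm)
  calc ∫⁻ z in seenCone x (m, c) V, g z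
      = ∫⁻ q : ℝ × E2, (seenCone x (m, c) V).indicator g (q.1 • m + ψ q.2)
          ∂((volume : Measure ℝ).prod volume) := by
        rw [← lintegral_indicator hcone,
          hψ.measurePreserving.lintegral_comp (hg.indicator hcone)]
    _ = ∫⁻ h : ℝ, ∫⁻ w : E2, (seenCone x (m, c) V).indicator g (h • m + ψ w) :=
        lintegral_prod _ ((hg.indicator hcone).comp hchart).aemeasurable
    -- Seen from the apex, the slice of the cone at height `h` is a copy of `V` scaled by `h / d`.
    -- Rescaling the slice later produces the Jacobian `(h / d) ^ 2`.
    _ = ∫⁻ h : ℝ, (Ioi (0 : ℝ)).indicator (fun h => ∫⁻ w : E2, G h ((h / d)⁻¹ • w)) h := by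
        refine lintegral_congr fun h => ?_
        by_cases hh : 0 < h
        · rw [indicator_of_mem (mem_Ioi.2 hh)]
          refine lintegral_congr fun w => ?_
          have e1 : (h / d) • (d • m + ψ ((h / d)⁻¹ • w)) = h • m + ψ w := by
            rw [smul_add, smul_smul, map_smul, smul_smul, div_mul_cancel₀ _ hd.ne',
              mul_inv_cancel₀ (div_pos hh hd).ne', one_smul]
          have e2 : x + (d / h) • (h • m + ψ w) = x + d • m + ψ ((h / d)⁻¹ • w) := by
            rw [smul_add, smul_smul, map_smul, inv_div, div_mul_cancel₀ _ hh.ne', add_assoc]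
          have e3 : h • m + ψ w ∈ seenCone x (m, c) V ↔
              (h / d)⁻¹ • w ∈ (fun w => x + d • m + ψ w) ⁻¹' V := by
            simp only [seenCone, mem_ofPred_eq, hin, hh, true_and, mem_preimage, ← e2]
            rfl
          by_cases hz : h • m + ψ w ∈ seenCone x (m, c) V
          · rw [indicator_of_mem hz]
            simp only [G]
            rw [indicator_of_mem (e3.1 hz), e1]
          · rw [indicator_of_notMem hz]
            simp only [G]
            rw [indicator_of_notMem (fun h' => hz (e3.2 h'))]
        · rw [indicator_of_notMem (by simpa using hh)]
          refine (lintegral_congr fun w => ?_).trans lintegral_zero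
          refine indicator_of_notMem (fun hz => hh ?_) _
          have := hz.1
          rwa [hin] at this
    _ = ∫⁻ h in Ioi (0 : ℝ), ∫⁻ w : E2, ENNReal.ofReal ((h / d) ^ 2) * G h w := by
        rw [lintegral_indicator measurableSet_Ioi]
        refine setLIntegral_congr_fun measurableSet_Ioi fun h hh => ?_
        rw [lintegral_comp_smul_E2 (hG h) (div_pos hh hd), lintegral_const_mul _ (hG h)]
    _ = ∫⁻ w : E2, ∫⁻ h in Ioi (0 : ℝ), ENNReal.ofReal ((h / d) ^ 2) * G h w := by
        refine lintegral_lintegral_swap (Measurable.aemeasurable ?_)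
        exact (by fun_prop : Measurable fun q : ℝ × E2 => ENNReal.ofReal ((q.1 / d) ^ 2)).mul hGu
    _ = ∫⁻ w : E2, V.indicator (fun y => ∫⁻ h in Ioi (0 : ℝ), ENNReal.ofReal ((h / d) ^ 2)
          * g ((h / d) • (y - x))) (x + d • m + ψ w) := by
        refine lintegral_congr fun w => ?_
        by_cases hw : x + d • m + ψ w ∈ V
        · rw [indicator_of_mem hw]
          refine lintegral_congr fun h => ?_
          simp only [G]
          rw [indicator_of_mem (show w ∈ (fun w => x + d • m + ψ w) ⁻¹' V from hw)]
          congr 3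
          abel
        · rw [indicator_of_notMem hw]
          have hG0 : ∀ h, G h w = 0 := fun h =>
            indicator_of_notMem (show w ∉ (fun w => x + d • m + ψ w) ⁻¹' V from hw) _
          simp [hG0]
    _ = _ := by
        have hmeas : Measurable fun y => ∫⁻ h in Ioi (0 : ℝ), ENNReal.ofReal ((h / d) ^ 2)
            * g ((h / d) • (y - x)) := by
          refine Measurable.lintegral_prod_right' (f := fun q : E3 × ℝ =>
            ENNReal.ofReal ((q.2 / d) ^ 2) * g ((q.2 / d) • (q.1 - x))) ?_
          exact (by fun_prop : Measurable fun q : E3 × ℝ => ENNReal.ofReal ((q.2 / d) ^ 2)).mul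
            (hg.comp (by fun_prop))
        rw [← lintegral_map (f := V.indicator _) (hmeas.indicator hV) (by fun_prop),
          hψ.map_eq hb, lintegral_indicator hV, Measure.restrict_restrict hV,
          inter_eq_left.2 hVp]

/-- The weight `⟪z, ν⟫ exp (-‖z‖²)`, whose integrals over cones give view factors. -/
noncomputable def coneWeight (ν z : E3) : ℝ≥0∞ :=
  ENNReal.ofReal (inner ℝ z ν * Real.exp (-‖z‖ ^ 2))

lemma measurable_coneWeight (ν : E3) : Measurable (coneWeight ν) := by
  unfold coneWeight
  fun_prop

lemma lintegral_pow_mul_exp_neg_mul_sq (n : ℕ) {b : ℝ} (hb : 0 < b) :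
    ∫⁻ h in Ioi (0 : ℝ), ENNReal.ofReal (h ^ n * Real.exp (-b * h ^ 2)) =
      ENNReal.ofReal (b ^ (-((n : ℝ) + 1) / 2) * (1 / 2) * Real.Gamma (((n : ℝ) + 1) / 2)) := by
  have h1 := integral_rpow_mul_exp_neg_mul_rpow (p := 2) (q := n) two_pos
    (by have : (0 : ℝ) ≤ n := n.cast_nonneg
        linarith) hb
  rw [← h1, ofReal_integral_eq_lintegral_ofReal]
  · refine setLIntegral_congr_fun measurableSet_Ioi fun h hh => ?_
    simp only [Real.rpow_natCast, Real.rpow_ofNat]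
  -- Integrability follows from the known value: without it the integral would be `0` by convention,
  -- but the value is positive.
  · by_contra hni
    rw [integral_undef hni] at h1
    have h2 : 0 < Real.Gamma (((n : ℝ) + 1) / 2) := Real.Gamma_pos_of_pos (by positivity)
    have h3 : 0 < b ^ (-((n : ℝ) + 1) / 2) := Real.rpow_pos_of_pos hb _
    have : 0 < b ^ (-((n : ℝ) + 1) / 2) * (1 / 2) * Real.Gamma (((n : ℝ) + 1) / 2) := by positivity
    exact this.ne h1
  · filter_upwards [ae_restrict_mem measurableSet_Ioi] with h hh
    exact mul_nonneg (Real.rpow_nonneg (le_of_lt hh) _) (Real.exp_nonneg _)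

lemma lintegral_mul_exp_neg_sq :
    ∫⁻ h in Ioi (0 : ℝ), ENNReal.ofReal (h * Real.exp (-h ^ 2)) = ENNReal.ofReal (1 / 2) := by
  have h := lintegral_pow_mul_exp_neg_mul_sq 1 one_pos
  norm_num at h
  simpa using h

lemma lintegral_cube_mul_exp_neg_mul_sq {b : ℝ} (hb : 0 < b) :
    ∫⁻ h in Ioi (0 : ℝ), ENNReal.ofReal (h ^ 3 * Real.exp (-b * h ^ 2)) =
      ENNReal.ofReal (1 / (2 * b ^ 2)) := by
  rw [lintegral_pow_mul_exp_neg_mul_sq 3 hb]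
  congr 1
  have h1 : ((3 : ℕ) + 1 : ℝ) / 2 = 2 := by norm_num
  have h2 : -((3 : ℕ) + 1 : ℝ) / 2 = -(2 : ℕ) := by norm_num
  rw [h1, h2, Real.rpow_neg hb.le, Real.rpow_natCast, Real.Gamma_two]
  field_simp

lemma lintegral_exp_neg_sq_E2 :
    ∫⁻ w : E2, ENNReal.ofReal (Real.exp (-‖w‖ ^ 2)) = ENNReal.ofReal Real.pi := by
  have h1 := GaussianFourier.integral_rexp_neg_mul_sq_norm (V := E2) one_pos
  simp only [neg_mul, one_mul, div_one, finrank_euclideanSpace, Fintype.card_fin] at h1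
  norm_num at h1
  rw [← h1, ofReal_integral_eq_lintegral_ofReal]
  · by_contra hni
    rw [integral_undef hni] at h1
    exact Real.pi_pos.ne h1
  · exact Filter.Eventually.of_forall fun w => Real.exp_nonneg _

/-- The total weight of a half space. -/
lemma setLIntegral_coneWeight {ν : E3} (hν : ‖ν‖ = 1) :
    ∫⁻ z in {z | 0 < inner ℝ z ν}, coneWeight ν z = ENNReal.ofReal (Real.pi / 2) := by
  obtain ⟨ψ, hψ⟩ := exists_isPlaneChart hν
  have hS : MeasurableSet {z : E3 | 0 < inner ℝ z ν} :=
    measurableSet_lt measurable_const (by fun_prop : Measurable fun z : E3 => inner ℝ z ν)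
  have hmeas := (measurable_coneWeight ν).indicator hS
  have hin : ∀ h w, inner ℝ (h • ν + ψ w) ν = h := fun h w => by
    rw [inner_add_left, hψ.orth, inner_smul_left, real_inner_self_eq_norm_sq, hν]; simp
  have hnorm : ∀ h w, ‖h • ν + ψ w‖ ^ 2 = h ^ 2 + ‖w‖ ^ 2 := fun h w => by
    have : inner ℝ (h • ν) (ψ w) = (0 : ℝ) := by
      rw [inner_smul_left, real_inner_comm, hψ.orth, mul_zero]
    rw [norm_add_sq_real, this, norm_smul, hν, ψ.norm_map]
    simp
  rw [← lintegral_indicator hS, ← hψ.measurePreserving.lintegral_comp hmeas,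
    lintegral_prod (fun q : ℝ × E2 => {z | 0 < inner ℝ z ν}.indicator (coneWeight ν)
      (q.1 • ν + ψ q.2)) (hmeas.comp hψ.measurePreserving.measurable).aemeasurable]
  calc _ = ∫⁻ h : ℝ, (Ioi (0 : ℝ)).indicator (fun h => ENNReal.ofReal (h * Real.exp (-h ^ 2))
          * ENNReal.ofReal Real.pi) h := by
        refine lintegral_congr fun h => ?_
        by_cases hh : 0 < h
        · rw [indicator_of_mem (mem_Ioi.2 hh), ← lintegral_exp_neg_sq_E2,
            ← lintegral_const_mul _ (by fun_prop)]
          refine lintegral_congr fun w => ?_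
          rw [indicator_of_mem (by rw [mem_ofPred_eq, hin]; exact hh), coneWeight, hin, hnorm,
            ← ENNReal.ofReal_mul (mul_nonneg hh.le (Real.exp_nonneg _)), mul_assoc, ← Real.exp_add]
          congr 3
          ring
        · rw [indicator_of_notMem (by simpa using hh)]
          refine (lintegral_congr fun w => ?_).trans lintegral_zero
          exact indicator_of_notMem (by rw [mem_ofPred_eq, hin]; exact hh) _
    _ = ENNReal.ofReal (1 / 2) * ENNReal.ofReal Real.pi := by
        rw [lintegral_indicator measurableSet_Ioi, lintegral_mul_const _ (by fun_prop),
          lintegral_mul_exp_neg_sq]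
    _ = _ := by
        rw [← ENNReal.ofReal_mul (by norm_num)]
        congr 1
        ring

/-- The weight of a cone over a subset of a plane as a surface integral. -/
lemma setLIntegral_seenCone_coneWeight {x ν : E3} {p : E3 × ℝ} (hp : ‖p.1‖ = 1)
    (hd : 0 < p.2 - inner ℝ x p.1) {V : Set E3} (hV : MeasurableSet V) (hVp : V ⊆ plane p)
    (hν : ∀ y ∈ V, 0 ≤ inner ℝ (y - x) ν) :
    ∫⁻ z in seenCone x p V, coneWeight ν z = ∫⁻ y in V,
      ENNReal.ofReal ((p.2 - inner ℝ x p.1) * inner ℝ (y - x) ν / (2 * ‖y - x‖ ^ 4)) ∂area := by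
  rw [setLIntegral_seenCone hp hd hV hVp (measurable_coneWeight ν)]
  refine setLIntegral_congr_fun hV fun y hy => ?_
  set d := p.2 - inner ℝ x p.1 with hd_def
  have hyx : 0 < ‖y - x‖ := by
    refine norm_pos_iff.2 fun h => ?_
    have h1 : inner ℝ y p.1 = p.2 := hVp hy
    rw [sub_eq_zero.1 h] at h1
    rw [hd_def, h1, sub_self] at hd
    exact lt_irrefl _ hd
  have hb : 0 < ‖y - x‖ ^ 2 / d ^ 2 := by positivity
  have hc : 0 ≤ inner ℝ (y - x) ν / d ^ 3 := div_nonneg (hν y hy) (by positivity)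
  calc _ = ∫⁻ h in Ioi (0 : ℝ), ENNReal.ofReal (inner ℝ (y - x) ν / d ^ 3) *
        ENNReal.ofReal (h ^ 3 * Real.exp (-(‖y - x‖ ^ 2 / d ^ 2) * h ^ 2)) := by
        refine setLIntegral_congr_fun measurableSet_Ioi fun h hh => ?_
        have hh : 0 < h := hh
        rw [coneWeight, ← ENNReal.ofReal_mul (by positivity), ← ENNReal.ofReal_mul hc, norm_smul,
          Real.norm_of_nonneg (by positivity), inner_smul_left]
        congr 1
        have e1 : -(h / d * ‖y - x‖) ^ 2 = -(‖y - x‖ ^ 2 / d ^ 2) * h ^ 2 := by ring_nf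
        rw [e1]
        simp only [conj_trivial]
        ring_nf
    _ = _ := by
        rw [lintegral_const_mul _ (by fun_prop), lintegral_cube_mul_exp_neg_mul_sq hb,
          ← ENNReal.ofReal_mul hc]
        congr 1
        field_simp

/-! ### Visibility -/

lemma isOpen_setOf_segment_subset {A : Set E3} (hA : IsOpen A) (K : Set ℝ) (hK : IsCompact K) :
    IsOpen {q : E3 × E3 | ∀ t ∈ K, q.1 + t • (q.2 - q.1) ∈ A} := by
  rw [isOpen_iff_mem_nhds]
  intro q hq
  refine hK.eventually_forall_of_forall_eventually fun t ht => ?_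
  have hcont : Continuous fun r : (E3 × E3) × ℝ => r.1.1 + r.2 • (r.1.2 - r.1.1) := by fun_prop
  exact hcont.continuousAt.eventually (hA.mem_nhds (hq t ht))

lemma openSegment_subset_iff {A : Set E3} {x y : E3} :
    openSegment ℝ x y ⊆ A ↔ ∀ t ∈ Ioo (0 : ℝ) 1, x + t • (y - x) ∈ A := by
  rw [openSegment_eq_image']
  exact image_subset_iff

/-- Exhaust the open segment by compact subsegments: by compactness, containment of each of them in
`A` is an open condition. -/
lemma measurableSet_visible {A : Set E3} (hA : IsOpen A) :
    MeasurableSet {q : E3 × E3 | openSegment ℝ q.1 q.2 ⊆ A} := by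
  have h1 : {q : E3 × E3 | openSegment ℝ q.1 q.2 ⊆ A} =
      ⋂ n : ℕ, {q | ∀ t ∈ Icc (1 / ((n : ℝ) + 1)) (1 - 1 / ((n : ℝ) + 1)),
        q.1 + t • (q.2 - q.1) ∈ A} := by
    ext q
    simp only [mem_ofPred_eq, openSegment_subset_iff, mem_iInter]
    refine ⟨fun h n t ht => h t ⟨lt_of_lt_of_le (by positivity) ht.1,
      lt_of_le_of_lt ht.2 (sub_lt_self _ (by positivity))⟩, fun h t ht => ?_⟩
    obtain ⟨n, hn⟩ := exists_nat_one_div_lt (lt_min ht.1 (sub_pos.2 ht.2))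
    exact h n t ⟨(hn.trans_le (min_le_left _ _)).le,
      by linarith [hn.trans_le (min_le_right t (1 - t))]⟩
  rw [h1]
  exact MeasurableSet.iInter fun n =>
    (isOpen_setOf_segment_subset hA _ isCompact_Icc).measurableSet

lemma measurable_visibility {A : Set E3} (hA : IsOpen A) :
    Measurable fun q : E3 × E3 => visibility A q.1 q.2 := by
  unfold visibility
  exact Measurable.ite (measurableSet_visible hA) measurable_const measurable_const

/-! ### Faces -/

/-- The part of the plane `p` in which `p.1` is the outer normal of `A`. -/
def face (A : Set E3) (p : E3 × ℝ) : Set E3 := {y | y ∈ plane p ∧ IsOuterNormal A y p.1}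

lemma IsOuterNormal.mem_frontier {A : Set E3} {x v : E3} (h : IsOuterNormal A x v) :
    x ∈ frontier A := by
  obtain ⟨hv, r, hr, h0⟩ := id h
  refine ⟨?_, fun hx => ?_⟩
  · refine Metric.mem_closure_iff.2 fun ε hε => ?_
    have hm : 0 < min ε r := lt_min hε hr
    have h2 : ‖(min ε r / 2) • v‖ = min ε r / 2 := by
      rw [norm_smul, hv, mul_one, Real.norm_of_nonneg (by positivity)]
    refine ⟨x - (min ε r / 2) • v, (h0 _ ?_).2 ?_, ?_⟩
    · rw [mem_ball_iff_norm, sub_sub_cancel_left, norm_neg, h2]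
      linarith [min_le_right ε r]
    · rw [sub_sub_cancel_left, inner_neg_left, inner_smul_left, real_inner_self_eq_norm_sq, hv]
      simpa using hm
    · rw [dist_eq_norm, sub_sub_cancel, h2]
      linarith [min_le_left ε r]
  · have := (h0 x (Metric.mem_ball_self hr)).1 (interior_subset hx)
    simp at this

lemma IsOuterNormal.of_mem_ball {A : Set E3} {x v : E3} (h : IsOuterNormal A x v) :
    ∃ r > 0, ∀ y ∈ Metric.ball x r, inner ℝ (y - x) v = 0 → IsOuterNormal A y v := by
  obtain ⟨hv, r, hr, h⟩ := h
  refine ⟨r / 2, by positivity, fun y hy hyv => ⟨hv, r / 2, by positivity, fun z hz => ?_⟩⟩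
  rw [h z, ← sub_add_sub_cancel z y x, inner_add_left, hyv, add_zero]
  rw [Metric.mem_ball] at *
  linarith [dist_triangle z y x]

/-- A face is relatively open in its plane: the outer normal persists at nearby points of the plane.
-/
lemma measurableSet_face (A : Set E3) (p : E3 × ℝ) : MeasurableSet (face A p) := by
  choose r hr h using fun y : face A p => y.2.2.of_mem_ball
  have h1 : face A p = plane p ∩ ⋃ y : face A p, Metric.ball (y : E3) (r y) := by
    ext z
    constructor
    · exact fun hz => ⟨hz.1, mem_iUnion.2 ⟨⟨z, hz⟩, Metric.mem_ball_self (hr _)⟩⟩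
    · rintro ⟨hz, hz'⟩
      obtain ⟨y, hy⟩ := mem_iUnion.1 hz'
      refine ⟨hz, h y z hy ?_⟩
      have hyp : inner ℝ (y : E3) p.1 = p.2 := y.2.1
      have hzp : inner ℝ z p.1 = p.2 := hz
      rw [inner_sub_left, hyp, hzp, sub_self]
  rw [h1]
  exact (isClosed_plane p).measurableSet.inter
    (isOpen_iUnion fun y => Metric.isOpen_ball).measurableSet

lemma face_disjoint {A : Set E3} {p q : E3 × ℝ} (hpq : p ≠ q) : Disjoint (face A p) (face A q) := by
  refine disjoint_left.2 fun y hp hq => hpq ?_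
  have h1 : p.1 = q.1 := hp.2.unique hq.2
  have h2 : inner ℝ y p.1 = p.2 := hp.1
  have h3 : inner ℝ y q.1 = q.2 := hq.1
  exact Prod.ext h1 (by rw [← h2, ← h3, h1])

lemma IsOuterNormal.innerNormal_eq {A : Set E3} {x v : E3} (h : IsOuterNormal A x v) :
    innerNormal A x = -v := by
  have hex : ∃ v, IsOuterNormal A x v := ⟨v, h⟩
  rw [innerNormal, dif_pos hex, hex.choose_spec.unique h]

lemma IsAdapted.frontier_diff_faces {F : Set (E3 × ℝ)} (hF : IsPlaneFamily F) {A : Set E3}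
    (hA : IsAdapted F A) : frontier A \ ⋃ p ∈ F, face A p ⊆ exceptional F := by
  rintro y ⟨hy, hy'⟩
  by_contra hex
  obtain ⟨p, hp, hyp, hn⟩ := hA.exists_normal hF hy hex
  exact hy' (mem_iUnion₂.2 ⟨p, hp, hyp, hn⟩)

lemma IsAdapted.frontier_ae_eq_faces {F : Set (E3 × ℝ)} (hF : IsPlaneFamily F) {A : Set E3}
    (hA : IsAdapted F A) : frontier A =ᵐ[area] (⋃ p ∈ F, face A p : Set E3) := by
  refine Filter.EventuallyLE.antisymm ?_ ?_
  · exact ae_le_set.2 (measure_mono_null (hA.frontier_diff_faces hF) (area_exceptional hF))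
  · exact (iUnion₂_subset fun p _ y hy => hy.2.mem_frontier : _ ⊆ frontier A).eventuallyLE

/-- Up to a null set the frontier is a finite union of faces, and the normal is constant on each of
them. -/
lemma IsAdapted.aemeasurable_innerNormal {F : Set (E3 × ℝ)} (hF : IsPlaneFamily F) {A : Set E3}
    (hA : IsAdapted F A) : AEMeasurable (innerNormal A) (area.restrict (frontier A)) := by
  rw [Measure.restrict_congr_set (hA.frontier_ae_eq_faces hF),
    biUnion_eq_iUnion]
  have := hF.finite.countable.to_subtype
  refine AEMeasurable.iUnion fun p => ?_
  refine (aemeasurable_const (b := -p.1.1)).congr ?_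
  filter_upwards [ae_restrict_mem (measurableSet_face A p.1)] with y hy
  exact hy.2.innerNormal_eq.symm

/-! ### The view factors of an enclosure sum up to one -/

/-- The part of a face that is seen from `x`. -/
def seenFace (A : Set E3) (x : E3) (p : E3 × ℝ) : Set E3 :=
  {y | y ∈ face A p ∧ openSegment ℝ x y ⊆ A}

lemma measurableSet_seenFace {A : Set E3} (hA : IsOpen A) (x : E3) (p : E3 × ℝ) :
    MeasurableSet (seenFace A x p) :=
  (measurableSet_face A p).inter
    ((by fun_prop : Measurable fun y : E3 => (x, y)) (measurableSet_visible hA))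

/-- Points of the segment close to `x` are in `A`, hence strictly on the inner side; this fixes the
sign for the whole direction. -/
lemma IsOuterNormal.inner_sub_neg {A : Set E3} {x y v : E3} (h : IsOuterNormal A x v)
    (hxy : openSegment ℝ x y ⊆ A) : inner ℝ (y - x) v < 0 := by
  obtain ⟨ε, hε, h⟩ := h.eventually (y - x)
  have hm : 0 < min ε 1 := lt_min hε one_pos
  refine (h (min ε 1 / 2) (by positivity) (by linarith [min_le_left ε 1])).1 ?_
  exact openSegment_subset_iff.1 hxy _ ⟨by positivity, by linarith [min_le_right ε 1]⟩

lemma seenFace_offset_pos {A : Set E3} {x y : E3} {p : E3 × ℝ} (hy : y ∈ seenFace A x p) :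
    0 < p.2 - inner ℝ x p.1 := by
  have h1 := hy.1.2.inner_sub_neg (y := x) (by rw [openSegment_symm]; exact hy.2)
  have h2 : inner ℝ y p.1 = p.2 := hy.1.1
  rw [inner_sub_left, h2] at h1
  linarith

lemma ne_of_mem_seenFace {A : Set E3} {x y : E3} {p : E3 × ℝ} (hy : y ∈ seenFace A x p) :
    0 < ‖y - x‖ := by
  refine norm_pos_iff.2 fun h => ?_
  have h1 := seenFace_offset_pos hy
  have h2 : inner ℝ y p.1 = p.2 := hy.1.1
  rw [sub_eq_zero.1 h] at h2
  rw [h2, sub_self] at h1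
  exact lt_irrefl _ h1

lemma viewFactor_of_mem_seenFace {A : Set E3} {x y v : E3} (hx : IsOuterNormal A x v)
    {p : E3 × ℝ} (hy : y ∈ seenFace A x p) :
    viewFactor A x y = (2 / Real.pi) *
      ((p.2 - inner ℝ x p.1) * inner ℝ (y - x) (-v) / (2 * ‖y - x‖ ^ 4)) := by
  have h2 : inner ℝ y p.1 = p.2 := hy.1.1
  have h3 := ne_of_mem_seenFace hy
  have h4 := Real.pi_pos
  rw [viewFactor, hx.innerNormal_eq, hy.1.2.innerNormal_eq, real_inner_self_eq_norm_sq,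
    real_inner_comm (y - x) (-v)]
  have h5 : inner ℝ (-p.1) (x - y) = p.2 - inner ℝ x p.1 := by
    rw [inner_neg_left, real_inner_comm, inner_sub_left, h2]
    ring
  rw [h5]
  field_simp

lemma visibility_mul_viewFactor_nonneg {A : Set E3} {x y v w : E3} (hx : IsOuterNormal A x v)
    (hy : IsOuterNormal A y w) : 0 ≤ visibility A x y * viewFactor A x y := by
  rw [visibility]
  split_ifs with h
  · rw [one_mul, viewFactor, hx.innerNormal_eq, hy.innerNormal_eq, inner_neg_left, inner_neg_left,
      real_inner_comm, real_inner_comm _ v]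
    have h1 := hx.inner_sub_neg h
    have h2 := hy.inner_sub_neg (y := x) (by rwa [openSegment_symm])
    have h4 := Real.pi_pos
    exact div_nonneg (mul_nonneg (by linarith) (by linarith)) (by positivity)
  · rw [zero_mul]

/-- Along every ray that enters `A` there is a first boundary point. -/
lemma exists_first_hit {A : Set E3} (hA : IsOpen A) (hb : Bornology.IsBounded A) {x v z : E3}
    (hx : IsOuterNormal A x v) (hz : inner ℝ z v < 0) :
    ∃ τ : ℝ, 0 < τ ∧ x + τ • z ∈ frontier A ∧ openSegment ℝ x (x + τ • z) ⊆ A := by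
  obtain ⟨ε, hε, h⟩ := hx.eventually z
  have hz0 : 0 < ‖z‖ := norm_pos_iff.2 (by rintro rfl; simp at hz)
  obtain ⟨R, hR⟩ := hb.subset_closedBall x
  -- The search for an exit time starts at `ε`, since `x` itself is a boundary point while the times
  -- in `(0, ε)` lead into `A`.
  let T : Set ℝ := Ici ε ∩ (fun t : ℝ => x + t • z) ⁻¹' Aᶜ
  have hcont : Continuous fun t : ℝ => x + t • z := by fun_prop
  have hT : IsClosed T := isClosed_Ici.inter (hA.isClosed_compl.preimage hcont)
  have hTne : T.Nonempty := by
    refine ⟨max ε ((|R| + 1) / ‖z‖), mem_Ici.2 (le_max_left _ _), fun hmem => ?_⟩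
    have h1 := hR hmem
    rw [mem_closedBall_iff_norm, add_sub_cancel_left, norm_smul,
      Real.norm_of_nonneg (le_trans hε.le (le_max_left _ _))] at h1
    have h2 : (|R| + 1) / ‖z‖ * ‖z‖ ≤ max ε ((|R| + 1) / ‖z‖) * ‖z‖ := by
      gcongr
      exact le_max_right _ _
    rw [div_mul_cancel₀ _ hz0.ne'] at h2
    linarith [le_abs_self R]
  have hTb : BddBelow T := ⟨ε, fun t ht => ht.1⟩
  have hmem := hT.csInf_mem hTne hTb
  set τ := sInf T
  have hτ : 0 < τ := hε.trans_le hmem.1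
  have hin : ∀ t, 0 < t → t < τ → x + t • z ∈ A := by
    intro t ht htτ
    by_cases htε : t < ε
    · exact (h t ht htε).2 hz
    · by_contra hcon
      exact notMem_of_lt_csInf htτ hTb ⟨not_lt.1 htε, hcon⟩
  refine ⟨τ, hτ, ?_, ?_⟩
  · rw [hA.frontier_eq]
    refine ⟨?_, hmem.2⟩
    have h1 : τ ∈ closure (Ioo 0 τ) := by
      rw [closure_Ioo hτ.ne]
      exact ⟨hτ.le, le_rfl⟩
    exact hcont.closure_preimage_subset A (closure_mono (fun t ht => hin t ht.1 ht.2) h1)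
  · refine openSegment_subset_iff.2 fun t ht => ?_
    rw [add_sub_cancel_left, smul_smul]
    exact hin _ (mul_pos ht.1 hτ) (by nlinarith [ht.2])

lemma seenCone_seenFace {A : Set E3} {x z : E3} {p : E3 × ℝ}
    (hz : z ∈ seenCone x p (seenFace A x p)) :
    ∃ τ : ℝ, 0 < τ ∧ x + τ • z ∈ seenFace A x p :=
  ⟨_, div_pos (seenFace_offset_pos hz.2) hz.1, hz.2⟩

lemma mem_seenCone {A : Set E3} {x z : E3} {p : E3 × ℝ} {τ : ℝ} (hτ : 0 < τ)
    (hz : x + τ • z ∈ seenFace A x p) : z ∈ seenCone x p (seenFace A x p) := by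
  have h1 := seenFace_offset_pos hz
  have h2 : inner ℝ (x + τ • z) p.1 = p.2 := hz.1.1
  rw [inner_add_left, inner_smul_left, conj_trivial] at h2
  have h3 : p.2 - inner ℝ x p.1 = τ * inner ℝ z p.1 := by linarith
  rw [h3] at h1
  have h4 : 0 < inner ℝ z p.1 := pos_of_mul_pos_right h1 hτ.le
  refine ⟨h4, ?_⟩
  rwa [h3, mul_div_assoc, div_self h4.ne', mul_one]

/-- A seen point is the first boundary point on its ray, so a ray has at most one, and that point
lies on one face only. -/
lemma seenCone_disjoint {A : Set E3} (hA : IsOpen A) {x : E3} {p q : E3 × ℝ} (hpq : p ≠ q) :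
    Disjoint (seenCone x p (seenFace A x p)) (seenCone x q (seenFace A x q)) := by
  refine disjoint_left.2 fun z hp hq => ?_
  obtain ⟨τ, hτ, h1⟩ := seenCone_seenFace hp
  obtain ⟨ρ, hρ, h2⟩ := seenCone_seenFace hq
  have key : ∀ {p q : E3 × ℝ} {τ ρ : ℝ}, 0 < τ → 0 < ρ → x + τ • z ∈ seenFace A x p →
      x + ρ • z ∈ seenFace A x q → ¬ τ < ρ := by
    intro p q τ ρ hτ hρ h1 h2 hlt
    have h3 : x + τ • z ∈ A := by
      have := openSegment_subset_iff.1 h2.2 (τ / ρ) ⟨by positivity, (div_lt_one hρ).2 hlt⟩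
      rwa [add_sub_cancel_left, smul_smul, div_mul_cancel₀ _ hρ.ne'] at this
    have := hA.inter_frontier_eq
    exact (this ▸ (⟨h3, h1.1.2.mem_frontier⟩ : x + τ • z ∈ A ∩ frontier A) :
      x + τ • z ∈ (∅ : Set E3))
  have heq : τ = ρ := le_antisymm (not_lt.1 (key hρ hτ h2 h1)) (not_lt.1 (key hτ hρ h1 h2))
  subst heq
  exact disjoint_left.1 (face_disjoint hpq) h1.1 h2.1

/-- If the ray `x + τ z` meets both planes at the same time, then `z` is orthogonal to `d' m - d
m'`, where `d`, `d'` are the offsets relative to `x`. If this vector vanishes and `d ≠ 0`, the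
planes agree up to orientation; if `d = 0`, then `z` is orthogonal to `m`. -/
lemma volume_rays_exceptional {F : Set (E3 × ℝ)} (hF : IsPlaneFamily F) (x : E3) :
    volume {z : E3 | ∃ τ : ℝ, 0 < τ ∧ x + τ • z ∈ exceptional F} = 0 := by
  have h1 : {z : E3 | ∃ τ : ℝ, 0 < τ ∧ x + τ • z ∈ exceptional F} ⊆ ⋃ p ∈ F, ⋃ q ∈ F,
      {z | q ≠ p ∧ q ≠ -p ∧ ∃ τ : ℝ, 0 < τ ∧ x + τ • z ∈ plane p ∧ x + τ • z ∈ plane q} := by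
    rintro z ⟨τ, hτ, hz⟩
    simp only [exceptional, mem_iUnion] at hz
    obtain ⟨p, hp, q, hq, h1, h2, h3, h4⟩ := hz
    simp only [mem_iUnion]
    exact ⟨p, hp, q, hq, h1, h2, τ, hτ, h3, h4⟩
  refine measure_mono_null h1 ?_
  refine (measure_biUnion_null_iff hF.finite.countable).2 fun p hp =>
    (measure_biUnion_null_iff hF.finite.countable).2 fun q hq => ?_
  by_cases h : q ≠ p ∧ q ≠ -p
  swap
  · refine measure_mono_null (fun z hz => ?_) measure_empty
    exact h ⟨hz.1, hz.2.1⟩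
  have hpn := hF.norm p hp
  have hqn := hF.norm q hq
  obtain ⟨m, c⟩ := p
  obtain ⟨m', c'⟩ := q
  dsimp only at hpn hqn
  set d := c - inner ℝ x m with hd
  set d' := c' - inner ℝ x m' with hd'
  have hmem : ∀ z ∈ {z | (m', c') ≠ (m, c) ∧ (m', c') ≠ -(m, c) ∧
      ∃ τ : ℝ, 0 < τ ∧ x + τ • z ∈ plane (m, c) ∧ x + τ • z ∈ plane (m', c')},
      ∃ τ : ℝ, 0 < τ ∧ τ * inner ℝ z m = d ∧ τ * inner ℝ z m' = d' := by
    rintro z ⟨-, -, τ, hτ, h1, h2⟩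
    have h1 : inner ℝ (x + τ • z) m = c := h1
    have h2 : inner ℝ (x + τ • z) m' = c' := h2
    rw [inner_add_left, inner_smul_left, conj_trivial] at h1 h2
    exact ⟨τ, hτ, by linarith, by linarith⟩
  by_cases hv : d' • m - d • m' = 0
  · have hm0 : m ≠ 0 := by rintro rfl; simp at hpn
    by_cases hd0 : d = 0
    · refine measure_mono_null (fun z hz => ?_) (volume_inner_eq_zero hm0)
      obtain ⟨τ, hτ, h1, -⟩ := hmem z hz
      rw [hd0] at h1
      exact (mul_eq_zero.1 h1).resolve_left hτ.ne'
    · exfalso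
      have h2 : m' = (d' / d) • m := by
        rw [div_eq_inv_mul, mul_smul, sub_eq_zero.1 hv, smul_smul, inv_mul_cancel₀ hd0, one_smul]
      have h3 : |d' / d| = 1 := by
        have := congrArg norm h2
        rwa [norm_smul, hpn, hqn, mul_one, Real.norm_eq_abs, eq_comm] at this
      have h4 : c' = (d' / d) * c := by
        have e1 : inner ℝ x m' = (d' / d) * inner ℝ x m := by rw [h2, inner_smul_right]
        have e2 : (d' / d) * (c - inner ℝ x m) = c' - inner ℝ x m' := div_mul_cancel₀ d' hd0
        rw [e1] at e2
        linarith
      rcases eq_or_eq_neg_of_abs_eq h3 with h5 | h5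
      · exact h.1 (by rw [h2, h4, h5]; simp)
      · exact h.2 (by rw [h2, h4, h5]; simp)
  · refine measure_mono_null (fun z hz => ?_) (volume_inner_eq_zero hv)
    obtain ⟨τ, hτ, h1, h2⟩ := hmem z hz
    rw [mem_ofPred_eq, inner_sub_right, inner_smul_right, inner_smul_right, ← h1, ← h2]
    ring

/-- Every inward ray has a first boundary point, and for almost every ray this point is not
exceptional, hence lies on a face. -/
lemma seenCones_ae_eq {F : Set (E3 × ℝ)} (hF : IsPlaneFamily F) {A : Set E3} (hA : IsAdapted F A)
    (hb : Bornology.IsBounded A) {x v : E3} (hx : IsOuterNormal A x v) :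
    (⋃ p ∈ F, seenCone x p (seenFace A x p) : Set E3) =ᵐ[volume] {z : E3 | 0 < inner ℝ z (-v)} := by
  refine Filter.EventuallyLE.antisymm (LE.le.eventuallyLE ?_) ?_
  · refine iUnion₂_subset fun p _ z hz => ?_
    obtain ⟨τ, hτ, h1⟩ := seenCone_seenFace hz
    have h2 := hx.inner_sub_neg h1.2
    rw [add_sub_cancel_left, inner_smul_left, conj_trivial] at h2
    rw [mem_ofPred_eq, inner_neg_right, Left.neg_pos_iff]
    exact neg_of_mul_neg_right h2 hτ.le
  · refine ae_le_set.2 (measure_mono_null ?_ (volume_rays_exceptional hF x))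
    rintro z ⟨hz, hz'⟩
    rw [mem_ofPred_eq, inner_neg_right, Left.neg_pos_iff] at hz
    obtain ⟨τ, hτ, h1, h2⟩ := exists_first_hit hA.isOpen hb hx hz
    refine ⟨τ, hτ, ?_⟩
    by_contra hex
    obtain ⟨p, hp, hyp, hn⟩ := hA.exists_normal hF h1 hex
    exact hz' (mem_iUnion₂.2 ⟨p, hp, mem_seenCone hτ ⟨⟨hyp, hn⟩, h2⟩⟩)

/-- The view factors from a regular boundary point of an enclosure sum up to one. -/
theorem lintegral_viewFactor {F : Set (E3 × ℝ)} (hF : IsPlaneFamily F) {A : Set E3}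
    (hA : IsAdapted F A) (hb : Bornology.IsBounded A) {x v : E3} (hx : IsOuterNormal A x v) :
    ∫⁻ y in frontier A, ENNReal.ofReal (visibility A x y * viewFactor A x y) ∂area = 1 := by
  -- On the visible part of a face the view factor is `2 / π` times the density of the cone weight;
  -- invisible points contribute nothing.
  have hface : ∀ p ∈ F, ∫⁻ y in face A p,
      ENNReal.ofReal (visibility A x y * viewFactor A x y) ∂area =
      ENNReal.ofReal (2 / Real.pi) * ∫⁻ z in seenCone x p (seenFace A x p), coneWeight (-v) z := by
    intro p hp
    have hseen := measurableSet_seenFace hA.isOpen x p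
    have h1 : ∫⁻ y in face A p, ENNReal.ofReal (visibility A x y * viewFactor A x y) ∂area =
        ∫⁻ y in seenFace A x p, ENNReal.ofReal (visibility A x y * viewFactor A x y) ∂area := by
      rw [← lintegral_indicator (measurableSet_face A p), ← lintegral_indicator hseen]
      refine lintegral_congr fun y => ?_
      by_cases hy : y ∈ seenFace A x p
      · rw [indicator_of_mem hy, indicator_of_mem hy.1]
      · rw [indicator_of_notMem hy]
        by_cases hy' : y ∈ face A p
        · rw [indicator_of_mem hy', visibility, if_neg fun h => hy ⟨hy', h⟩]
          simp
        · rw [indicator_of_notMem hy']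
    rw [h1]
    rcases (seenFace A x p).eq_empty_or_nonempty with he | ⟨y₀, hy₀⟩
    · have : seenCone x p (seenFace A x p) = ∅ := by
        rw [he]
        exact eq_empty_of_forall_notMem fun z hz => hz.2
      rw [this, he]
      simp
    · have hν : ∀ y ∈ seenFace A x p, 0 ≤ inner ℝ (y - x) (-v) := fun y hy => by
        rw [inner_neg_right]
        linarith [hx.inner_sub_neg hy.2]
      rw [setLIntegral_seenCone_coneWeight (hF.norm p hp) (seenFace_offset_pos hy₀) hseen
        (fun y hy => hy.1.1) hν, ← lintegral_const_mul _ (by fun_prop)]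
      refine setLIntegral_congr_fun hseen fun y hy => ?_
      have hpi := Real.pi_pos
      rw [visibility, if_pos hy.2, one_mul, viewFactor_of_mem_seenFace hx hy,
        ENNReal.ofReal_mul (by positivity)]
  have hnv : ‖-v‖ = 1 := by rw [norm_neg, hx.1]
  have hfin := hF.finite
  rw [setLIntegral_congr (hA.frontier_ae_eq_faces hF)]
  lift F to Finset (E3 × ℝ) using hfin
  simp only [Finset.mem_coe] at *
  rw [lintegral_biUnion_finset (fun p _ q _ hpq => face_disjoint hpq)
    (fun p _ => measurableSet_face A p), Finset.sum_congr rfl hface, ← Finset.mul_sum,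
    ← lintegral_biUnion_finset (fun p _ q _ hpq => seenCone_disjoint hA.isOpen hpq)
      (fun p _ => measurableSet_seenCone x p (measurableSet_seenFace hA.isOpen x p))]
  have hcone := seenCones_ae_eq hF hA hb hx
  simp only [Finset.mem_coe] at hcone
  rw [setLIntegral_congr hcone, setLIntegral_coneWeight hnv,
    ← ENNReal.ofReal_mul (by have := Real.pi_pos; positivity)]
  have := Real.pi_pos.ne'
  rw [show 2 / Real.pi * (Real.pi / 2) = 1 by field_simp, ENNReal.ofReal_one]

/-! ### View factor coefficients -/

lemma IsAdapted.ae_isOuterNormal {F : Set (E3 × ℝ)} (hF : IsPlaneFamily F) {A : Set E3}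
    (hA : IsAdapted F A) {ζ : Set E3} (hζ : ζ ⊆ frontier A) :
    ∀ᵐ x ∂(area.restrict ζ), ∃ v, IsOuterNormal A x v := by
  have h1 : ∀ᵐ x ∂(area.restrict (frontier A)), ∃ v, IsOuterNormal A x v := by
    rw [Measure.restrict_congr_set (hA.frontier_ae_eq_faces hF)]
    have : ∀ᵐ x ∂(area.restrict (⋃ p ∈ F, face A p)), x ∈ ⋃ p ∈ F, face A p :=
      ae_restrict_mem (MeasurableSet.biUnion hF.finite.countable fun p _ => measurableSet_face A p)
    filter_upwards [this] with x hx
    obtain ⟨p, -, hp⟩ := mem_iUnion₂.1 hx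
    exact ⟨_, hp.2⟩
  exact ae_restrict_of_ae_restrict_of_subset hζ h1

lemma IsAdapted.aemeasurable_kernel {F : Set (E3 × ℝ)} (hF : IsPlaneFamily F) {A : Set E3}
    (hA : IsAdapted F A) {ζ ζ' : Set E3} (hζ : ζ ⊆ frontier A) (hζ' : ζ' ⊆ frontier A)
    [SFinite (area.restrict ζ)] [SFinite (area.restrict ζ')] :
    AEMeasurable (fun q : E3 × E3 => visibility A q.1 q.2 * viewFactor A q.1 q.2)
      ((area.restrict ζ).prod (area.restrict ζ')) := by
  have hn := hA.aemeasurable_innerNormal hF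
  have h1 : AEMeasurable (fun q : E3 × E3 => innerNormal A q.1)
      ((area.restrict ζ).prod (area.restrict ζ')) :=
    (hn.mono_measure (Measure.restrict_mono_set _ hζ)).comp_quasiMeasurePreserving
      Measure.quasiMeasurePreserving_fst
  have h2 : AEMeasurable (fun q : E3 × E3 => innerNormal A q.2)
      ((area.restrict ζ).prod (area.restrict ζ')) :=
    (hn.mono_measure (Measure.restrict_mono_set _ hζ')).comp_quasiMeasurePreserving
      Measure.quasiMeasurePreserving_snd
  refine (measurable_visibility hA.isOpen).aemeasurable.mul ?_
  unfold viewFactor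
  fun_prop

/-- The kernel is nonnegative almost everywhere, because points that see each other lie on the inner
sides of their tangent planes. So Tonelli's theorem applies. -/
lemma IsAdapted.radCoeff_eq {F : Set (E3 × ℝ)} (hF : IsPlaneFamily F) {A : Set E3}
    (hA : IsAdapted F A) {ζ ζ' : Set E3} (hζ : ζ ⊆ frontier A) (hζ' : ζ' ⊆ frontier A)
    [SFinite (area.restrict ζ)] [SFinite (area.restrict ζ')] :
    0 ≤ radCoeff A ζ ζ' ∧ radCoeff A ζ ζ' = (∫⁻ x in ζ, ∫⁻ y in ζ',
      ENNReal.ofReal (visibility A x y * viewFactor A x y) ∂area ∂area).toReal := by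
  have hmeas := hA.aemeasurable_kernel hF hζ hζ'
  have h0 : 0 ≤ᵐ[(area.restrict ζ).prod (area.restrict ζ')]
      fun q : E3 × E3 => visibility A q.1 q.2 * viewFactor A q.1 q.2 := by
    have h1 := Measure.quasiMeasurePreserving_fst (μ := area.restrict ζ) (ν := area.restrict ζ')
      |>.ae (hA.ae_isOuterNormal hF hζ)
    have h2 := Measure.quasiMeasurePreserving_snd (μ := area.restrict ζ) (ν := area.restrict ζ')
      |>.ae (hA.ae_isOuterNormal hF hζ')
    filter_upwards [h1, h2] with q hq1 hq2
    exact visibility_mul_viewFactor_nonneg hq1.choose_spec hq2.choose_spec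
  have h1 : radCoeff A ζ ζ' = (∫⁻ x in ζ, ∫⁻ y in ζ',
      ENNReal.ofReal (visibility A x y * viewFactor A x y) ∂area ∂area).toReal := by
    rw [radCoeff, integral_eq_lintegral_of_nonneg_ae h0 hmeas.aestronglyMeasurable,
      lintegral_prod _ hmeas.ennreal_ofReal]
  exact ⟨by rw [h1]; exact ENNReal.toReal_nonneg, h1⟩

/-- If the boundary of an enclosure is partitioned, up to null sets, then the view factor
coefficients of a boundary element sum up to its area. -/
theorem IsAdapted.sum_radCoeff {F : Set (E3 × ℝ)} (hF : IsPlaneFamily F) {A : Set E3}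
    (hA : IsAdapted F A) (hb : Bornology.IsBounded A) {J : Type*} [Fintype J] {ζ : J → Set E3}
    (hmeas : ∀ β, MeasurableSet (ζ β)) (hsub : ∀ β, ζ β ⊆ frontier A)
    (hdisj : ∀ β γ, β ≠ γ → area (ζ β ∩ ζ γ) = 0) (hcov : area (frontier A \ ⋃ β, ζ β) = 0)
    {ξ : Set E3} (hξ : ξ ⊆ frontier A) :
    ∑ β, radCoeff A ξ (ζ β) = area.real ξ := by
  have hfb : Bornology.IsBounded (frontier A) := hb.closure.subset frontier_subset_closure
  have hfin : ∀ S ⊆ frontier A, area S < ⊤ := fun S hS =>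
    area_lt_top hF (hfb.subset hS) (hS.trans hA.frontier_subset)
  have hfin' : ∀ S ⊆ frontier A, IsFiniteMeasure (area.restrict S) := fun S hS =>
    ⟨by rw [Measure.restrict_apply_univ]; exact hfin S hS⟩
  have i1 := hfin' ξ hξ
  have i2 := fun β => hfin' (ζ β) (hsub β)
  have hcov' : frontier A =ᵐ[area] (⋃ β, ζ β : Set E3) :=
    Filter.EventuallyLE.antisymm (ae_le_set.2 hcov)
      (iUnion_subset hsub : _ ⊆ frontier A).eventuallyLE
  -- This is `lintegral_viewFactor`, split along the partition and integrated over `ξ`.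
  have hone : ∫⁻ x in ξ, ∑ β, ∫⁻ y in ζ β,
      ENNReal.ofReal (visibility A x y * viewFactor A x y) ∂area ∂area = area ξ := by
    rw [← setLIntegral_one ξ]
    refine lintegral_congr_ae ?_
    filter_upwards [hA.ae_isOuterNormal hF hξ] with x hx
    rw [← lintegral_viewFactor hF hA hb hx.choose_spec, setLIntegral_congr hcov',
      ← tsum_fintype (L := SummationFilter.unconditional J)]
    rw [lintegral_iUnion₀ (fun β => (hmeas β).nullMeasurableSet) (fun β γ h => hdisj β γ h)]
  have hinner : ∀ β, AEMeasurable (fun x => ∫⁻ y in ζ β,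
      ENNReal.ofReal (visibility A x y * viewFactor A x y) ∂area) (area.restrict ξ) := fun β =>
    (hA.aemeasurable_kernel hF hξ (hsub β)).ennreal_ofReal.lintegral_prod_right'
  rw [lintegral_finsetSum' _ fun β _ => hinner β] at hone
  rw [Finset.sum_congr rfl fun β _ => (hA.radCoeff_eq hF hξ (hsub β)).2, ← ENNReal.toReal_sum,
    hone, measureReal_def]
  -- Finiteness of each summand, needed for `ENNReal.toReal_sum`: the sum itself is the finite area
  -- of `ξ`.
  intro β _
  refine ne_top_of_le_ne_top (hfin ξ hξ).ne ?_
  rw [← hone]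
  exact Finset.single_le_sum (f := fun β => ∫⁻ x in ξ, ∫⁻ y in ζ β,
    ENNReal.ofReal (visibility A x y * viewFactor A x y) ∂area ∂area)
    (fun _ _ => zero_le) (Finset.mem_univ β)

/-! ### Volume and area of special sets -/

lemma volume_planeUnion {F : Set (E3 × ℝ)} (hF : IsPlaneFamily F) : volume (planeUnion F) = 0 := by
  refine (measure_biUnion_null_iff hF.finite.countable).2 fun p hp => ?_
  have hn := hF.norm p hp
  have h := volume_linear_fiber (f := innerₗ E3 p.1) (fun h => ?_) p.2
  · simpa [plane, real_inner_comm] using h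
  · have := LinearMap.congr_fun h p.1
    simp only [innerₗ_apply_apply, real_inner_self_eq_norm_sq, hn] at this
    norm_num at this

/-- Hausdorff measure does not grow under `1`-Lipschitz maps, and both sides carry the same
normalising factor. -/
lemma area_image_le {π : E3 → E2} (hπ : LipschitzWith 1 π) (S : Set E3) :
    volume (π '' S) ≤ area S := by
  rw [← EuclideanSpace.euclideanHausdorffMeasure_eq_volume, area,
    Measure.euclideanHausdorffMeasure_def, Measure.euclideanHausdorffMeasure_def,
    Measure.smul_apply, Measure.smul_apply]
  have := hπ.hausdorffMeasure_image_le (d := 2) (by norm_num) S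
  simp only [ENNReal.coe_one, ENNReal.one_rpow, one_mul] at this
  exact smul_le_smul_of_nonneg_left (by exact_mod_cast this) zero_le

/-- A set that meets all parallel lines near a given line has positive area. -/
lemma area_pos_of_lines {m : E3} (hm : ‖m‖ = 1) {a : E3} {r : ℝ} (hr : 0 < r) {S : Set E3}
    (h : ∀ w : E3, inner ℝ w m = 0 → ‖w‖ < r → ∃ s : ℝ, a + w + s • m ∈ S) : 0 < area S := by
  obtain ⟨ψ, hψ⟩ := exists_isPlaneChart hm
  -- The adjoint of the chart is the orthogonal projection along `m`; the image of `S` contains a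
  -- disc around `π a`.
  let π : E3 →L[ℝ] E2 := ContinuousLinearMap.adjoint ψ.toContinuousLinearMap
  have hπψ : ∀ w, π (ψ w) = w := fun w => by
    refine ext_inner_right ℝ fun z => ?_
    rw [ContinuousLinearMap.adjoint_inner_left]
    exact ψ.inner_map_map w z
  have hπm : π m = 0 := by
    refine ext_inner_right ℝ fun z => ?_
    rw [ContinuousLinearMap.adjoint_inner_left, inner_zero_left, real_inner_comm]
    exact hψ.orth z
  have hnorm : ‖π‖ ≤ 1 := by
    rw [LinearIsometryEquiv.norm_map]
    exact ψ.norm_toContinuousLinearMap_le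
  have hlip : LipschitzWith 1 π := π.lipschitz.weaken (by exact_mod_cast hnorm)
  refine lt_of_lt_of_le ?_ (area_image_le hlip S)
  refine (Metric.measure_ball_pos volume (π a) hr).trans_le (measure_mono fun w hw => ?_)
  rw [mem_ball_iff_norm] at hw
  obtain ⟨s, hs⟩ := h (ψ (w - π a)) (hψ.orth _) (by rwa [ψ.norm_map])
  exact ⟨_, hs, by rw [map_add, map_add, map_smul, hπψ, hπm, smul_zero]; abel⟩

/-- The surface that separates two disjoint open sets in a convex open set has positive area. -/
lemma area_separating_pos {W A B : Set E3} (hW : Convex ℝ W) (hWo : IsOpen W) (hA : IsOpen A)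
    (hB : IsOpen B) (hAB : Disjoint A B) (hcov : W ⊆ closure A ∪ closure B)
    (hWA : (W ∩ A).Nonempty) (hWB : (W ∩ B).Nonempty) :
    0 < area (W ∩ (closure A ∩ closure B)) := by
  obtain ⟨a, ha⟩ := hWA
  obtain ⟨b, hb⟩ := hWB
  have hab : 0 < ‖b - a‖ := by
    refine norm_pos_iff.2 fun h => ?_
    rw [sub_eq_zero.1 h] at hb
    exact disjoint_left.1 hAB ha.2 hb.2
  obtain ⟨r₁, hr₁, h₁⟩ := Metric.isOpen_iff.1 (hWo.inter hA) a ha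
  obtain ⟨r₂, hr₂, h₂⟩ := Metric.isOpen_iff.1 (hWo.inter hB) b hb
  refine area_pos_of_lines (m := ‖b - a‖⁻¹ • (b - a)) (a := a) (r := min r₁ r₂)
    (by simpa using norm_smul_inv_norm (𝕜 := ℝ) (norm_pos_iff.1 hab)) (lt_min hr₁ hr₂)
    fun w _ hw => ?_
  have ha' : a + w ∈ W ∩ A := h₁ (by simpa using hw.trans_le (min_le_left _ _))
  have hb' : b + w ∈ W ∩ B := h₂ (by simpa using hw.trans_le (min_le_right _ _))
  have hseg : segment ℝ (a + w) (b + w) ⊆ W := hW.segment_subset ha'.1 hb'.1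
  -- Every segment parallel to `b - a` and close to it runs from `A` to `B`. If it avoided the
  -- common boundary, the complements of the two closures would disconnect it.
  have hdis : (segment ℝ (a + w) (b + w) ∩ (closure A ∩ closure B)).Nonempty := by
    by_contra hne
    have hsub : segment ℝ (a + w) (b + w) ⊆ (closure B)ᶜ ∪ (closure A)ᶜ := by
      intro z hz
      by_contra hcon
      rw [mem_union, not_or, mem_compl_iff, mem_compl_iff, not_not, not_not] at hcon
      exact hne ⟨z, hz, hcon.2, hcon.1⟩
    obtain ⟨z, hz, hz1, hz2⟩ := (convex_segment (a + w) (b + w)).isPreconnected _ _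
      isClosed_closure.isOpen_compl isClosed_closure.isOpen_compl hsub
      ⟨a + w, left_mem_segment ℝ _ _, fun h => disjoint_left.1 (hAB.closure_right hA) ha'.2 h⟩
      ⟨b + w, right_mem_segment ℝ _ _, fun h => disjoint_left.1 (hAB.closure_left hB) h hb'.2⟩
    rcases hcov (hseg hz) with h | h
    · exact hz2 h
    · exact hz1 h
  obtain ⟨z, hz, hz'⟩ := hdis
  have hzW := hseg hz
  rw [segment_eq_image'] at hz
  obtain ⟨t, -, rfl⟩ := hz
  refine ⟨t * ‖b - a‖, ?_⟩
  rw [smul_smul, mul_assoc, mul_inv_cancel₀ hab.ne', mul_one]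
  rw [add_sub_add_right_eq_sub] at hzW hz'
  exact ⟨hzW, hz'⟩

/-! ### Boundary elements -/

lemma IsBoundaryElement.measurableSet {Γ ζ : Set E3} (h : IsBoundaryElement Γ ζ)
    (hΓ : IsClosed Γ) : MeasurableSet ζ := by
  obtain ⟨U, hU, rfl⟩ := h.relOpen
  exact hU.measurableSet.inter hΓ.measurableSet

/-- The relative boundary consists of convex pieces. As `ζ` is dense in its closure, such a piece
has no interior within the plane, so it coincides with its own frontier there, and frontiers of
convex sets are null. -/
lemma IsBoundaryElement.area_boundary {Γ ζ : Set E3} (h : IsBoundaryElement Γ ζ) :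
    area (closure ζ \ ζ) = 0 := by
  obtain ⟨Q, hQ, hζQ⟩ := h.planar
  obtain ⟨⟨m, c⟩, hm, hp⟩ := exists_plane_of_affineSubspace_ne_top (s := Q) (by
    rintro rfl
    rw [AffineSubspace.direction_top, finrank_top] at hQ
    simp at hQ)
  dsimp only at hm
  have hcl : closure ζ ⊆ plane (m, c) := closure_minimal (hζQ.trans hp) (isClosed_plane _)
  obtain ⟨𝒱, h𝒱⟩ := h.polyBoundary
  rw [h𝒱]
  refine (measure_biUnion_null_iff 𝒱.countable_toSet).2 fun V hV => ?_
  have hsub : convexHull ℝ (V : Set E3) ⊆ closure ζ \ ζ := by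
    rw [h𝒱]
    exact subset_biUnion_of_mem (u := fun V : Finset E3 => convexHull ℝ (V : Set E3)) hV
  set K := convexHull ℝ (V : Set E3) with hK
  have hKc : IsClosed K := V.finite_toSet.isClosed_convexHull ℝ
  obtain ⟨ψ, hψ⟩ := exists_isPlaneChart hm
  have hb := smul_mem_plane hm c
  rw [← inter_eq_left.2 ((hsub.trans sdiff_subset).trans hcl), ← Measure.restrict_apply
    hKc.measurableSet, ← hψ.map_eq hb, Measure.map_apply (by fun_prop) hKc.measurableSet]
  set φ : E2 → E3 := fun w => c • m + ψ w with hφ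
  have hφc : Continuous φ := by fun_prop
  have hconv : Convex ℝ (φ ⁻¹' K) := by
    have h1 : φ ⁻¹' K = ψ.toLinearMap ⁻¹' ((fun y => c • m + y) ⁻¹' K) := rfl
    rw [h1]
    exact ((convex_convexHull ℝ _).translate_preimage_right _).linear_preimage _
  have hint : interior (φ ⁻¹' K) = ∅ := by
    by_contra hne
    obtain ⟨w₀, hw₀⟩ := nonempty_iff_ne_empty.2 hne
    obtain ⟨r, hr, hball⟩ := Metric.isOpen_iff.1 isOpen_interior w₀ hw₀
    have h1 : φ w₀ ∈ closure ζ := (hsub (show φ w₀ ∈ K from interior_subset (s := φ ⁻¹' K) hw₀)).1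
    obtain ⟨z, hz, hzr⟩ := Metric.mem_closure_iff.1 h1 r hr
    have hzp : inner ℝ z m = c := hcl (subset_closure hz)
    obtain ⟨w, hw⟩ := hψ.surj (z - c • m) (by
      rw [inner_sub_left, hzp, show inner ℝ (c • m) m = c from hb, sub_self])
    have hzw : z = φ w := by rw [hφ]; simp [hw]
    rw [hzw, dist_comm, hφ, dist_add_left, ψ.dist_map] at hzr
    have h2 := interior_subset (hball hzr)
    rw [mem_preimage, ← hzw] at h2
    exact (hsub h2).2 hz
  have hfr : φ ⁻¹' K ⊆ frontier (φ ⁻¹' K) := by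
    rw [(hKc.preimage hφc).frontier_eq, hint, sdiff_empty]
  exact measure_mono_null hfr (hconv.addHaar_frontier volume)

lemma area_diff_iUnion {Γ : Set E3} {J : Type*} [Finite J] {ζ : J → Set E3}
    (h : ∀ α, IsBoundaryElement Γ (ζ α)) (hcov : Γ = ⋃ α, closure (ζ α)) :
    area (Γ \ ⋃ α, ζ α) = 0 := by
  refine measure_mono_null ?_ (measure_iUnion_null fun α => (h α).area_boundary)
  rw [hcov]
  rintro y ⟨hy, hy'⟩
  obtain ⟨α, hα⟩ := mem_iUnion.1 hy
  exact mem_iUnion.2 ⟨α, hα, fun h => hy' (mem_iUnion.2 ⟨α, h⟩)⟩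

/-- Sum of the areas of those elements of a partition that are relevant for a subset `X`. -/
lemma sum_area_eq {Γ X Y : Set E3} {J : Type*} [Fintype J] {ζ : J → Set E3} (hΓ : IsClosed Γ)
    (hfin : area Γ ≠ ⊤) (h : ∀ α, IsBoundaryElement Γ (ζ α))
    (hdisj : Pairwise fun α β => Disjoint (ζ α) (ζ β)) (hcov : Γ = ⋃ α, closure (ζ α))
    (s : Finset J) (hs : ∀ α ∉ s, area (ζ α ∩ Y) = 0) (hXY : X ⊆ Y) (hXΓ : X ⊆ Γ)
    (hsX : ∀ α ∈ s, area (ζ α \ X) = 0) : ∑ α ∈ s, area.real (ζ α) = area.real X := by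
  have hmeas := fun α => (h α).measurableSet hΓ
  rw [← measureReal_biUnion_finset (fun α _ β _ hαβ => hdisj hαβ) (fun α _ => hmeas α)
    fun α _ => ne_top_of_le_ne_top hfin (measure_mono (h α).subset)]
  refine measureReal_congr (Filter.EventuallyLE.antisymm (ae_le_set.2 ?_) (ae_le_set.2 ?_))
  · refine measure_mono_null (t := ⋃ α ∈ s, ζ α \ X) ?_
      ((measure_biUnion_null_iff s.countable_toSet).2 hsX)
    rintro y ⟨hy, hyX⟩
    obtain ⟨α, hα, hy⟩ := mem_iUnion₂.1 hy
    exact mem_iUnion₂.2 ⟨α, hα, hy, hyX⟩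
  -- A point of `X` missed by the selected elements is in no element at all, or in an unselected
  -- one; there it belongs to `ζ α ∩ Y`.
  · refine measure_mono_null (t := (Γ \ ⋃ α, ζ α) ∪ ⋃ α ∈ (sᶜ : Set J), ζ α ∩ Y) ?_
      (measure_union_null (area_diff_iUnion h hcov)
        ((measure_biUnion_null_iff (to_countable _)).2 hs))
    rintro y ⟨hy, hys⟩
    by_cases hyu : y ∈ ⋃ α, ζ α
    · obtain ⟨α, hα⟩ := mem_iUnion.1 hyu
      refine Or.inr (mem_iUnion₂.2 ⟨α, fun h => hys (mem_iUnion₂.2 ⟨α, h, hα⟩), hα, hXY hy⟩)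
    · exact Or.inl ⟨hXΓ hy, hyu⟩

/-! ### The geometry of the model -/

namespace Model

variable {P : Model}

/-- A frontier point outside `closure dom` cannot be interior to the hull, since it would then
belong to the open region. -/
lemma frontier_openRegion_subset : frontier P.openRegion ⊆ P.ΓΩ ∪ P.Γph := by
  intro y hy
  have hopen : IsOpen P.openRegion := isOpen_interior.sdiff isClosed_closure
  have hyO : y ∉ P.openRegion := fun h => by
    have := hopen.inter_frontier_eq
    exact (this ▸ (⟨h, hy⟩ : y ∈ P.openRegion ∩ frontier P.openRegion) : y ∈ (∅ : Set E3))
  by_cases hyd : y ∈ closure P.dom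
  · exact Or.inl ⟨hyd, frontier_subset_closure hy⟩
  · refine Or.inr ⟨?_, hy⟩
    have hyh : y ∈ P.hull := closure_minimal (sdiff_subset.trans interior_subset) isClosed_closure
      (frontier_subset_closure hy)
    exact ⟨subset_closure hyh, fun h => hyO ⟨h, hyd⟩⟩

lemma ΓΩ_subset_frontier_openRegion : P.ΓΩ ⊆ frontier P.openRegion := by
  have hopen : IsOpen P.openRegion := isOpen_interior.sdiff isClosed_closure
  rw [hopen.frontier_eq]
  exact fun y hy => ⟨hy.2, fun h => h.2 hy.1⟩

lemma disjoint_dom_openRegion : Disjoint P.dom P.openRegion :=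
  disjoint_left.2 fun _ hy h => h.2 (subset_closure hy)

lemma isClosed_ΓΩ : IsClosed P.ΓΩ := isClosed_closure.inter isClosed_closure

lemma isClosed_Γph : IsClosed P.Γph := isClosed_frontier.inter isClosed_frontier

namespace Admissible

variable (hP : P.Admissible)
include hP

lemma ΓΩ_subset_frontier_dom : P.ΓΩ ⊆ frontier P.dom := by
  rw [hP.dom_poly.1.frontier_eq]
  exact fun y hy => ⟨hy.1, fun h =>
    disjoint_left.1 (disjoint_dom_openRegion.closure_right hP.dom_poly.1) h hy.2⟩

lemma dom_subset_interior_hull : P.dom ⊆ interior P.hull :=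
  interior_maximal ((subset_convexHull ℝ _).trans subset_closure) hP.dom_poly.1

lemma isBounded_openRegion : Bornology.IsBounded P.openRegion :=
  ((isBounded_convexHull.2 hP.dom_poly.isBounded).closure).subset
    (sdiff_subset.trans interior_subset)

lemma gas_subset_dom : P.sub Phase.gas ⊆ P.dom := by
  have h1 : P.sub Phase.gas ⊆ closure P.dom := by
    rw [hP.closure_eq]
    exact subset_closure.trans subset_union_right
  rw [← hP.dom_poly.2.1]
  exact interior_maximal h1 (hP.sub_poly _).1

/-- Near the outer boundary there is only solid. -/
lemma dom_diff_gas_subset : P.dom ∩ (closure (P.sub Phase.gas))ᶜ ⊆ P.sub Phase.solid := by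
  have h1 : P.dom ∩ (closure (P.sub Phase.gas))ᶜ ⊆ closure (P.sub Phase.solid) := by
    rintro y ⟨hy, hyg⟩
    have := subset_closure hy
    rw [hP.closure_eq] at this
    exact this.resolve_right hyg
  rw [← (hP.sub_poly Phase.solid).2.1]
  exact interior_maximal h1 (hP.dom_poly.1.inter isClosed_closure.isOpen_compl)

lemma frontier_dom_subset : frontier P.dom ⊆ (closure (P.sub Phase.gas))ᶜ := by
  intro y hy hyg
  by_cases h : y ∈ P.sub Phase.gas
  · rw [hP.dom_poly.1.frontier_eq] at hy
    exact hy.2 (hP.gas_subset_dom h)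
  · refine disjoint_left.1 hP.frontier_disjoint hy ?_
    rw [(hP.sub_poly _).1.frontier_eq]
    exact ⟨hyg, h⟩

/-- On the outer boundary, subsets of the domain have the same boundary as their solid parts. -/
lemma frontier_inter_solid {S : Set E3} (hS : S ⊆ P.dom) :
    frontier (S ∩ P.sub Phase.solid) ∩ frontier P.dom = frontier S ∩ frontier P.dom := by
  have hopen : IsOpen (closure (P.sub Phase.gas))ᶜ := isClosed_closure.isOpen_compl
  have h1 : S ∩ P.sub Phase.solid ∩ (closure (P.sub Phase.gas))ᶜ
      = S ∩ (closure (P.sub Phase.gas))ᶜ := by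
    ext y
    exact ⟨fun h => ⟨h.1.1, h.2⟩,
      fun h => ⟨⟨h.1, hP.dom_diff_gas_subset ⟨hS h.1, h.2⟩⟩, h.2⟩⟩
  have h2 := frontier_inter_open_inter (s := S ∩ P.sub Phase.solid) hopen
  rw [h1, frontier_inter_open_inter hopen] at h2
  have h3 := hP.frontier_dom_subset
  ext y
  constructor
  · rintro ⟨hy, hyd⟩
    exact ⟨(h2.ge ⟨hy, h3 hyd⟩).1, hyd⟩
  · rintro ⟨hy, hyd⟩
    exact ⟨(h2.le ⟨hy, h3 hyd⟩).1, hyd⟩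

/-- Near a point of the element, the convex open set `ball ∩ interior hull` is covered by the
closures of the domain and of the open region and meets both. The surface separating them has
positive area and lies in the element by relative openness. -/
lemma area_pos_of_subset_ΓΩ {ζ : Set E3} (h : IsBoundaryElement P.ΓΩ ζ) : 0 < area ζ := by
  obtain ⟨y, hy⟩ := h.connected.nonempty
  obtain ⟨U, hU, rfl⟩ := h.relOpen
  obtain ⟨r, hr, hball⟩ := Metric.isOpen_iff.1 hU y hy.1
  have hopen : IsOpen P.openRegion := isOpen_interior.sdiff isClosed_closure
  have hconv : Convex ℝ (interior P.hull) := (convex_convexHull ℝ _).closure.interior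
  have hyd := hy.2.1
  have hyO := hy.2.2
  refine (area_separating_pos (W := Metric.ball y r ∩ interior P.hull)
    ((convex_ball y r).inter hconv) (Metric.isOpen_ball.inter isOpen_interior) hP.dom_poly.1 hopen
    disjoint_dom_openRegion ?_ ?_ ?_).trans_le (measure_mono ?_)
  · intro z hz
    by_cases hzd : z ∈ closure P.dom
    · exact Or.inl hzd
    · exact Or.inr (subset_closure ⟨hz.2, hzd⟩)
  · obtain ⟨z, hz, hz'⟩ := mem_closure_iff.1 hyd _ Metric.isOpen_ball (Metric.mem_ball_self hr)
    exact ⟨z, ⟨hz, hP.dom_subset_interior_hull hz'⟩, hz'⟩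
  · obtain ⟨z, hz, hz'⟩ := mem_closure_iff.1 hyO _ Metric.isOpen_ball (Metric.mem_ball_self hr)
    exact ⟨z, ⟨hz, hz'.1⟩, hz'⟩
  · exact fun z hz => ⟨hball hz.1.1, hz.2⟩

/-- As for `ΓΩ`, now with the gas and the complement of its closure as the separated sets. -/
lemma area_pos_of_subset_interface {ζ : Set E3} (h : IsBoundaryElement P.interface ζ) :
    0 < area ζ := by
  obtain ⟨y, hy⟩ := h.connected.nonempty
  obtain ⟨U, hU, rfl⟩ := h.relOpen
  obtain ⟨r, hr, hball⟩ := Metric.isOpen_iff.1 hU y hy.1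
  have hg := hP.sub_poly Phase.gas
  have hyg : y ∈ frontier (P.sub Phase.gas) := hy.2
  refine (area_separating_pos (W := Metric.ball y r) (A := P.sub Phase.gas)
    (B := (closure (P.sub Phase.gas))ᶜ) (convex_ball y r) Metric.isOpen_ball hg.1
    isClosed_closure.isOpen_compl
    (disjoint_compl_right.mono_left subset_closure) ?_ ?_ ?_).trans_le (measure_mono ?_)
  · intro z _
    by_cases hz : z ∈ closure (P.sub Phase.gas)
    · exact Or.inl hz
    · exact Or.inr (subset_closure hz)
  · exact mem_closure_iff.1 (frontier_subset_closure hyg) _ Metric.isOpen_ball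
      (Metric.mem_ball_self hr)
  -- Every ball around `y` leaves the closed gas domain: otherwise regularity would make `y` a point
  -- of the open gas domain.
  · by_contra hne
    have h1 : Metric.ball y r ⊆ closure (P.sub Phase.gas) := fun z hz => by
      by_contra hz'
      exact hne ⟨z, hz, hz'⟩
    have h2 := interior_maximal h1 Metric.isOpen_ball (Metric.mem_ball_self hr)
    rw [hg.2.1] at h2
    rw [hg.1.frontier_eq] at hyg
    exact hyg.2 h2
  · rintro z ⟨hz, hz1, hz2⟩
    refine ⟨hball hz, ?_⟩
    rw [closure_compl] at hz2
    exact ⟨hz1, fun h => hz2 (interior_mono subset_closure h)⟩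

end Admissible

end Model

/-! ### Compatibility of boundary elements with control volumes -/

namespace Discretization

set_option linter.unusedSectionVars false

variable {I IΩ IS : Type*} [Fintype I] [Fintype IΩ] [Fintype IS]
  {D : Discretization I IΩ IS} {P : Model}

/-- A family of planes for all domains of a discretized model. -/
structure IsAdaptedFamily (D : Discretization I IΩ IS) (P : Model) (F : Set (E3 × ℝ)) : Prop where
  family : IsPlaneFamily F
  dom : IsAdapted F P.dom
  sub : ∀ m, IsAdapted F (P.sub m)
  vol : ∀ i, IsAdapted F (D.vol i)
  hull : IsAdapted F (interior P.hull)

lemma exists_isAdaptedFamily (hP : P.Admissible) (hD : D.Admissible P) :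
    ∃ F, D.IsAdaptedFamily P F := by
  obtain ⟨F₁, h₁, h₁'⟩ := hP.dom_poly.exists_adapted
  obtain ⟨F₂, h₂, h₂'⟩ := (hP.sub_poly Phase.solid).exists_adapted
  obtain ⟨F₃, h₃, h₃'⟩ := (hP.sub_poly Phase.gas).exists_adapted
  obtain ⟨F₄, h₄, h₄'⟩ := exists_adapted_interior_hull hP.dom_poly
  choose G hG hG' using fun i => (hD.vol_poly i).exists_adapted
  let T : Fin 4 ⊕ I → Set (E3 × ℝ) := Sum.elim ![F₁, F₂, F₃, F₄] G
  have hT : ∀ j, T j ⊆ ⋃ j, T j := subset_iUnion T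
  refine ⟨⋃ j, T j, isPlaneFamily_iUnion ?_, h₁'.mono (hT (Sum.inl 0)), ?_,
    fun i => (hG' i).mono (hT (Sum.inr i)), h₄'.mono (hT (Sum.inl 3))⟩
  · rintro (j | i)
    · fin_cases j <;> assumption
    · exact hG i
  · rintro (_ | _)
    · exact h₂'.mono (hT (Sum.inl 1))
    · exact h₃'.mono (hT (Sum.inl 2))

namespace IsAdaptedFamily

variable {F : Set (E3 × ℝ)} (h : D.IsAdaptedFamily P F)
include h

lemma subVol (m : Phase) (i : I) : IsAdapted F (D.subVol P m i) := (h.vol i).inter (h.sub m)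

lemma openRegion : IsAdapted F P.openRegion := h.hull.diff_closure h.dom

end IsAdaptedFamily

lemma disjoint_subVol (hD : D.Admissible P) (m : Phase) {i j : I} (hij : i ≠ j) :
    Disjoint (D.subVol P m i) (D.subVol P m j) :=
  (hD.vol_disjoint hij).mono inter_subset_left inter_subset_left

lemma disjoint_solid_gas (hP : P.Admissible) (i j : I) :
    Disjoint (D.subVol P Phase.solid i) (D.subVol P Phase.gas j) :=
  hP.sub_disjoint.mono inter_subset_right inter_subset_right

/-- Two control volumes fill both sides at a regular common boundary point, which therefore cannot
be on the boundary of the domain. -/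
lemma area_ζΩ_inter_frontier (hP : P.Admissible) (hD : D.Admissible P) {α : IΩ} {i : I}
    (hi : D.iΩ α ≠ i) : area (D.ζΩ α ∩ frontier (D.vol i)) = 0 := by
  obtain ⟨F, hF⟩ := D.exists_isAdaptedFamily hP hD
  refine measure_mono_null (fun y hy => ?_) (area_exceptional hF.family)
  have h1 := hD.iΩ_mem α hy.1
  exact not_mem_frontier_whole hF.family (hF.vol (D.iΩ α)) (hF.vol i) hF.dom (hD.vol_disjoint hi)
    (hD.vol_subset _) (hD.vol_subset _) h1.1 hy.2 (hP.ΓΩ_subset_frontier_dom h1.2)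

/-- Two solid parts and the gas are three pairwise disjoint sets; they share only exceptional
boundary points. -/
lemma area_ζS_inter_frontier (hP : P.Admissible) (hD : D.Admissible P) {α : IS} {i : I}
    (hi : D.iS α ≠ i) : area (D.ζS α ∩ frontier (D.subVol P Phase.solid i)) = 0 := by
  obtain ⟨F, hF⟩ := D.exists_isAdaptedFamily hP hD
  refine measure_mono_null (fun y hy => ?_) (area_exceptional hF.family)
  have h1 := hD.iS_mem α hy.1
  exact not_mem_three_frontiers hF.family (hF.subVol _ (D.iS α)) (hF.subVol _ i)
    (hF.sub Phase.gas) (disjoint_subVol hD _ hi) (hP.sub_disjoint.mono_left inter_subset_right)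
    (hP.sub_disjoint.mono_left inter_subset_right) h1.1 hy.2 h1.2

lemma mem_JΩ_iff (hP : P.Admissible) (hD : D.Admissible P) (i : I) (α : IΩ) :
    α ∈ D.JΩ i ↔ D.iΩ α = i := by
  rw [JΩ, Finset.mem_filter, and_iff_right (Finset.mem_univ α)]
  refine ⟨fun h => ?_, ?_⟩
  · by_contra hi
    exact h (area_ζΩ_inter_frontier hP hD hi)
  · rintro rfl
    rw [inter_eq_left.2 fun y hy => (hD.iΩ_mem α hy).1]
    exact (hP.area_pos_of_subset_ΓΩ (hD.ζΩ_elem α)).ne'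

lemma mem_JS_iff (hP : P.Admissible) (hD : D.Admissible P) (i : I) (α : IS) :
    α ∈ D.JS P i ↔ D.iS α = i := by
  rw [JS, Finset.mem_filter, and_iff_right (Finset.mem_univ α)]
  refine ⟨fun h => ?_, ?_⟩
  · by_contra hi
    exact h (area_ζS_inter_frontier hP hD hi)
  · rintro rfl
    rw [inter_eq_left.2 fun y hy => (hD.iS_mem α hy).1]
    exact (hP.area_pos_of_subset_interface (hD.ζS_elem α)).ne'

lemma area_openRegion_frontier_lt_top (hP : P.Admissible) (hD : D.Admissible P) {S : Set E3}
    (hS : S ⊆ frontier P.openRegion) : area S < ⊤ := by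
  obtain ⟨F, hF⟩ := D.exists_isAdaptedFamily hP hD
  exact area_lt_top hF.family
    (hP.isBounded_openRegion.closure.subset (hS.trans frontier_subset_closure))
    (hS.trans hF.openRegion.frontier_subset)

lemma area_interface_lt_top (hP : P.Admissible) {S : Set E3}
    (hS : S ⊆ P.interface) : area S < ⊤ := by
  obtain ⟨F, hF, hF'⟩ := (hP.sub_poly Phase.gas).exists_adapted
  exact area_lt_top hF ((hP.sub_poly Phase.gas).isBounded.closure.subset
    (hS.trans frontier_subset_closure)) (hS.trans hF'.frontier_subset)

lemma sum_area_ζΩ (hP : P.Admissible) (hD : D.Admissible P) (i : I) :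
    ∑ α ∈ D.JΩ i, area.real (D.ζΩ α) = D.areaΓΩ P i := by
  -- The gas stays away from the outer boundary, so there a control volume and its solid part have
  -- the same frontier.
  have h1 : frontier (D.subVol P Phase.solid i) ∩ P.ΓΩ = frontier (D.vol i) ∩ P.ΓΩ := by
    have h2 := hP.frontier_inter_solid (hD.vol_subset i)
    rw [← inter_eq_right.2 hP.ΓΩ_subset_frontier_dom, ← inter_assoc, ← inter_assoc, subVol, h2]
  rw [areaΓΩ, h1]
  refine sum_area_eq P.isClosed_ΓΩ (D.area_openRegion_frontier_lt_top hP hD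
    P.ΓΩ_subset_frontier_openRegion).ne hD.ζΩ_elem hD.ζΩ_disjoint hD.ζΩ_cover _
    (fun α hα => area_ζΩ_inter_frontier hP hD fun h => hα ((mem_JΩ_iff hP hD i α).2 h))
    inter_subset_left inter_subset_right fun α hα => ?_
  rw [mem_JΩ_iff hP hD] at hα
  rw [sdiff_eq_empty.2 (hα ▸ hD.iΩ_mem α), measure_empty]

lemma vol_inter_interface_subset (hP : P.Admissible) (hD : D.Admissible P) (i : I) :
    D.vol i ∩ P.interface ⊆ frontier (D.subVol P Phase.solid i) := by
  rintro y ⟨hy, hyS⟩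
  have h1 : y ∈ frontier (P.sub Phase.solid) := hP.frontier_eq ▸ Or.inr hyS
  have h2 := frontier_inter_open_inter (s := P.sub Phase.solid) (hD.vol_poly i).1
  rw [inter_comm (P.sub Phase.solid)] at h2
  exact (h2.ge ⟨h1, hy⟩).1

/-- By `reg_eq`, a regular boundary point of the solid part on the interface also bounds the gas
part of the same control volume. The two parts fill both sides, so the point is not on the frontier
of the control volume. -/
lemma area_solid_frontier_diff (hP : P.Admissible) (hD : D.Admissible P) (i : I) :
    area ((frontier (D.subVol P Phase.solid i) ∩ P.interface) \ (D.vol i ∩ P.interface)) = 0 := by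
  obtain ⟨F, hF⟩ := D.exists_isAdaptedFamily hP hD
  refine measure_mono_null ?_ (area_exceptional hF.family)
  rintro y ⟨⟨hy, hyS⟩, hy'⟩
  by_contra hex
  obtain ⟨p, -, -, hn⟩ := (hF.subVol Phase.solid i).exists_normal hF.family hy hex
  have hreg : y ∈ regBoundary (D.subVol P Phase.solid i) ∩ P.interface := ⟨⟨hy, _, hn⟩, hyS⟩
  rw [hD.reg_eq i] at hreg
  refine hex (not_mem_frontier_whole hF.family (hF.subVol Phase.solid i) (hF.subVol Phase.gas i)
    (hF.vol i) (disjoint_solid_gas hP i i) inter_subset_left inter_subset_left hy hreg.1.1 ?_)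
  rw [(hF.vol i).isOpen.frontier_eq]
  exact ⟨closure_mono inter_subset_left (frontier_subset_closure hy), fun h => hy' ⟨h, hyS⟩⟩

lemma sum_area_ζS (hP : P.Admissible) (hD : D.Admissible P) (i : I) :
    ∑ α ∈ D.JS P i, area.real (D.ζS α) = D.areaS P i := by
  rw [areaS]
  refine sum_area_eq isClosed_frontier (area_interface_lt_top hP subset_rfl).ne
    hD.ζS_elem hD.ζS_disjoint hD.ζS_cover _
    (fun α hα => area_ζS_inter_frontier hP hD fun h => hα ((mem_JS_iff hP hD i α).2 h))
    (vol_inter_interface_subset hP hD i) inter_subset_right fun α hα => ?_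
  rw [mem_JS_iff hP hD] at hα
  exact measure_mono_null (sdiff_subset_sdiff_left (hα ▸ hD.iS_mem α))
    (area_solid_frontier_diff hP hD i)

lemma volume_vol_pos (hD : D.Admissible P) (i : I) : 0 < volume.real (D.vol i) :=
  ENNReal.toReal_pos ((hD.vol_poly i).1.measure_pos volume (hD.vol_connected i).nonempty).ne'
    (hD.vol_poly i).isBounded.measure_lt_top.ne

/-- A point of the cell in neither part lies on the frontier of a phase, hence on one of finitely
many planes. The growth of the total energy needs this inequality only. -/
lemma volume_vol_le (hP : P.Admissible) (hD : D.Admissible P) (i : I) :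
    volume.real (D.vol i) ≤
      volume.real (D.subVol P Phase.solid i) + volume.real (D.subVol P Phase.gas i) := by
  obtain ⟨F, hF⟩ := D.exists_isAdaptedFamily hP hD
  have hb : ∀ S ⊆ D.vol i, volume S ≠ ⊤ := fun S hS =>
    ((hD.vol_poly i).isBounded.subset hS).measure_lt_top.ne
  have h1 : D.vol i ⊆ D.subVol P Phase.solid i ∪ D.subVol P Phase.gas i ∪ planeUnion F := by
    intro y hy
    have hyd := subset_closure (hD.vol_subset i hy)
    rw [hP.closure_eq] at hyd
    have key : ∀ m, y ∈ closure (P.sub m) → y ∈ D.subVol P m i ∨ y ∈ planeUnion F := by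
      intro m hm
      by_cases hym : y ∈ P.sub m
      · exact Or.inl ⟨hy, hym⟩
      · refine Or.inr ((hF.sub m).frontier_subset ?_)
        rw [(hF.sub m).isOpen.frontier_eq]
        exact ⟨hm, hym⟩
    rcases hyd with h | h
    · rcases key _ h with h | h
      · exact Or.inl (Or.inl h)
      · exact Or.inr h
    · rcases key _ h with h | h
      · exact Or.inl (Or.inr h)
      · exact Or.inr h
  have h2 : volume (D.vol i) ≤
      volume (D.subVol P Phase.solid i) + volume (D.subVol P Phase.gas i) := by
    refine (measure_mono h1).trans ((measure_union_le _ _).trans ?_)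
    rw [volume_planeUnion hF.family, add_zero]
    exact measure_union_le _ _
  have hs : ∀ m, volume (D.subVol P m i) ≠ ⊤ := fun m => hb _ inter_subset_left
  rw [measureReal_def, measureReal_def, measureReal_def, ← ENNReal.toReal_add (hs _) (hs _)]
  exact ENNReal.toReal_mono (ENNReal.add_ne_top.2 ⟨hs _, hs _⟩) h2

lemma ζΩ_subset_frontier (hD : D.Admissible P) (α : IΩ) : D.ζΩ α ⊆ frontier P.openRegion :=
  (hD.ζΩ_elem α).subset.trans P.ΓΩ_subset_frontier_openRegion

/-- At such a point the domain and the open region, disjoint subsets of the interior of the hull,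
would both touch the frontier of that interior. -/
lemma area_ΓΩ_inter_Γph (hP : P.Admissible) (hD : D.Admissible P) : area (P.ΓΩ ∩ P.Γph) = 0 := by
  obtain ⟨F, hF⟩ := D.exists_isAdaptedFamily hP hD
  refine measure_mono_null ?_ (area_exceptional hF.family)
  rintro y ⟨hy, hyh, hyO⟩
  refine not_mem_frontier_whole hF.family hF.dom hF.openRegion hF.hull
    P.disjoint_dom_openRegion hP.dom_subset_interior_hull sdiff_subset
    (hP.ΓΩ_subset_frontier_dom hy) hyO ?_
  rw [isOpen_interior.frontier_eq]
  exact ⟨closure_mono sdiff_subset (frontier_subset_closure hyO), hyh.2⟩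

lemma row_ΛΩ (hP : P.Admissible) (hD : D.Admissible P) (α : IΩ) :
    ∑ β, D.ΛΩ P α β + D.Λph P α = area.real (D.ζΩ α) := by
  obtain ⟨F, hF⟩ := D.exists_isAdaptedFamily hP hD
  -- The phantom surface, as index `none`, completes the boundary elements to a partition of the
  -- boundary of the open region.
  let ζ : Option IΩ → Set E3 := fun β => β.elim P.Γph D.ζΩ
  have hph : ∀ β, area (D.ζΩ β ∩ P.Γph) = 0 := fun β =>
    measure_mono_null (inter_subset_inter_left _ (hD.ζΩ_elem β).subset)
      (D.area_ΓΩ_inter_Γph hP hD)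
  have h := hF.openRegion.sum_radCoeff hF.family hP.isBounded_openRegion (ζ := ζ)
    (fun β => by
      cases β
      · exact P.isClosed_Γph.measurableSet
      · exact (hD.ζΩ_elem _).measurableSet P.isClosed_ΓΩ)
    (fun β => by
      cases β
      · exact inter_subset_right
      · exact ζΩ_subset_frontier hD _)
    (fun β γ hβγ => by
      rcases β with _ | β <;> rcases γ with _ | γ
      · exact absurd rfl hβγ
      · rw [inter_comm]
        exact hph _
      · exact hph _
      · have hd : Disjoint (D.ζΩ β) (D.ζΩ γ) := hD.ζΩ_disjoint (fun h => hβγ (by rw [h]))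
        change area (D.ζΩ β ∩ D.ζΩ γ) = 0
        rw [hd.inter_eq, measure_empty])
    (by
      refine measure_mono_null ?_ (area_diff_iUnion hD.ζΩ_elem hD.ζΩ_cover)
      rintro y ⟨hy, hy'⟩
      rw [mem_iUnion, not_exists] at hy'
      refine ⟨(P.frontier_openRegion_subset hy).resolve_right (hy' none), fun hu => ?_⟩
      obtain ⟨β, hβ⟩ := mem_iUnion.1 hu
      exact hy' (some β) hβ)
    (ζΩ_subset_frontier hD α)
  rw [Fintype.sum_option, add_comm] at h
  exact h

lemma row_ΛS (hP : P.Admissible) (hD : D.Admissible P) (α : IS) :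
    ∑ β, D.ΛS P α β = area.real (D.ζS α) := by
  obtain ⟨F, hF⟩ := D.exists_isAdaptedFamily hP hD
  exact (hF.sub Phase.gas).sum_radCoeff hF.family (hP.sub_poly _).isBounded
    (fun β => (hD.ζS_elem β).measurableSet isClosed_frontier) (fun β => (hD.ζS_elem β).subset)
    (fun β γ h => by rw [(hD.ζS_disjoint h).inter_eq, measure_empty])
    (area_diff_iUnion hD.ζS_elem hD.ζS_cover) (hD.ζS_elem α).subset

theorem conservative (hP : P.Admissible) (hD : D.Admissible P) : D.Conservative P := by
  obtain ⟨F, hF⟩ := D.exists_isAdaptedFamily hP hD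
  have hO : ∀ S ⊆ frontier P.openRegion, IsFiniteMeasure (area.restrict S) := fun S hS =>
    ⟨by rw [Measure.restrict_apply_univ]; exact D.area_openRegion_frontier_lt_top hP hD hS⟩
  have hS : ∀ S ⊆ P.interface, IsFiniteMeasure (area.restrict S) := fun S hS =>
    ⟨by rw [Measure.restrict_apply_univ]; exact area_interface_lt_top hP hS⟩
  have hζO := ζΩ_subset_frontier hD
  have hph : P.Γph ⊆ frontier P.openRegion := inter_subset_right
  have i1 := fun α => hO _ (hζO α)
  have i2 := hO _ hph
  have i3 := fun α => hS _ (hD.ζS_elem α).subset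
  exact
    { vol_pos := volume_vol_pos hD
      vol_le := volume_vol_le hP hD
      areaζΩ_pos := fun α => ENNReal.toReal_pos (hP.area_pos_of_subset_ΓΩ (hD.ζΩ_elem α)).ne'
        (D.area_openRegion_frontier_lt_top hP hD (hζO α)).ne
      areaζS_pos := fun α => ENNReal.toReal_pos
        (hP.area_pos_of_subset_interface (hD.ζS_elem α)).ne'
        (area_interface_lt_top hP (hD.ζS_elem α).subset).ne
      ΛΩ_nonneg := fun α β => (hF.openRegion.radCoeff_eq hF.family (hζO α) (hζO β)).1
      Λph_nonneg := fun α => (hF.openRegion.radCoeff_eq hF.family (hζO α) hph).1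
      ΛS_nonneg := fun α β => ((hF.sub Phase.gas).radCoeff_eq hF.family (hD.ζS_elem α).subset
        (hD.ζS_elem β).subset).1
      rowΩ := row_ΛΩ hP hD
      rowS := row_ΛS hP hD
      mem_JΩ := fun i α => (mem_JΩ_iff hP hD i α).1
      mem_JS := fun i α => (mem_JS_iff hP hD i α).1
      sumΩ := sum_area_ζΩ hP hD
      sumS := sum_area_ζS hP hD }

end Discretization

end RadHeat

theorem corollary4p3 {I IΩ IS : Type*} [Fintype I] [Fintype IΩ] [Fintype IS]
    (P : RadHeat.Model) (hP : P.Admissible)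
    (D : RadHeat.Discretization I IΩ IS) (hD : D.Admissible P)
    (n : ℕ) (hn : 1 ≤ n) (hnN : n ≤ D.N)
    (u : ℕ → I → ℝ) (hu : D.IsNonnegSolution P (n - 1) u) :
    (∀ v : I → ℝ, (∀ i, 0 ≤ v i) → (∀ i, D.H P n (u (n - 1)) v i = 0) →
      ∀ i, v i ∈ Set.Icc (P.lower (u (n - 1))) (D.upper P n (u (n - 1)))) ∧
    (D.StepCondition P n (u (n - 1)) →
      ∃! v : I → ℝ, (∀ i, 0 ≤ v i) ∧ ∀ i, D.H P n (u (n - 1)) v i = 0) :=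
  (RadHeat.Discretization.conservative hP hD).bounds_and_existsUnique hP hD hn hnN
    (hu.1 (n - 1) le_rfl)
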